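/- **Gauss diagrams.** A Gauss diagram consists of ordered oriented circles $C_1,\dots,C_\mu$ and finitely many oriented chords, each with a sign $\varepsilon=\pm1$, whose endpoints are distinct points of the circles. The initial endpoint of a chord of sign $\varepsilon$ has sign $-\varepsilon$, the terminal endpoint has sign $\varepsilon$. A chord is a self-chord of $C_i$ if both endpoints lie on $C_i$, and a nonself-chord of type $(i,j)$, $i\neq j$, if it is oriented from $C_i$ to $C_j$. An oriented $\mu$-component virtual link $L=K_1\cup\dots\cup K_\mu$ (with ordered components) is an equivalence class of Gauss diagrams with $\mu$ circles under the Reidemeister moves R1, R2, R3 for Gauss diagrams, where a chord is oriented from the over- to the under-crossing. **Shell moves.** A shell for a chord $\gamma$ is a self-chord surrounding one endpoint $x$ of $\gamma$, oriented as the circle if $x$ is positive and against the circle if $x$ is negative; several shells surround $x$ in parallel. The move S1 slides a shell from one endpoint of a chord to its other endpoint and keeps the sign of the shell. The move S2 exchanges two adjacent endpoints $x,y$ of two different chords ($x$ preceding $y$ on the oriented circle) and surrounds $x$ by a new shell of sign $\operatorname{sgn}(x)\operatorname{sgn}(y)$ and $y$ by a new shell of sign $-\operatorname{sgn}(x)\operatorname{sgn}(y)$.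 Two virtual links are S-equivalent if their Gauss diagrams are related by finitely many moves R1, R2, R3, S1, S2 and their inverses. **Invariants.** Let $G$ be a Gauss diagram of $L=K_1\cup K_2$. Let $\mathrm{Lk}(K_i,K_j)$ be the sum of the signs of the nonself-chords of type $(i,j)$, and $\lambda(L)=\mathrm{Lk}(K_1,K_2)-\mathrm{Lk}(K_2,K_1)$. The index of a self-chord of $C_i$ is the sum of the signs of all endpoints on the arc of $C_i$ that runs along the orientation from its initial to its terminal endpoint; if $\lambda(L)=0$, then for $n\neq0$ the $n$-writhe $J_n(K_i;L)$ is the sum of the signs of the self-chords of $C_i$ of index $n$. Fix a nonself-chord $\gamma_0$. The index $\mathrm{Ind}'(\gamma;\gamma_0)$ of a nonself-chord $\gamma$ of type $(i,j)$ is the sum of the signs of all endpoints on the two arcs, taken along the orientations, of $C_i$ from the initial endpoint of $\gamma$ to the endpoint of $\gamma_0$ and of $C_j$ from the endpoint of $\gamma_0$ to the terminal endpoint of $\gamma$. Put $F_{ij}(t;\gamma_0)=\sum_\gamma \operatorname{sgn}(\gamma)\,t^{\mathrm{Ind}'(\gamma;\gamma_0)}\in\mathbb Z[t,t^{-1}]$,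 the sum over the nonself-chords of type $(i,j)$. Let $\Gamma(0)$ be the set of pairs $(f,g)$ of Laurent polynomials in $\mathbb Z[t,t^{-1}]$ modulo $(f,g)\sim(t^kf,t^{-k}g)$, $k\in\mathbb Z$. If $\lambda(L)=0$, the linking class of $L$ is $F(L)=[F_{12}(t;\gamma_0),F_{21}(t;\gamma_0)]\in\Gamma(0)$; it is $[0,0]$ if $G$ has no nonself-chord. These quantities may be computed from any Gauss diagram $G$ of $L$ and any $\gamma_0$. **Theorem.** Let $L=K_1\cup K_2$ and $L'=K_1'\cup K_2'$ be oriented $2$-component virtual links with $\lambda(L)=\lambda(L')=0$. Then $L$ and $L'$ are S-equivalent if and only if (i) $J_n(K_1;L)=J_n(K_1';L')$ for all integers $n\neq0,1$, (ii) $J_n(K_2;L)=J_n(K_2';L')$ for all integers $n\neq0,1$, and (iii) $F(L)=F(L')$ in $\Gamma(0)$. -/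

import Mathlib

namespace VirtualLinks

/-- An endpoint of a chord of a Gauss diagram.  `chord` is the name of the chord, `terminal` says
whether this is the terminal (`true`) or the initial (`false`) endpoint of the oriented chord, and
`sign` is the sign of the chord. -/
structure Endpoint where
  chord : ℕ
  terminal : Bool
  sign : ℤˣ
  deriving DecidableEq

namespace Endpoint

/-- The initial endpoint of the chord `c` of sign `s`. -/
def ini (c : ℕ) (s : ℤˣ) : Endpoint := ⟨c, false, s⟩

/-- The terminal endpoint of the chord `c` of sign `s`. -/
def ter (c : ℕ) (s : ℤˣ) : Endpoint := ⟨c, true, s⟩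

/-- The other endpoint of the same chord. -/
def other (e : Endpoint) : Endpoint := ⟨e.chord, !e.terminal, e.sign⟩

/-- The sign of an endpoint: for a chord of sign `ε` the initial endpoint has sign `-ε` and the
terminal endpoint has sign `ε`. -/
def endSign (e : Endpoint) : ℤˣ := if e.terminal then e.sign else -e.sign

/-- Renaming of chords. -/
def rename (σ : Equiv.Perm ℕ) (e : Endpoint) : Endpoint := ⟨σ e.chord, e.terminal, e.sign⟩

end Endpoint

open Endpoint

/-- A Gauss diagram with `μ` (ordered, oriented) circles.  `circle i` lists the endpoints of chords
met on the `i`-th circle when it is traversed once along its orientation from some base point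
(the empty list is a circle without endpoints).  Each chord has exactly one initial and one
terminal endpoint in the whole diagram.  Diagrams that differ by base points or by the names of the
chords are identified through `Iso` below. -/
structure GaussDiagram (μ : ℕ) where
  circle : Fin μ → List Endpoint
  nodup : ((List.finRange μ).flatMap circle).Nodup
  sign_eq : ∀ e ∈ (List.finRange μ).flatMap circle, ∀ f ∈ (List.finRange μ).flatMap circle,
    e.chord = f.chord → e.sign = f.sign
  other_mem : ∀ e ∈ (List.finRange μ).flatMap circle,
    e.other ∈ (List.finRange μ).flatMap circle

/-! ### Local moves -/

/-- A diagram with `k` open slots: the part of a Gauss diagram that a local move leaves alone.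
The slots may lie on the same circle or on different circles, in any order. -/
abbrev Template (μ k : ℕ) := Fin μ → List (Endpoint ⊕ Fin k)

/-- Insert the words `p 0, …, p (k-1)` in the slots of a template. -/
def Template.fill {μ k : ℕ} (T : Template μ k) (p : Fin k → List Endpoint) :
    Fin μ → List Endpoint :=
  fun i => (T i).flatMap (Sum.elim (fun e => [e]) p)

/-- `G'` is obtained from `G` by replacing disjoint arcs that carry the words `p 0, …, p (k-1)` by
arcs that carry the words `q 0, …, q (k-1)`; nothing else changes. -/
def LocalMove {μ k : ℕ} (p q : Fin k → List Endpoint) (G G' : GaussDiagram μ) : Prop :=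
  ∃ T : Template μ k, (∀ h : Fin k, ∑ i, (T i).count (Sum.inr h) = 1) ∧
    G.circle = T.fill p ∧ G'.circle = T.fill q

/-- Two lists of words describe the same Gauss diagram: change of base points on the circles and
change of the names of chords. -/
def Iso {μ : ℕ} (G G' : GaussDiagram μ) : Prop :=
  ∃ σ : Equiv.Perm ℕ, ∀ i, (G.circle i).map (rename σ) ~r G'.circle i

/-- Reidemeister move R1: a free chord, of any sign and orientation, is born. -/
def R1 {μ : ℕ} (G G' : GaussDiagram μ) : Prop :=
  ∃ e : Endpoint, LocalMove ![[]] ![[e, e.other]] G G'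

/-- Reidemeister move R2: two chords of opposite signs are born, with adjacent initial endpoints
and adjacent terminal endpoints; the two strands run in the same or in opposite directions. -/
def R2 {μ : ℕ} (G G' : GaussDiagram μ) : Prop :=
  ∃ (a b : ℕ) (s : ℤˣ),
    LocalMove ![[], []] ![[ini a s, ini b (-s)], [ter a s, ter b (-s)]] G G' ∨
    LocalMove ![[], []] ![[ini a s, ini b (-s)], [ter b (-s), ter a s]] G G'

/-- The word `[e, f]` if `s = 1` and `[f, e]` if `s = -1`. -/
def ordered (s : ℤˣ) (e f : Endpoint) : List Endpoint := if s = 1 then [e, f] else [f, e]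

/-- Reidemeister move R3, for all orientations of the three strands.  The top strand passes over the
middle strand (chord `a`, sign `r`) and over the bottom strand (chord `b`, sign `s`), and the middle
strand over the bottom strand (chord `c`, sign `t`).  On one side of the move the two endpoints on
each strand are in the order given first, on the other side they are all exchanged. -/
def R3 {μ : ℕ} (G G' : GaussDiagram μ) : Prop :=
  ∃ (a b c : ℕ) (r s t : ℤˣ),
    LocalMove
      ![ordered s (ini a r) (ini b s), ordered t (ter a r) (ini c t),
        ordered (r * s * t) (ter b s) (ter c t)]
      ![ordered (-s) (ini a r) (ini b s), ordered (-t) (ter a r) (ini c t),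
        ordered (-(r * s * t)) (ter b s) (ter c t)] G G'

/-- The endpoint `x` surrounded by a shell, namely the self-chord `c` of sign `s`.  The shell is
oriented as the circle if `x` is positive and against the circle if `x` is negative. -/
def shelled (c : ℕ) (s : ℤˣ) (x : Endpoint) : List Endpoint :=
  if x.endSign = 1 then [ini c s, x, ter c s] else [ter c s, x, ini c s]

/-- Shell move S1: a shell that surrounds one endpoint of a chord slides to the other endpoint of
this chord and keeps its sign. -/
def S1 {μ : ℕ} (G G' : GaussDiagram μ) : Prop :=
  ∃ (x : Endpoint) (c : ℕ) (s : ℤˣ),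
    LocalMove ![shelled c s x, [x.other]] ![[x], shelled c s x.other] G G'

/-- Shell move S2: adjacent endpoints `x`, `y` of two chords are exchanged, and each of the two
chords gets a shell.  With `a`, `b` the signs of the endpoints `x`, `y`, where `x` comes first, the
shell at `x` has sign `a * b` and the shell at `y` has sign `-(a * b)`. -/
def S2 {μ : ℕ} (G G' : GaussDiagram μ) : Prop :=
  ∃ (x y : Endpoint) (c d : ℕ), x.chord ≠ y.chord ∧
    LocalMove ![[x, y]]
      ![shelled d (-(x.endSign * y.endSign)) y ++ shelled c (x.endSign * y.endSign) x] G G'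

/-- One Reidemeister move (or a change of description of the same diagram). -/
def ReidemeisterStep {μ : ℕ} (G G' : GaussDiagram μ) : Prop :=
  Iso G G' ∨ R1 G G' ∨ R2 G G' ∨ R3 G G'

/-- Gauss diagrams related by finitely many Reidemeister moves and their inverses. -/
def reidemeisterSetoid (μ : ℕ) : Setoid (GaussDiagram μ) :=
  Relation.EqvGen.setoid ReidemeisterStep

/-- An oriented virtual link with `μ` ordered components: a class of Gauss diagrams with `μ` circles
up to Reidemeister moves. -/
def VirtualLink (μ : ℕ) : Type := Quotient (reidemeisterSetoid μ)

/-- `G` is a Gauss diagram of `L`. -/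
def IsDiagramOf {μ : ℕ} (G : GaussDiagram μ) (L : VirtualLink μ) : Prop :=
  Quotient.mk (reidemeisterSetoid μ) G = L

/-- S-equivalence of Gauss diagrams: finitely many Reidemeister and shell moves and their
inverses. -/
def GaussDiagram.SEquiv {μ : ℕ} : GaussDiagram μ → GaussDiagram μ → Prop :=
  Relation.EqvGen fun G G' => ReidemeisterStep G G' ∨ S1 G G' ∨ S2 G G'

/-- S-equivalence of virtual links. -/
def VirtualLink.SEquiv {μ : ℕ} (L L' : VirtualLink μ) : Prop :=
  ∃ G G' : GaussDiagram μ, IsDiagramOf G L ∧ IsDiagramOf G' L' ∧ G.SEquiv G'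

/-! ### Invariants -/

/-- The endpoints met on the closed arc from `e` to `f` along the orientation of a circle with
cyclic word `w`.  If `e = f` the arc is a single point. -/
def arc (w : List Endpoint) (e f : Endpoint) : List Endpoint :=
  (w.rotate (w.idxOf e)).takeWhile (fun x => decide (x ≠ f)) ++ [f]

/-- The sum of the signs of endpoints on an arc. -/
def signSum (l : List Endpoint) : ℤ := (l.map fun e => (e.endSign : ℤ)).sum

namespace GaussDiagram

/-- The chords from the circle `i` to the circle `j`, each given by its initial endpoint.  For
`i = j` these are the self-chords spanning circle `i`, for `i ≠ j` the nonself-chords of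
type `(i, j)`. -/
def chords {μ : ℕ} (G : GaussDiagram μ) (i j : Fin μ) : List Endpoint :=
  (G.circle i).filter fun e => decide (e.terminal = false ∧ e.other ∈ G.circle j)

/-- The linking number `Lk(K_i, K_j)`, for `i ≠ j`. -/
def lk {μ : ℕ} (G : GaussDiagram μ) (i j : Fin μ) : ℤ :=
  ((G.chords i j).map fun e => (e.sign : ℤ)).sum

/-- The virtual linking number `λ = Lk(K_1, K_2) - Lk(K_2, K_1)`. -/
def virtualLk (G : GaussDiagram 2) : ℤ := G.lk 0 1 - G.lk 1 0

/-- The index of the self-chord of circle `i` with initial endpoint `e`: the sum of the signs of the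
endpoints of all chords on the arc from the initial to the terminal endpoint. -/
def selfIndex {μ : ℕ} (G : GaussDiagram μ) (i : Fin μ) (e : Endpoint) : ℤ :=
  signSum (arc (G.circle i) e e.other)

/-- The `n`-writhe of the `i`-th component: the sum of the signs of the self-chords of circle `i`
that have index `n`. -/
def writhe {μ : ℕ} (G : GaussDiagram μ) (i : Fin μ) (n : ℤ) : ℤ :=
  (((G.chords i i).filter fun e => decide (G.selfIndex i e = n)).map
    fun e => (e.sign : ℤ)).sum

/-- The index of the nonself-chord of type `(i, j)` with initial endpoint `e` with respect to a
nonself-chord whose endpoint on circle `k` is `p k`: the sum of the signs of the endpoints on the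
arc of circle `i` from `e` to `p i` and on the arc of circle `j` from `p j` to the terminal endpoint
of the chord. -/
def nonselfIndex (G : GaussDiagram 2) (p : Fin 2 → Endpoint) (i j : Fin 2) (e : Endpoint) : ℤ :=
  signSum (arc (G.circle i) e (p i)) + signSum (arc (G.circle j) (p j) e.other)

/-- The Laurent polynomial `F_{ij}(t; γ₀)`, in which each nonself-chord `γ` of type `(i, j)`
contributes its sign times `t ^ Ind'(γ; γ₀)`. -/
noncomputable def linkingPoly (G : GaussDiagram 2) (p : Fin 2 → Endpoint) (i j : Fin 2) :
    LaurentPolynomial ℤ :=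
  ((G.chords i j).map fun e =>
    (e.sign : ℤ) • (LaurentPolynomial.T (G.nonselfIndex p i j e) : LaurentPolynomial ℤ)).sum

end GaussDiagram

/-- Pairs of Laurent polynomials up to `(f, g) ↦ (t ^ k f, t ^ (-k) g)` with `k` an integer. -/
def gammaSetoid : Setoid (LaurentPolynomial ℤ × LaurentPolynomial ℤ) where
  r x y := ∃ k : ℤ, y.1 = LaurentPolynomial.T k * x.1 ∧ y.2 = LaurentPolynomial.T (-k) * x.2
  iseqv := by
    refine ⟨fun x => ⟨0, by simp⟩, ?_, ?_⟩
    · rintro x y ⟨k, h1, h2⟩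
      refine ⟨-k, ?_, ?_⟩
      · rw [h1, ← mul_assoc, ← LaurentPolynomial.T_add]; simp
      · rw [h2, ← mul_assoc, ← LaurentPolynomial.T_add]; simp
    · rintro x y z ⟨k, h1, h2⟩ ⟨l, h3, h4⟩
      refine ⟨l + k, ?_, ?_⟩
      · rw [h3, h1, ← mul_assoc, ← LaurentPolynomial.T_add]
      · rw [h4, h2, ← mul_assoc, ← LaurentPolynomial.T_add, neg_add]

/-- The set `Γ(0)`. -/
def Gamma0 : Type := Quotient gammaSetoid

/-- `F` is the linking class in `Γ(0)` computed from the Gauss diagram `G` of a link with virtual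
linking number `0`: the class of `(F_{12}(t; γ₀), F_{21}(t; γ₀))` for some nonself-chord `γ₀` of
`G`, with endpoints `x` on the first and `x.other` on the second circle.  A diagram without
nonself-chords has the class of `(0, 0)`: a pair of nonself-chords born by R2 contributes
`t ^ 0 - t ^ 0` when one of them is taken as `γ₀`. -/
def GaussDiagram.IsLinkingClass (G : GaussDiagram 2) (F : Gamma0) : Prop :=
  (∃ x ∈ G.circle 0, x.other ∈ G.circle 1 ∧
    F = Quotient.mk gammaSetoid
      (G.linkingPoly ![x, x.other] 0 1, G.linkingPoly ![x, x.other] 1 0)) ∨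
  ((∀ x ∈ G.circle 0, x.other ∉ G.circle 1) ∧ F = Quotient.mk gammaSetoid (0, 0))

/-- Every Gauss diagram with two circles has a linking class. -/
theorem GaussDiagram.exists_isLinkingClass (G : GaussDiagram 2) : ∃ F, G.IsLinkingClass F := by
  by_cases h : ∃ x ∈ G.circle 0, x.other ∈ G.circle 1
  · obtain ⟨x, hx, hy⟩ := h
    exact ⟨_, Or.inl ⟨x, hx, hy, rfl⟩⟩
  · exact ⟨_, Or.inr ⟨fun x hx hy => h ⟨x, hx, hy⟩, rfl⟩⟩

end VirtualLinks

/-!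
Cut each circle of a Gauss diagram at a base point, and give an endpoint the height equal to the
sum of the signs of the endpoints up to it (including itself exactly if it is terminal). When
`λ = 0`, the signs on each circle add up to zero, so heights are independent of the base points up to a
constant on each circle. The index of a chord is the height of its terminal endpoint minus the
height of its initial endpoint, up to a constant for each type of nonself-chords. The `n`-writhes
and the linking class are therefore encoded in the numbers `GaussDiagram.coef`, the sums of the
signs of the chords of type `(i, j)` and index `n`; the ambiguity of the linking class is the
choice of the base points (`writhe_eq`, `linkingClass_eq_iff`).

*Invariance.* A local move replaces words by words of the same sign sums, so all other endpoints
keep their heights. The chords born in R2 cancel in `coef`, a chord born in R1 is a self-chord of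
index `0`, shells are self-chords of index `1`, and R3 keeps the indices of its three chords. A
shell of sign `s` lowers the height of the endpoint `x` that it surrounds by `s * x.endSign`
(`locate_shelled`). So a shell has the same effect on the index of a chord at either endpoint, and
the shells born in S2 compensate exactly for the exchange of the two endpoints. Hence the numbers
`coef` of S-equivalent diagrams agree, up to a shift of the heights on the circles, except for the
self-chords of index `0` and `1` (`SEquiv.sameInvariants`).

*Classification.* For the converse, chords are given stacks of shells. By S1 and R2, only the total
number of shells on a chord matters (`Sim.withShells_congr`), so shells can be used to give each
chord an arbitrary prescribed index; `withIndex w I` is the diagram `w` with shells such that the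
chord `c` has index `I c`. With this normalization S2 reads: adjacent endpoints of different chords
commute (`Sim.swap`). Adjacent endpoints of the same chord commute as well (`Sim.flip`), so that
the order of the endpoints on the circles is irrelevant (`Sim.perm`), and `withIndex w I` depends
only on the list of the chords with their types, signs and indices. Two chords of the same type and
index and of opposite signs cancel by R2 (`Sim.parallel`), and self-chords of index `0` or `1`
disappear by R1 or R2 (`Sim.isolated`, `Sim.isolated_one`). It follows that the class depends only
on the coefficients (`IndexedChord.sim_of_coef`): insert the chords of the second diagram together
with their negatives in the first diagram, and cancel the negatives against either set of chords.
Finally the indices of the nonself-chords can be shifted by carrying one endpoint of an isolated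
chord once around a circle (`Sim.shift`), which accounts for the relation in `Γ(0)`. The move R3 is
not needed in this direction.
-/

namespace VirtualLinks

open Endpoint

/-! ### Well-formed words -/

/-- The conditions on the list of all endpoints of a Gauss diagram. -/
def WellFormed (l : List Endpoint) : Prop :=
  l.Nodup ∧ (∀ e ∈ l, ∀ f ∈ l, e.chord = f.chord → e.sign = f.sign) ∧ ∀ e ∈ l, e.other ∈ l

namespace Endpoint

@[simp] lemma other_other (e : Endpoint) : e.other.other = e := by
  cases e; simp [other]

@[simp] lemma other_chord (e : Endpoint) : e.other.chord = e.chord := rfl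

@[simp] lemma other_sign (e : Endpoint) : e.other.sign = e.sign := rfl

@[simp] lemma other_terminal (e : Endpoint) : e.other.terminal = !e.terminal := rfl

@[simp] lemma other_ini (c : ℕ) (s : ℤˣ) : (ini c s).other = ter c s := rfl

@[simp] lemma other_ter (c : ℕ) (s : ℤˣ) : (ter c s).other = ini c s := rfl

@[simp] lemma ini_chord (c : ℕ) (s : ℤˣ) : (ini c s).chord = c := rfl

@[simp] lemma ter_chord (c : ℕ) (s : ℤˣ) : (ter c s).chord = c := rfl

@[simp] lemma ini_sign (c : ℕ) (s : ℤˣ) : (ini c s).sign = s := rfl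

@[simp] lemma ter_sign (c : ℕ) (s : ℤˣ) : (ter c s).sign = s := rfl

@[simp] lemma ini_terminal (c : ℕ) (s : ℤˣ) : (ini c s).terminal = false := rfl

@[simp] lemma ter_terminal (c : ℕ) (s : ℤˣ) : (ter c s).terminal = true := rfl

@[simp] lemma endSign_ini (c : ℕ) (s : ℤˣ) : (ini c s).endSign = -s := rfl

@[simp] lemma endSign_ter (c : ℕ) (s : ℤˣ) : (ter c s).endSign = s := rfl

@[simp] lemma endSign_other (e : Endpoint) : e.other.endSign = -e.endSign := by
  rcases e with ⟨c, _ | _, s⟩ <;> simp [other, endSign]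

@[simp] lemma endSign_rename (σ : Equiv.Perm ℕ) (e : Endpoint) :
    (rename σ e).endSign = e.endSign := rfl

@[simp] lemma rename_other (σ : Equiv.Perm ℕ) (e : Endpoint) :
    rename σ e.other = (rename σ e).other := rfl

lemma other_ne (e : Endpoint) : e.other ≠ e := fun h => by
  have := congrArg terminal h
  simp at this

lemma other_injective : Function.Injective other := fun e f h => by
  rw [← other_other e, h, other_other]

lemma rename_injective (σ : Equiv.Perm ℕ) : Function.Injective (rename σ) := by
  rintro ⟨a, b, c⟩ ⟨a', b', c'⟩ h
  simp only [rename, mk.injEq, EmbeddingLike.apply_eq_iff_eq] at h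
  simp [h]

lemma eq_or_eq_other {e f : Endpoint} (h : f.chord = e.chord) (hs : f.sign = e.sign) :
    f = e ∨ f = e.other := by
  rcases e with ⟨a, _ | _, c⟩ <;> rcases f with ⟨a', _ | _, c'⟩ <;> simp_all [other]

end Endpoint

namespace WellFormed

variable {l l' : List Endpoint}

lemma perm (h : WellFormed l) (hp : l.Perm l') : WellFormed l' := by
  refine ⟨hp.nodup_iff.1 h.1, ?_, ?_⟩
  · intro e he f hf
    exact h.2.1 e (hp.mem_iff.2 he) f (hp.mem_iff.2 hf)
  · intro e he
    exact hp.mem_iff.1 (h.2.2 e (hp.mem_iff.2 he))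

lemma eq_or_eq_other (h : WellFormed l) {e f : Endpoint} (he : e ∈ l) (hf : f ∈ l)
    (hc : f.chord = e.chord) : f = e ∨ f = e.other :=
  Endpoint.eq_or_eq_other hc (h.2.1 f hf e he hc)

lemma chord_ne {e f : Endpoint} (h : WellFormed (e :: e.other :: l)) (hf : f ∈ l) :
    f.chord ≠ e.chord := by
  intro hc
  have hn := h.1
  simp only [List.nodup_cons, List.mem_cons, not_or] at hn
  rcases h.eq_or_eq_other (e := e) (f := f) (by simp) (by simp [hf]) hc with rfl | rfl
  · exact hn.1.2 hf
  · exact hn.2.1 hf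

lemma cons_pair (h : WellFormed l) {e : Endpoint} (he : ∀ f ∈ l, f.chord ≠ e.chord) :
    WellFormed (e :: e.other :: l) := by
  refine ⟨?_, ?_, ?_⟩
  · simp only [List.nodup_cons, List.mem_cons, not_or]
    exact ⟨⟨e.other_ne.symm, fun h => he _ h rfl⟩, fun h => he _ h rfl, h.1⟩
  · intro a ha b hb hab
    simp only [List.mem_cons] at ha hb
    rcases ha with rfl | rfl | ha <;> rcases hb with rfl | rfl | hb <;> try rfl
    · exact absurd hab.symm (he _ hb)
    · exact absurd hab.symm (he _ hb)
    · exact absurd hab (he _ ha)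
    · exact absurd hab (he _ ha)
    · exact h.2.1 a ha b hb hab
  · intro a ha
    simp only [List.mem_cons] at ha ⊢
    rcases ha with rfl | rfl | ha
    · simp
    · simp
    · exact Or.inr (Or.inr (h.2.2 a ha))

lemma of_cons_pair {e : Endpoint} (h : WellFormed (e :: e.other :: l)) : WellFormed l := by
  refine ⟨?_, ?_, ?_⟩
  · have := h.1
    simp only [List.nodup_cons] at this
    exact this.2.2
  · intro a ha b hb
    exact h.2.1 a (by simp [ha]) b (by simp [hb])
  · intro a ha
    have h1 := h.2.2 a (by simp [ha])
    have h2 := h.chord_ne ha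
    simp only [List.mem_cons] at h1
    rcases h1 with h1 | h1 | h1
    · exact absurd (congrArg chord h1) h2
    · exact absurd (congrArg chord h1) h2
    · exact h1

end WellFormed

lemma GaussDiagram.wellFormed (G : GaussDiagram 2) :
    WellFormed (G.circle 0 ++ G.circle 1) := by
  have h : (List.finRange 2).flatMap G.circle = G.circle 0 ++ G.circle 1 := by
    simp [List.finRange_succ]
  exact ⟨h ▸ G.nodup, h ▸ G.sign_eq, h ▸ G.other_mem⟩

/-! ### Heights of endpoints -/

@[simp] lemma signSum_nil : signSum [] = 0 := rfl

@[simp] lemma signSum_cons (e : Endpoint) (l : List Endpoint) :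
    signSum (e :: l) = e.endSign + signSum l := by simp [signSum]

@[simp] lemma signSum_append (l m : List Endpoint) :
    signSum (l ++ m) = signSum l + signSum m := by simp [signSum]

lemma signSum_perm {l m : List Endpoint} (h : l.Perm m) : signSum l = signSum m :=
  (h.map _).sum_eq

/-- An endpoint together with the circle on which it lies and its height there. -/
abbrev Located := Endpoint × Fin 2 × ℤ

/-- The height of an endpoint `e`, if the endpoints before it have sign sum `b`: the sum of the
signs up to and including `e` if `e` is terminal, the sum of the signs before `e` if `e` is initial.
With this convention the index of a chord is the height of its terminal endpoint minus the height
of its initial endpoint. -/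
def height (b : ℤ) (e : Endpoint) : ℤ := if e.terminal then b + e.endSign else b

lemma height_add (b t : ℤ) (e : Endpoint) : height (b + t) e = height b e + t := by
  unfold height; split_ifs <;> ring

/-- The endpoints of a word on circle `i`, with their heights over the base height `b`. -/
def locate (i : Fin 2) : ℤ → List Endpoint → List Located
  | _, [] => []
  | b, e :: l => (e, i, height b e) :: locate i (b + e.endSign) l

lemma locate_append (i : Fin 2) (b : ℤ) (l m : List Endpoint) :
    locate i b (l ++ m) = locate i b l ++ locate i (b + signSum l) m := by
  induction l generalizing b with
  | nil => simp [locate]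
  | cons e l ih => simp [locate, ih, add_assoc]

@[simp] lemma map_fst_locate (i : Fin 2) (b : ℤ) (l : List Endpoint) :
    (locate i b l).map Prod.fst = l := by
  induction l generalizing b with
  | nil => rfl
  | cons e l ih => simp [locate, ih]

lemma locate_add (i : Fin 2) (b t : ℤ) (l : List Endpoint) :
    locate i (b + t) l = (locate i b l).map fun a => (a.1, a.2.1, a.2.2 + t) := by
  induction l generalizing b with
  | nil => rfl
  | cons e l ih =>
    simp only [locate, List.map_cons, ← ih, height_add]
    rw [add_right_comm]

/-- All endpoints of a pair of words, with their circles and heights. -/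
def located (D : Fin 2 → List Endpoint) : Multiset Located :=
  ↑(locate 0 0 (D 0) ++ locate 1 0 (D 1))

lemma map_fst_located (D : Fin 2 → List Endpoint) :
    (located D).map Prod.fst = ↑(D 0 ++ D 1) := by
  simp [located]

/-- The contribution of the pair `a`, `b` to the `n`-th coefficient of chords from circle `i` to
circle `j`: the sign of the chord if `a` and `b` are the two ends of such a chord of index `n`,
and zero otherwise. -/
def weight (i j : Fin 2) (n : ℤ) (a b : Located) : ℤ :=
  if a.1.terminal = false ∧ b.1 = a.1.other ∧ a.2.1 = i ∧ b.2.1 = j ∧ b.2.2 - a.2.2 = n then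
    a.1.sign else 0

/-- The sum of the signs of the chords of type `(i, j)` and index `n` in a multiset of located
endpoints.  Written as a quadratic expression, it is easily compared for diagrams that differ in a
few chords. -/
def coefOf (i j : Fin 2) (n : ℤ) (A : Multiset Located) : ℤ :=
  (A.map fun a => (A.map fun b => weight i j n a b).sum).sum

lemma weight_eq_zero (i j : Fin 2) (n : ℤ) {a b : Located} (h : a.1.chord ≠ b.1.chord) :
    weight i j n a b = 0 := by
  unfold weight
  rw [if_neg]
  rintro ⟨-, h2, -⟩
  exact h (by rw [h2]; rfl)

lemma weight_self (i j : Fin 2) (n : ℤ) (a b : Located) (h : a.1 = b.1) :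
    weight i j n a b = 0 := by
  unfold weight
  rw [if_neg]
  rintro ⟨-, h2, -⟩
  exact a.1.other_ne (by rw [← h2, h])

lemma coefOf_cons_cons (i j : Fin 2) (n : ℤ) {a b : Located} {A : Multiset Located}
    (hab : b.1 = a.1.other) (hA : ∀ x ∈ A, x.1.chord ≠ a.1.chord) :
    coefOf i j n (a ::ₘ b ::ₘ A) = weight i j n a b + weight i j n b a + coefOf i j n A := by
  have hb : b.1.chord = a.1.chord := by rw [hab]; rfl
  have h1 : ∀ c : Located, c.1.chord = a.1.chord →
      (A.map fun x => weight i j n c x).sum = 0 := by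
    intro c hc
    rw [Multiset.map_congr rfl (g := fun _ => (0 : ℤ))]
    · simp
    · intro x hx
      exact weight_eq_zero _ _ _ (by rw [hc]; exact (hA x hx).symm)
  have h2 : (A.map fun x => weight i j n x a + (weight i j n x b +
      (A.map fun y => weight i j n x y).sum)).sum = coefOf i j n A := by
    unfold coefOf
    congr 1
    refine Multiset.map_congr rfl fun x hx => ?_
    rw [weight_eq_zero i j n (hA x hx), weight_eq_zero i j n (by rw [hb]; exact hA x hx)]
    ring
  rw [coefOf]
  simp only [Multiset.map_cons, Multiset.sum_cons]
  rw [h1 a rfl, h1 b hb, h2, weight_self i j n a a rfl, weight_self i j n b b rfl]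
  ring

/-- Only the difference of the heights of the two ends of a chord matters. -/
lemma weight_congr (i j i' j' : Fin 2) (n : ℤ) {p q p' q' : ℤ} (e f : Endpoint)
    (h : q - p = q' - p') :
    weight i j n (e, i', p) (f, j', q) = weight i j n (e, i', p') (f, j', q') := by
  simp [weight, h]

/-- The coefficients considered in the classification: those of chords between different circles,
and those of self-chords of index other than `0` and `1`. -/
def Essential (i j : Fin 2) (n : ℤ) : Prop := i = j → n ≠ 0 ∧ n ≠ 1

lemma weight_of_not_essential {i j : Fin 2} {n : ℤ} (h : Essential i j n) (i' : Fin 2) {p q : ℤ}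
    (e f : Endpoint) (hpq : q - p = 0 ∨ q - p = 1) :
    weight i j n (e, i', p) (f, i', q) = 0 := by
  unfold weight
  rw [if_neg]
  rintro ⟨-, -, h1, h2, h3⟩
  have := h (h1 ▸ h2)
  dsimp only at h3
  omega

lemma weight_terminal (i j : Fin 2) (n : ℤ) {a b : Located} (h : a.1.terminal = true) :
    weight i j n a b = 0 := by
  unfold weight
  rw [if_neg]
  rintro ⟨h1, -⟩
  simp [h1] at h

lemma forall_chord_ne {l : List Endpoint} (hl : WellFormed l) {A : Multiset Located}
    {a b : Located} (hab : b.1 = a.1.other)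
    (h : (a ::ₘ b ::ₘ A).map Prod.fst = ↑l) : ∀ x ∈ A, x.1.chord ≠ a.1.chord := by
  intro x hx
  induction A using Quotient.inductionOn with
  | h A =>
    have hp : (a.1 :: a.1.other :: A.map Prod.fst).Perm l := by
      rw [← Multiset.coe_eq_coe, ← h]
      simp [hab]
    exact (hl.perm hp.symm).chord_ne (List.mem_map_of_mem hx)

/-! ### Local moves and located endpoints -/

/-- The derived boolean equality on a sum type is lawful. -/
instance sumLawfulBEq {α β : Type*} [BEq α] [BEq β] [LawfulBEq α] [LawfulBEq β] :
    LawfulBEq (α ⊕ β) where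
  eq_of_beq := by
    rintro (a | a) (b | b) h
    · exact congrArg _ (eq_of_beq (show (a == b) = true from h))
    · cases h
    · cases h
    · exact congrArg _ (eq_of_beq (show (a == b) = true from h))
  rfl := by
    rintro (a | a)
    · exact beq_self_eq_true a
    · exact beq_self_eq_true a

lemma locate_fill {k : ℕ} (i : Fin 2) (S : Fin k → ℤ) (t : List (Endpoint ⊕ Fin k)) (b : ℤ) :
    ∃ (R : Multiset Located) (L : List (Fin k × Fin 2 × ℤ)) (d : ℤ),
      (∀ h, (L.map Prod.fst).count h = t.count (Sum.inr h)) ∧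
      ∀ p : Fin k → List Endpoint, (∀ h, signSum (p h) = S h) →
        signSum (t.flatMap (Sum.elim (fun e => [e]) p)) = d ∧
        (locate i b (t.flatMap (Sum.elim (fun e => [e]) p)) : Multiset Located) =
          R + (L.map fun x => (locate x.2.1 x.2.2 (p x.1) : Multiset Located)).sum := by
  induction t generalizing b with
  | nil => exact ⟨0, [], 0, by simp, by simp [locate]⟩
  | cons a t ih =>
    rcases a with e | h
    · obtain ⟨R, L, d, h1, h2⟩ := ih (b + e.endSign)
      refine ⟨(e, i, height b e) ::ₘ R, L, e.endSign + d, fun h => ?_, fun p hp => ?_⟩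
      · rw [h1, List.count_cons_of_ne (by simp)]
      obtain ⟨h3, h4⟩ := h2 p hp
      refine ⟨by simp [h3], ?_⟩
      simp only [List.flatMap_cons, Sum.elim_inl, List.cons_append, List.nil_append, locate]
      rw [← Multiset.cons_coe, h4, Multiset.cons_add]
    · obtain ⟨R, L, d, h1, h2⟩ := ih (b + S h)
      refine ⟨R, (h, i, b) :: L, S h + d, ?_, fun p hp => ?_⟩
      · intro h'
        by_cases hh : h = h'
        · subst hh
          simp [h1]
        · simp [hh, h1, List.count_cons_of_ne]
      · obtain ⟨h3, h4⟩ := h2 p hp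
        refine ⟨by simp [h3, hp], ?_⟩
        simp only [List.flatMap_cons, Sum.elim_inr, List.map_cons, List.sum_cons]
        rw [locate_append, hp, ← Multiset.coe_add, h4]
        abel

/-- If a template is filled with words of prescribed sign sums, the located endpoints outside the
slots do not depend on these words. -/
lemma located_fill {k : ℕ} (T : Template 2 k) (hT : ∀ h : Fin k, ∑ i, (T i).count (Sum.inr h) = 1)
    (S : Fin k → ℤ) :
    ∃ (R : Multiset Located) (c : Fin k → Fin 2) (b : Fin k → ℤ) (d : Fin 2 → ℤ),
      ∀ p : Fin k → List Endpoint, (∀ h, signSum (p h) = S h) →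
        (∀ i, signSum (T.fill p i) = d i) ∧
        located (T.fill p) = R + ∑ h, (locate (c h) (b h) (p h) : Multiset Located) := by
  obtain ⟨R0, L0, d0, h0, h0'⟩ := locate_fill 0 S (T 0) 0
  obtain ⟨R1, L1, d1, h1, h1'⟩ := locate_fill 1 S (T 1) 0
  have hc : ∀ h, ((L0 ++ L1).map Prod.fst).count h = 1 := by
    intro h
    have := hT h
    rw [Fin.sum_univ_two] at this
    rw [List.map_append, List.count_append, h0, h1, this]
  have hperm : ((L0 ++ L1).map Prod.fst).Perm (List.finRange k) := by
    rw [List.perm_iff_count]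
    intro h
    rw [hc, List.count_eq_one_of_mem (List.nodup_finRange k) (List.mem_finRange h)]
  have hnd : ((L0 ++ L1).map Prod.fst).Nodup := hperm.nodup_iff.2 (List.nodup_finRange k)
  have hex : ∀ h : Fin k, ∃ y, (h, y) ∈ L0 ++ L1 := by
    intro h
    have : h ∈ (L0 ++ L1).map Prod.fst := hperm.mem_iff.2 (List.mem_finRange h)
    obtain ⟨⟨x, y⟩, hx, rfl⟩ := List.mem_map.1 this
    exact ⟨y, hx⟩
  choose y hy using hex
  have huniq : ∀ x ∈ L0 ++ L1, x.2 = y x.1 := by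
    intro x hx
    have := List.inj_on_of_nodup_map hnd hx (hy x.1) rfl
    exact congrArg Prod.snd this
  refine ⟨R0 + R1, fun h => (y h).1, fun h => (y h).2, ![d0, d1], fun p hp => ⟨?_, ?_⟩⟩
  · intro i
    fin_cases i
    · exact (h0' p hp).1
    · exact (h1' p hp).1
  · have hsum : ∑ h, (locate (y h).1 (y h).2 (p h) : Multiset Located) =
        ((L0 ++ L1).map fun x => (locate x.2.1 x.2.2 (p x.1) : Multiset Located)).sum := by
      rw [List.map_congr_left (g := fun x =>
        ((fun h => (locate (y h).1 (y h).2 (p h) : Multiset Located)) ∘ Prod.fst) x)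
        (fun x hx => by simp [← huniq x hx]), ← List.map_map, (hperm.map _).sum_eq]
      exact (List.sum_ofFn (f := fun h => (locate (y h).1 (y h).2 (p h) : Multiset Located))
        ▸ by rw [List.ofFn_eq_map])
    rw [hsum, located, ← Multiset.coe_add]
    simp only [Template.fill]
    rw [(h0' p hp).2, (h1' p hp).2, List.map_append, List.sum_append]
    abel

/-! ### Invariance under local moves -/

/-- The endpoints in `A` satisfy the conditions on the endpoints of a Gauss diagram. -/
def WellLocated (A : Multiset Located) : Prop :=
  ∃ l : List Endpoint, WellFormed l ∧ A.map Prod.fst = ↑l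

lemma GaussDiagram.wellLocated (G : GaussDiagram 2) : WellLocated (located G.circle) :=
  ⟨_, G.wellFormed, map_fst_located _⟩

lemma WellLocated.of_cons_cons {a b : Located} {A : Multiset Located}
    (h : WellLocated (a ::ₘ b ::ₘ A)) (hab : b.1 = a.1.other) : WellLocated A := by
  obtain ⟨l, hl, he⟩ := h
  induction A using Quotient.inductionOn with
  | h A =>
    have hp : l.Perm (a.1 :: a.1.other :: A.map Prod.fst) := by
      rw [← Multiset.coe_eq_coe, ← he]
      simp [hab]
    exact ⟨A.map Prod.fst, (hl.perm hp).of_cons_pair, by simp⟩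

lemma WellLocated.coefOf_cons_cons {a b : Located} {A : Multiset Located}
    (h : WellLocated (a ::ₘ b ::ₘ A)) (hab : b.1 = a.1.other) (i j : Fin 2) (n : ℤ) :
    coefOf i j n (a ::ₘ b ::ₘ A) = weight i j n a b + weight i j n b a + coefOf i j n A := by
  obtain ⟨l, hl, he⟩ := h
  exact VirtualLinks.coefOf_cons_cons i j n hab (forall_chord_ne hl hab he)

namespace GaussDiagram

/-- The sum of the signs of the chords of type `(i, j)` and index `n`. -/
def coef (G : GaussDiagram 2) (i j : Fin 2) (n : ℤ) : ℤ := coefOf i j n (located G.circle)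

/-- On each circle the signs of the endpoints add up to zero. -/
def Balanced (G : GaussDiagram 2) : Prop := ∀ i, signSum (G.circle i) = 0

/-- The diagrams have the same sign sums on their circles and the same essential coefficients. -/
def SameCoefs (G G' : GaussDiagram 2) : Prop :=
  (∀ i, signSum (G.circle i) = signSum (G'.circle i)) ∧
    ∀ i j n, Essential i j n → G.coef i j n = G'.coef i j n

end GaussDiagram

lemma LocalMove.located_eq {k : ℕ} {p q : Fin k → List Endpoint} {G G' : GaussDiagram 2}
    (h : LocalMove p q G G') (hs : ∀ h, signSum (q h) = signSum (p h)) :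
    (∀ i, signSum (G.circle i) = signSum (G'.circle i)) ∧
    ∃ (R : Multiset Located) (c : Fin k → Fin 2) (b : Fin k → ℤ),
      located G.circle = R + ∑ h, (locate (c h) (b h) (p h) : Multiset Located) ∧
      located G'.circle = R + ∑ h, (locate (c h) (b h) (q h) : Multiset Located) := by
  obtain ⟨T, hT, h1, h2⟩ := h
  obtain ⟨R, c, b, d, H⟩ := located_fill T hT (fun h => signSum (p h))
  have hp := H p (fun _ => rfl)
  have hq := H q hs
  rw [h1, h2]
  exact ⟨fun i => (hp.1 i).trans (hq.1 i).symm, R, c, b, hp.2, hq.2⟩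

lemma units_cases (s : ℤˣ) : s = 1 ∨ s = -1 := Int.units_eq_one_or s

lemma sameCoefs_of_R1 {G G' : GaussDiagram 2} (h : R1 G G') : G.SameCoefs G' := by
  obtain ⟨e, h⟩ := h
  obtain ⟨hs, R, c, b, h1, h2⟩ := h.located_eq (by intro h; fin_cases h; simp)
  refine ⟨hs, fun i j n hn => ?_⟩
  have w := G'.wellLocated
  unfold GaussDiagram.coef
  have e1 : located G.circle = R := by rw [h1]; simp [locate]
  have e2 : located G'.circle = (e, c 0, height (b 0) e) ::ₘ
      (e.other, c 0, height (b 0 + e.endSign) e.other) ::ₘ R := by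
    rw [h2]
    simp only [Fin.sum_univ_one, Matrix.cons_val_zero, locate, ← Multiset.cons_coe,
      Multiset.coe_nil, ← Multiset.singleton_add, add_zero]
    abel
  rw [e2] at w
  rw [e1, e2, w.coefOf_cons_cons rfl, weight_of_not_essential hn, weight_of_not_essential hn]
  · ring
  all_goals
    left
    rcases e with ⟨_, _ | _, s⟩ <;> simp [height, other, endSign]

lemma sameCoefs_of_R2 {G G' : GaussDiagram 2} (h : R2 G G') : G.SameCoefs G' := by
  obtain ⟨a, b, s, h | h⟩ := h
  all_goals
    obtain ⟨hs, R, c, β, h1, h2⟩ := h.located_eq (by intro h; fin_cases h <;> simp)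
    refine ⟨hs, fun i j n hn => ?_⟩
    have w := G'.wellLocated
    unfold GaussDiagram.coef
    have e1 : located G.circle = R := by rw [h1]; simp [locate]
  · have e2 : located G'.circle = (ini a s, c 0, β 0) ::ₘ (ter a s, c 1, β 1 + s) ::ₘ
        (ini b (-s), c 0, β 0 - s) ::ₘ (ter b (-s), c 1, β 1) ::ₘ R := by
      rw [h2]
      simp [locate, ← Multiset.cons_coe, ← Multiset.singleton_add, height, ← sub_eq_add_neg]
      abel
    rw [e2] at w
    rw [e1, e2, w.coefOf_cons_cons rfl, (w.of_cons_cons rfl).coefOf_cons_cons rfl,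
      weight_terminal _ _ _ (a := (ter a s, _)) rfl,
      weight_terminal _ _ _ (a := (ter b (-s), _)) rfl]
    simp only [weight, ini_terminal, other_ini, ini_sign]
    have : β 1 - (β 0 - s) = β 1 + s - β 0 := by ring
    rw [this]
    simp only [true_and]
    split_ifs <;> simp
  · have e2 : located G'.circle = (ini a s, c 0, β 0) ::ₘ (ter a s, c 1, β 1) ::ₘ
        (ini b (-s), c 0, β 0 - s) ::ₘ (ter b (-s), c 1, β 1 - s) ::ₘ R := by
      rw [h2]
      simp [locate, ← Multiset.cons_coe, ← Multiset.singleton_add, height, ← sub_eq_add_neg]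
      abel
    rw [e2] at w
    rw [e1, e2, w.coefOf_cons_cons rfl, (w.of_cons_cons rfl).coefOf_cons_cons rfl,
      weight_terminal _ _ _ (a := (ter a s, _)) rfl,
      weight_terminal _ _ _ (a := (ter b (-s), _)) rfl]
    simp only [weight, ini_terminal, other_ini, ini_sign]
    have : β 1 - s - (β 0 - s) = β 1 - β 0 := by ring
    rw [this]
    simp only [true_and]
    split_ifs <;> simp

lemma locate_ordered (i : Fin 2) (b : ℤ) (s : ℤˣ) (e f : Endpoint) :
    (locate i b (ordered s e f) : Multiset Located) =
      {(e, i, if s = 1 then height b e else height b e + f.endSign)} +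
        {(f, i, if s = 1 then height b f + e.endSign else height b f)} := by
  unfold ordered
  split_ifs with h
  · simp [locate, ← Multiset.cons_coe, ← Multiset.singleton_add, height_add]
  · simp [locate, ← Multiset.cons_coe, ← Multiset.singleton_add, height_add]
    abel

@[simp] lemma signSum_ordered (s : ℤˣ) (e f : Endpoint) :
    signSum (ordered s e f) = e.endSign + f.endSign := by
  unfold ordered
  split_ifs <;> simp [add_comm]

lemma sameCoefs_of_R3 {G G' : GaussDiagram 2} (h : R3 G G') : G.SameCoefs G' := by
  obtain ⟨a, b, c, r, s, t, h⟩ := h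
  obtain ⟨hs, R, k, β, h1, h2⟩ := h.located_eq (by intro h; fin_cases h <;> simp)
  refine ⟨hs, fun i j n hn => ?_⟩
  have w := G.wellLocated
  have w' := G'.wellLocated
  unfold GaussDiagram.coef
  -- both diagrams consist of the same outer part and of the three chords, listed in this order
  have key : ∀ u1 v1 u2 v2 u3 v3 : Located,
      R + (({u1} + {u2}) + (({v1} + {u3}) + ({v2} + {v3}))) =
        u1 ::ₘ v1 ::ₘ u2 ::ₘ v2 ::ₘ u3 ::ₘ v3 ::ₘ R := by
    intro u1 v1 u2 v2 u3 v3
    simp only [← Multiset.singleton_add]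
    abel
  simp only [Fin.sum_univ_three, Matrix.cons_val_zero, Matrix.cons_val_one, Matrix.cons_val,
    locate_ordered, add_assoc ({_} + {_} : Multiset Located)] at h1 h2
  rw [key] at h1 h2
  rw [h1] at w ⊢
  rw [h2] at w' ⊢
  rw [w.coefOf_cons_cons rfl, (w.of_cons_cons rfl).coefOf_cons_cons rfl,
    ((w.of_cons_cons rfl).of_cons_cons rfl).coefOf_cons_cons rfl,
    w'.coefOf_cons_cons rfl, (w'.of_cons_cons rfl).coefOf_cons_cons rfl,
    ((w'.of_cons_cons rfl).of_cons_cons rfl).coefOf_cons_cons rfl]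
  rw [weight_terminal _ _ _ (a := (ter a r, _)) rfl, weight_terminal _ _ _ (a := (ter b s, _)) rfl,
    weight_terminal _ _ _ (a := (ter c t, _)) rfl, weight_terminal _ _ _ (a := (ter a r, _)) rfl,
    weight_terminal _ _ _ (a := (ter b s, _)) rfl, weight_terminal _ _ _ (a := (ter c t, _)) rfl]
  refine congrArg₂ (· + ·) (congrArg (· + (0 : ℤ)) (weight_congr _ _ _ _ _ _ _ ?_))
    (congrArg₂ (· + ·) (congrArg (· + (0 : ℤ)) (weight_congr _ _ _ _ _ _ _ ?_))
      (congrArg (· + coefOf i j n R) (congrArg (· + (0 : ℤ)) (weight_congr _ _ _ _ _ _ _ ?_))))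
  all_goals
    rcases units_cases r with rfl | rfl <;> rcases units_cases s with rfl | rfl <;>
      rcases units_cases t with rfl | rfl <;> simp [height] <;> ring

@[simp] lemma signSum_shelled (c : ℕ) (s : ℤˣ) (x : Endpoint) :
    signSum (shelled c s x) = x.endSign := by
  unfold shelled
  split_ifs <;> simp

/-- A shell has index `1`, and it lowers the surrounded endpoint by the product of its sign and the
sign of the endpoint. -/
lemma locate_shelled (i : Fin 2) (b : ℤ) (c : ℕ) (s : ℤˣ) (x : Endpoint) :
    ∃ β, (locate i b (shelled c s x) : Multiset Located) =
      {(x, i, height b x - s * x.endSign)} + ({(ini c s, i, β)} + {(ter c s, i, β + 1)}) := by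
  unfold shelled
  rcases units_cases x.endSign with h | h
  · refine ⟨b, ?_⟩
    have e1 : height (b + -(s : ℤ)) x = height b x - s := by rw [height_add]; ring
    simp [h, locate, ← Multiset.cons_coe, ← Multiset.singleton_add, e1]
    rw [show height (b + -(s : ℤ) + 1) (ter c s) = b + 1 by simp [height]; ring,
      show height b (ini c s) = b by simp [height]]
    abel
  · refine ⟨b + s - 1, ?_⟩
    have e1 : height (b + (s : ℤ)) x = height b x + s := by rw [height_add]
    simp [h, locate, ← Multiset.cons_coe, ← Multiset.singleton_add, e1]
    rw [show height (b + (s : ℤ) + -1) (ini c s) = b + s - 1 by simp [height]; ring,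
      show height b (ter c s) = b + s by simp [height]]
    abel

lemma sameCoefs_of_S1 {G G' : GaussDiagram 2} (h : S1 G G') : G.SameCoefs G' := by
  obtain ⟨x, c, s, h⟩ := h
  obtain ⟨hs, R, k, b, h1, h2⟩ := h.located_eq (by intro h; fin_cases h <;> simp)
  refine ⟨hs, fun i j n hn => ?_⟩
  have w := G.wellLocated
  have w' := G'.wellLocated
  unfold GaussDiagram.coef
  obtain ⟨β, hβ⟩ := locate_shelled (k 0) (b 0) c s x
  obtain ⟨γ, hγ⟩ := locate_shelled (k 1) (b 1) c s x.other
  have e1 : located G.circle = (x, k 0, height (b 0) x - s * x.endSign) ::ₘ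
      (x.other, k 1, height (b 1) x.other) ::ₘ (ini c s, k 0, β) ::ₘ (ter c s, k 0, β + 1) ::ₘ
      R := by
    rw [h1]
    simp only [Fin.sum_univ_two, Matrix.cons_val_zero, Matrix.cons_val_one, hβ, locate,
      ← Multiset.cons_coe, Multiset.coe_nil, ← Multiset.singleton_add, add_zero]
    abel
  have e2 : located G'.circle = (x, k 0, height (b 0) x) ::ₘ
      (x.other, k 1, height (b 1) x.other - s * x.other.endSign) ::ₘ (ini c s, k 1, γ) ::ₘ
      (ter c s, k 1, γ + 1) ::ₘ R := by
    rw [h2]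
    simp only [Fin.sum_univ_two, Matrix.cons_val_zero, Matrix.cons_val_one, hγ, locate,
      ← Multiset.cons_coe, Multiset.coe_nil, ← Multiset.singleton_add, add_zero]
    abel
  rw [e1] at w ⊢
  rw [e2] at w' ⊢
  rw [w.coefOf_cons_cons rfl, (w.of_cons_cons rfl).coefOf_cons_cons rfl,
    w'.coefOf_cons_cons rfl, (w'.of_cons_cons rfl).coefOf_cons_cons rfl,
    weight_terminal _ _ _ (a := (ter c s, _)) rfl, weight_terminal _ _ _ (a := (ter c s, _)) rfl,
    weight_of_not_essential hn _ (ini c s) (ter c s) (by right; ring),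
    weight_of_not_essential hn _ (ini c s) (ter c s) (by right; ring)]
  congr 1
  congr 1
  · exact weight_congr _ _ _ _ _ _ _ (by simp; ring)
  · exact weight_congr _ _ _ _ _ _ _ (by simp; ring)

lemma sameCoefs_of_S2 {G G' : GaussDiagram 2} (h : S2 G G') : G.SameCoefs G' := by
  obtain ⟨x, y, c, d, hxy, h⟩ := h
  obtain ⟨hs, R, k, b, h1, h2⟩ := h.located_eq (by
    intro h; fin_cases h; simp [add_comm])
  refine ⟨hs, fun i j n hn => ?_⟩
  have w := G.wellLocated
  have w' := G'.wellLocated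
  unfold GaussDiagram.coef
  obtain ⟨β, hβ⟩ := locate_shelled (k 0) (b 0) d (-(x.endSign * y.endSign)) y
  obtain ⟨γ, hγ⟩ := locate_shelled (k 0) (b 0 + y.endSign) c (x.endSign * y.endSign) x
  have e1 : located G.circle = {(x, k 0, height (b 0) x)} +
      {(y, k 0, height (b 0 + x.endSign) y)} + R := by
    rw [h1]
    simp only [Fin.sum_univ_one, Matrix.cons_val_zero, locate,
      ← Multiset.cons_coe, Multiset.coe_nil, ← Multiset.singleton_add, add_zero]
    abel
  -- the new shells restore the heights of `x` and `y`
  have hy : height (b 0) y - ((-(x.endSign * y.endSign) : ℤˣ) : ℤ) * y.endSign =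
      height (b 0 + x.endSign) y := by
    rw [height_add]
    rcases units_cases x.endSign with h | h <;> rcases units_cases y.endSign with h' | h' <;>
      simp [h, h', sub_eq_add_neg]
  have hx : height (b 0 + y.endSign) x - ((x.endSign * y.endSign : ℤˣ) : ℤ) * x.endSign =
      height (b 0) x := by
    rw [height_add]
    rcases units_cases x.endSign with h | h <;> rcases units_cases y.endSign with h' | h' <;>
      simp [h, h']
  have e2 : located G'.circle = (ini d (-(x.endSign * y.endSign)), k 0, β) ::ₘ
      (ter d (-(x.endSign * y.endSign)), k 0, β + 1) ::ₘ
      (ini c (x.endSign * y.endSign), k 0, γ) ::ₘ (ter c (x.endSign * y.endSign), k 0, γ + 1) ::ₘ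
      located G.circle := by
    rw [h2, e1]
    simp only [Fin.sum_univ_one, Matrix.cons_val_zero, locate_append, signSum_shelled]
    rw [← Multiset.coe_add, hβ, hγ, hx, hy]
    simp only [← Multiset.singleton_add]
    abel
  rw [e2] at w' ⊢
  rw [w'.coefOf_cons_cons rfl, (w'.of_cons_cons rfl).coefOf_cons_cons rfl,
    weight_terminal _ _ _ (a := (ter c _, _)) rfl, weight_terminal _ _ _ (a := (ter d _, _)) rfl,
    weight_of_not_essential hn _ (ini c _) (ter c _) (by right; ring),
    weight_of_not_essential hn _ (ini d _) (ter d _) (by right; ring)]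
  ring

/-! ### Invariance under S-equivalence -/

lemma locate_rename (σ : Equiv.Perm ℕ) (i : Fin 2) (b : ℤ) (l : List Endpoint) :
    locate i b (l.map (rename σ)) = (locate i b l).map fun a => (rename σ a.1, a.2) := by
  induction l generalizing b with
  | nil => rfl
  | cons e l ih => simp [locate, ih, height, rename, endSign]

lemma signSum_rename (σ : Equiv.Perm ℕ) (l : List Endpoint) :
    signSum (l.map (rename σ)) = signSum l := by
  simp [signSum, Function.comp_def]

lemma locate_isRotated (i : Fin 2) {l m : List Endpoint} (h : l ~r m) (hl : signSum l = 0) :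
    ∃ d : ℤ, (locate i 0 m).Perm ((locate i 0 l).map fun a => (a.1, a.2.1, a.2.2 + d)) := by
  obtain ⟨n, hn, rfl⟩ := List.isRotated_iff_mod.1 h
  rw [List.rotate_eq_drop_append_take hn]
  have hs : signSum (l.take n) + signSum (l.drop n) = 0 := by
    rw [← signSum_append, List.take_append_drop, hl]
  refine ⟨signSum (l.drop n), ?_⟩
  rw [← locate_add]
  have hl' : locate i (0 + signSum (l.drop n)) l =
      locate i (0 + signSum (l.drop n)) (l.take n ++ l.drop n) := by rw [List.take_append_drop]
  rw [hl', locate_append, locate_append, zero_add,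
    show signSum (l.drop n) + signSum (l.take n) = 0 by omega]
  exact List.perm_append_comm

/-- Renaming the chords and shifting the heights on each circle shifts the coefficients. -/
lemma coefOf_shift (σ : Equiv.Perm ℕ) (d : Fin 2 → ℤ) (i j : Fin 2) (n : ℤ)
    (A : Multiset Located) :
    coefOf i j n (A.map fun a => (rename σ a.1, a.2.1, a.2.2 + d a.2.1)) =
      coefOf i j (n - (d j - d i)) A := by
  unfold coefOf
  rw [Multiset.map_map]
  congr 1
  refine Multiset.map_congr rfl fun a _ => ?_
  simp only [Function.comp, Multiset.map_map]
  congr 1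
  refine Multiset.map_congr rfl fun b _ => ?_
  unfold weight
  simp only [← rename_other, (rename_injective σ).eq_iff]
  refine if_congr ?_ rfl rfl
  refine and_congr_right fun _ => and_congr_right fun _ => and_congr_right fun h =>
    and_congr_right fun h' => ?_
  rw [← h, ← h']
  constructor <;> intro h <;> linarith

namespace GaussDiagram

/-- The essential coefficients of `G'` arise from those of `G` by shifting the heights on the two
circles. -/
def ShiftedCoefs (G G' : GaussDiagram 2) : Prop :=
  ∃ d : Fin 2 → ℤ, ∀ i j n, Essential i j n → G'.coef i j n = G.coef i j (n - (d j - d i))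

/-- The relation between S-equivalent diagrams that is used in the classification. -/
def SameInvariants (G G' : GaussDiagram 2) : Prop :=
  (G.Balanced ↔ G'.Balanced) ∧ (G.Balanced → G.ShiftedCoefs G')

lemma Essential_sub {i j : Fin 2} {n : ℤ} (h : Essential i j n) (d : Fin 2 → ℤ) :
    Essential i j (n - (d j - d i)) := by
  intro hij
  have := h hij
  subst hij
  simpa using this

lemma ShiftedCoefs.symm {G G' : GaussDiagram 2} (h : G.ShiftedCoefs G') : G'.ShiftedCoefs G := by
  obtain ⟨d, h⟩ := h
  refine ⟨fun i => -d i, fun i j n hn => ?_⟩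
  rw [h i j _ (Essential_sub hn fun i => -d i)]
  congr 1
  ring

lemma ShiftedCoefs.trans {G G' G'' : GaussDiagram 2} (h : G.ShiftedCoefs G')
    (h' : G'.ShiftedCoefs G'') : G.ShiftedCoefs G'' := by
  obtain ⟨d, h⟩ := h
  obtain ⟨d', h'⟩ := h'
  refine ⟨fun i => d i + d' i, fun i j n hn => ?_⟩
  rw [h' i j n hn, h i j _ (Essential_sub hn d')]
  congr 1
  ring

lemma SameCoefs.sameInvariants {G G' : GaussDiagram 2} (h : G.SameCoefs G') :
    G.SameInvariants G' := by
  refine ⟨?_, fun _ => ⟨0, fun i j n hn => ?_⟩⟩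
  · simp [Balanced, h.1]
  · simp [h.2 i j n hn]

lemma sameInvariants_of_iso {G G' : GaussDiagram 2} (h : Iso G G') : G.SameInvariants G' := by
  obtain ⟨σ, h⟩ := h
  have hs : ∀ i, signSum (G'.circle i) = signSum (G.circle i) := fun i => by
    rw [← signSum_perm (h i).perm, signSum_rename]
  refine ⟨by simp [Balanced, hs], fun hb => ?_⟩
  have hd : ∀ i, ∃ d : ℤ, (locate i 0 (G'.circle i)).Perm
      ((locate i 0 ((G.circle i).map (rename σ))).map fun a => (a.1, a.2.1, a.2.2 + d)) :=
    fun i => locate_isRotated i (h i) (by rw [signSum_rename, hb])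
  choose d hd using hd
  refine ⟨d, fun i j n _ => ?_⟩
  have key : located G'.circle =
      (located G.circle).map fun a => (rename σ a.1, a.2.1, a.2.2 + d a.2.1) := by
    have hc : ∀ i, (locate i 0 (G'.circle i)).Perm
        ((locate i 0 (G.circle i)).map fun a => (rename σ a.1, a.2.1, a.2.2 + d a.2.1)) := by
      intro i
      refine (hd i).trans ?_
      rw [locate_rename, List.map_map]
      have : ∀ (b : ℤ) (l : List Endpoint), ∀ a ∈ locate i b l, a.2.1 = i := by
        intro b l
        induction l generalizing b with
        | nil => simp [locate]
        | cons e l ih => simpa [locate] using ih _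
      rw [List.map_congr_left (g := fun a => (rename σ a.1, a.2.1, a.2.2 + d a.2.1))]
      intro a ha
      simp [this _ _ a ha]
    simp only [located, Multiset.map_coe, Multiset.coe_eq_coe, List.map_append]
    exact (hc 0).append (hc 1)
  rw [coef, coef, key, coefOf_shift]

/-- The invariants of S-equivalent diagrams agree. -/
lemma SEquiv.sameInvariants {G G' : GaussDiagram 2} (h : G.SEquiv G') : G.SameInvariants G' := by
  induction h with
  | rel G G' h =>
    rcases h with (h | h | h | h) | h | h
    · exact sameInvariants_of_iso h
    · exact (sameCoefs_of_R1 h).sameInvariants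
    · exact (sameCoefs_of_R2 h).sameInvariants
    · exact (sameCoefs_of_R3 h).sameInvariants
    · exact (sameCoefs_of_S1 h).sameInvariants
    · exact (sameCoefs_of_S2 h).sameInvariants
  | refl G => exact ⟨Iff.rfl, fun _ => ⟨0, by simp⟩⟩
  | symm G G' _ ih => exact ⟨ih.1.symm, fun h => (ih.2 (ih.1.2 h)).symm⟩
  | trans G G' G'' _ _ ih ih' =>
    exact ⟨ih.1.trans ih'.1, fun h => (ih.2 h).trans (ih'.2 (ih.1.1 h))⟩

end GaussDiagram

/-- S-equivalence of virtual links can be tested on arbitrary Gauss diagrams, since Reidemeister moves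
are among the moves of S-equivalence. -/
lemma VirtualLink.SEquiv.gaussDiagram {L L' : VirtualLink 2} (h : L.SEquiv L')
    {G G' : GaussDiagram 2} (hG : IsDiagramOf G L) (hG' : IsDiagramOf G' L') : G.SEquiv G' := by
  obtain ⟨D, D', hD, hD', h⟩ := h
  have key : ∀ {X Y : GaussDiagram 2}, Relation.EqvGen ReidemeisterStep X Y → X.SEquiv Y :=
    fun h => Relation.EqvGen.mono (fun _ _ h => Or.inl h) _ _ h
  have h1 : G.SEquiv D := key (Quotient.exact (hG.trans hD.symm))
  have h2 : D'.SEquiv G' := key (Quotient.exact (hD'.trans hG'.symm))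
  exact (h1.trans _ _ _ h).trans _ _ _ h2

/-! ### The invariants in terms of coefficients -/

/-- The sum of the signs of the endpoints before `e` in the word `l`. -/
def before (l : List Endpoint) (e : Endpoint) : ℤ := signSum (l.takeWhile fun x => decide (x ≠ e))

lemma before_append_cons {A : List Endpoint} {e : Endpoint} (h : e ∉ A) (B : List Endpoint) :
    before (A ++ e :: B) e = signSum A := by
  unfold before
  rw [List.takeWhile_append_of_pos]
  · simp
  · intro x hx
    simpa using fun hxe : x = e => h (hxe ▸ hx)

/-- The height of `e` in the word `l`. -/
def heightIn (l : List Endpoint) (e : Endpoint) : ℤ := height (before l e) e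

lemma locate_eq_map (i : Fin 2) {A B : List Endpoint} (h : (A ++ B).Nodup) :
    locate i (signSum A) B = B.map fun e => (e, i, heightIn (A ++ B) e) := by
  induction B generalizing A with
  | nil => rfl
  | cons e B ih =>
    have h1 : e ∉ A := fun he => (List.nodup_append.1 h).2.2 e he e (by simp) rfl
    have h2 := ih (A := A ++ [e]) (by simpa using h)
    simp only [signSum_append, signSum_cons, signSum_nil, add_zero, List.append_assoc,
      List.cons_append, List.nil_append] at h2
    rw [locate, h2, List.map_cons, heightIn, before_append_cons h1]

lemma sum_map_filter {α : Type*} (l : List α) (P : α → Bool) (f : α → ℤ) :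
    ((l.filter P).map f).sum = (l.map fun x => if P x then f x else 0).sum := by
  induction l with
  | nil => rfl
  | cons a l ih =>
    rw [List.filter_cons, List.map_cons, List.sum_cons, ← ih]
    split_ifs <;> simp

lemma sum_map_ite_eq {l : List Endpoint} (hl : l.Nodup) (a : Endpoint) (P : Endpoint → Prop)
    [DecidablePred P] (s : ℤ) :
    (l.map fun x => if x = a ∧ P x then s else 0).sum = if a ∈ l ∧ P a then s else 0 := by
  induction l with
  | nil => simp
  | cons e l ih =>
    rw [List.nodup_cons] at hl
    rw [List.map_cons, List.sum_cons, ih hl.2]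
    by_cases he : e = a
    · subst he
      simp [hl.1]
    · simp [he, Ne.symm he]

namespace GaussDiagram

/-- The index of the chord from circle `i` to circle `j` with initial endpoint `e`, measured with
respect to the base points of the two circles. -/
def baseIndex (G : GaussDiagram 2) (i j : Fin 2) (e : Endpoint) : ℤ :=
  heightIn (G.circle j) e.other - heightIn (G.circle i) e

lemma nodup_circle (G : GaussDiagram 2) (i : Fin 2) : (G.circle i).Nodup := by
  have := List.nodup_append.1 G.wellFormed.1
  fin_cases i
  · exact this.1
  · exact this.2.1

/-- The quadratic expression in the definition of `coef` is the sum over the chords. -/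
lemma coef_eq (G : GaussDiagram 2) (i j : Fin 2) (n : ℤ) :
    G.coef i j n = (((G.chords i j).filter fun e => decide (G.baseIndex i j e = n)).map
      fun e => (e.sign : ℤ)).sum := by
  have hl : ∀ i', locate i' 0 (G.circle i') =
      (G.circle i').map fun e => (e, i', heightIn (G.circle i') e) := fun i' => by
    simpa using locate_eq_map i' (A := []) (G.nodup_circle i')
  have hin : ∀ (i' j' : Fin 2) (e : Endpoint), (((G.circle j').map fun f =>
      (f, j', heightIn (G.circle j') f)).map fun b =>
        weight i j n (e, i', heightIn (G.circle i') e) b).sum =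
      if (e.terminal = false ∧ e.other ∈ G.circle j' ∧
        heightIn (G.circle j') e.other - heightIn (G.circle i') e = n) ∧ i' = i ∧ j' = j then
        (e.sign : ℤ) else 0 := by
    intro i' j' e
    rw [List.map_map]
    have h1 := sum_map_ite_eq (G.nodup_circle j') e.other (fun f => e.terminal = false ∧ i' = i ∧
      j' = j ∧ heightIn (G.circle j') f - heightIn (G.circle i') e = n) (e.sign : ℤ)
    refine Eq.trans ?_ (h1.trans ?_)
    · congr 1
      refine List.map_congr_left fun f _ => if_congr ?_ rfl rfl
      tauto
    · exact if_congr (by tauto) rfl rfl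
  have hout : ∀ i' : Fin 2, ((G.circle i').map fun e =>
      (((locate 0 0 (G.circle 0) ++ locate 1 0 (G.circle 1)).map fun b =>
        weight i j n (e, i', heightIn (G.circle i') e) b).sum)).sum =
      if i' = i then (((G.chords i j).filter fun e => decide (G.baseIndex i j e = n)).map
        fun e => (e.sign : ℤ)).sum else 0 := by
    intro i'
    have h2 : ∀ e, ((locate 0 0 (G.circle 0) ++ locate 1 0 (G.circle 1)).map fun b =>
        weight i j n (e, i', heightIn (G.circle i') e) b).sum =
        if i' = i then (if e.terminal = false ∧ e.other ∈ G.circle j ∧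
          heightIn (G.circle j) e.other - heightIn (G.circle i) e = n then (e.sign : ℤ) else 0)
        else 0 := by
      intro e
      rw [List.map_append, List.sum_append, hl 0, hl 1, hin, hin]
      by_cases hi : i' = i
      · subst hi
        fin_cases j <;> simp
      · simp [hi]
    simp only [h2]
    by_cases hi : i' = i
    · subst hi
      simp only [if_true, chords, List.filter_filter, sum_map_filter]
      congr 1
      refine List.map_congr_left fun e _ => if_congr ?_ rfl rfl
      rw [Bool.and_eq_true, decide_eq_true_iff, decide_eq_true_iff]
      unfold baseIndex
      tauto
    · simp [hi]
  have hloc : ∀ (i' : Fin 2) (φ : Located → ℤ), ((locate i' 0 (G.circle i')).map φ).sum =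
      ((G.circle i').map fun e => φ (e, i', heightIn (G.circle i') e)).sum := fun i' φ => by
    rw [hl i', List.map_map]
    rfl
  unfold coef coefOf located
  simp only [Multiset.map_coe, Multiset.sum_coe]
  rw [List.map_append, List.sum_append, hloc 0, hloc 1, hout 0, hout 1]
  fin_cases i <;> simp

end GaussDiagram

/-! ### Arcs, writhes and linking classes -/

/-- On a circle whose endpoints have total sign zero, the sign sum of an arc is a difference of
partial sums from the base point, even if the arc runs through the base point. -/
lemma signSum_arc {w : List Endpoint} (hw : w.Nodup) (h0 : signSum w = 0) {e f : Endpoint}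
    (he : e ∈ w) (hf : f ∈ w) :
    signSum (arc w e f) = before w f + f.endSign - before w e := by
  obtain ⟨A, B, rfl⟩ := List.append_of_mem he
  have hA : e ∉ A := fun h => (List.nodup_append.1 hw).2.2 e h e (by simp) rfl
  have hB : e ∉ B := fun h => by
    have := (List.nodup_append.1 hw).2.1
    simp [h] at this
  have hAB : ∀ x ∈ A, x ∉ B := fun x hx hx' =>
    (List.nodup_append.1 hw).2.2 x hx x (by simp [hx']) rfl
  have hidx : (A ++ e :: B).idxOf e = A.length := by
    rw [List.idxOf_append_of_notMem hA]; simp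
  unfold arc
  rw [hidx, List.rotate_append_length_eq, before_append_cons hA]
  have hrot : ∀ C D : List Endpoint, f ∉ C → e :: B ++ A = C ++ f :: D →
      signSum ((e :: B ++ A).takeWhile (fun x => decide (x ≠ f)) ++ [f]) =
        signSum C + f.endSign := by
    intro C D hC hCD
    rw [hCD, signSum_append, signSum_cons, signSum_nil, add_zero]
    have := before_append_cons hC D
    rw [← this]
    rfl
  simp only [signSum_append, signSum_cons] at h0
  rw [List.mem_append, List.mem_cons] at hf
  rcases hf with hf | rfl | hf
  · obtain ⟨A1, A2, rfl⟩ := List.append_of_mem hf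
    have hf1 : f ∉ A1 := fun h => by
      have := (List.nodup_append.1 (List.nodup_append.1 hw).1).2.2 f h f (by simp)
      exact this rfl
    have hfe : f ≠ e := fun h => hA (h ▸ hf)
    rw [hrot (e :: B ++ A1) A2 (by simpa [hfe, hf1] using hAB f hf) (by simp),
      show A1 ++ f :: A2 ++ e :: B = A1 ++ f :: (A2 ++ e :: B) by simp, before_append_cons hf1]
    simp only [signSum_append, signSum_cons] at h0 ⊢
    linarith
  · rw [hrot [] (B ++ A) (by simp) (by simp), before_append_cons hA]
    simp
  · obtain ⟨B1, B2, rfl⟩ := List.append_of_mem hf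
    have hf1 : f ∉ B1 := fun h => by
      have := (List.nodup_append.1 (List.nodup_cons.1 (List.nodup_append.1 hw).2.1).2).2.2 f h f
        (by simp)
      exact this rfl
    have hfe : f ≠ e := fun h => hB (h ▸ hf)
    have hfA : f ∉ A := fun h => hAB f h hf
    rw [hrot (e :: B1) (B2 ++ A) (by simp [hfe, hf1]) (by simp),
      show A ++ e :: (B1 ++ f :: B2) = (A ++ e :: B1) ++ f :: B2 by simp,
      before_append_cons (by simp [hfe, hf1, hfA])]
    simp only [signSum_append, signSum_cons]
    ring

lemma heightIn_of_initial (l : List Endpoint) {e : Endpoint} (h : e.terminal = false) :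
    heightIn l e = before l e := by simp [heightIn, height, h]

lemma heightIn_of_terminal (l : List Endpoint) {e : Endpoint} (h : e.terminal = true) :
    heightIn l e = before l e + e.endSign := by simp [heightIn, height, h]

namespace GaussDiagram

lemma mem_chords {G : GaussDiagram 2} {i j : Fin 2} {e : Endpoint} :
    e ∈ G.chords i j ↔ e ∈ G.circle i ∧ e.terminal = false ∧ e.other ∈ G.circle j := by
  simp [chords]

variable {G : GaussDiagram 2} (hb : G.Balanced)
include hb

lemma selfIndex_eq {i : Fin 2} {e : Endpoint} (he : e ∈ G.chords i i) :
    G.selfIndex i e = G.baseIndex i i e := by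
  obtain ⟨h1, h2, h3⟩ := mem_chords.1 he
  rw [selfIndex, signSum_arc (G.nodup_circle i) (hb i) h1 h3, baseIndex,
    heightIn_of_initial _ h2, heightIn_of_terminal _ (by simp [h2])]

lemma writhe_eq (i : Fin 2) (n : ℤ) : G.writhe i n = G.coef i i n := by
  rw [coef_eq, writhe]
  congr 2
  refine List.filter_congr fun e he => ?_
  rw [selfIndex_eq hb he]

lemma nonselfIndex_eq {p : Fin 2 → Endpoint} {i j : Fin 2} {e : Endpoint}
    (hp : ∀ i, p i ∈ G.circle i) (he : e ∈ G.chords i j) :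
    G.nonselfIndex p i j e = G.baseIndex i j e +
      (before (G.circle i) (p i) + (p i).endSign - before (G.circle j) (p j)) := by
  obtain ⟨h1, h2, h3⟩ := mem_chords.1 he
  rw [nonselfIndex, signSum_arc (G.nodup_circle i) (hb i) h1 (hp i),
    signSum_arc (G.nodup_circle j) (hb j) (hp j) h3, baseIndex,
    heightIn_of_initial _ h2, heightIn_of_terminal _ (by simp [h2])]
  ring

lemma coeff_linkingPoly {p : Fin 2 → Endpoint} (hp : ∀ i, p i ∈ G.circle i) (i j : Fin 2) (n : ℤ) :
    (G.linkingPoly p i j).coeff n = G.coef i j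
      (n - (before (G.circle i) (p i) + (p i).endSign - before (G.circle j) (p j))) := by
  rw [coef_eq, linkingPoly, sum_map_filter]
  have key : ∀ l : List Endpoint, (∀ e ∈ l, e ∈ G.chords i j) →
      ((l.map fun e => (e.sign : ℤ) • (LaurentPolynomial.T (G.nonselfIndex p i j e) :
        LaurentPolynomial ℤ)).sum).coeff n =
      (l.map fun e => if decide (G.baseIndex i j e = n - (before (G.circle i) (p i) +
        (p i).endSign - before (G.circle j) (p j))) = true then (e.sign : ℤ) else 0).sum := by
    intro l hl
    induction l with
    | nil => simp
    | cons e l ih =>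
      rw [List.map_cons, List.map_cons, List.sum_cons, List.sum_cons,
        ← ih fun x hx => hl x (by simp [hx]), nonselfIndex_eq hb hp (hl e (by simp))]
      rw [AddMonoidAlgebra.coeff_add, Finsupp.add_apply, AddMonoidAlgebra.coeff_smul,
        Finsupp.smul_apply, LaurentPolynomial.T, AddMonoidAlgebra.coeff_single,
        Finsupp.single_apply]
      simp [eq_sub_iff_add_eq]
  exact key _ fun e he => he

omit hb in
lemma not_mem_other_circle {e : Endpoint} (h0 : e ∈ G.circle 0) : e ∉ G.circle 1 := fun h1 =>
  (List.nodup_append.1 G.wellFormed.1).2.2 e h0 e h1 rfl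

omit hb in
lemma other_mem_circle {i : Fin 2} {e : Endpoint} (h : e ∈ G.circle i) :
    e.other ∈ G.circle 0 ∨ e.other ∈ G.circle 1 := by
  have := G.wellFormed.2.2 e (by fin_cases i <;> simp_all)
  simpa using this

omit hb in
lemma coeff_T_mul (m n : ℤ) (f : LaurentPolynomial ℤ) :
    (LaurentPolynomial.T m * f).coeff n = f.coeff (n - m) := by
  have := AddMonoidAlgebra.coeff_single_mul_add f (1 : ℤ) m (n - m)
  rw [one_mul, add_sub_cancel] at this
  exact this

/-- The linking class is represented by the generating functions of the coefficients with respect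
to the base points. -/
lemma IsLinkingClass.exists_rep {F : Gamma0} (hF : G.IsLinkingClass F) :
    ∃ f g : LaurentPolynomial ℤ, F = Quotient.mk gammaSetoid (f, g) ∧
      (∀ n, f.coeff n = G.coef 0 1 n) ∧ ∀ n, g.coeff n = G.coef 1 0 n := by
  rcases hF with ⟨x, hx, hy, rfl⟩ | ⟨h, rfl⟩
  · have hp : ∀ i, (![x, x.other] : Fin 2 → Endpoint) i ∈ G.circle i := by
      intro i; fin_cases i <;> simpa
    have h1 := coeff_linkingPoly hb hp 0 1
    have h2 := coeff_linkingPoly hb hp 1 0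
    simp only [Matrix.cons_val_zero, Matrix.cons_val_one, endSign_other, Units.val_neg] at h1 h2
    set k := before (G.circle 0) x + x.endSign - before (G.circle 1) x.other with hk
    refine ⟨LaurentPolynomial.T (-k) * G.linkingPoly ![x, x.other] 0 1,
      LaurentPolynomial.T k * G.linkingPoly ![x, x.other] 1 0, ?_, ?_, ?_⟩
    · exact Quotient.sound ⟨-k, rfl, by simp⟩
    · intro n
      rw [coeff_T_mul, h1]
      congr 1
      ring
    · intro n
      rw [coeff_T_mul, h2]
      congr 1
      rw [hk]
      ring
  · refine ⟨0, 0, rfl, ?_, ?_⟩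
    · intro n
      rw [coef_eq, show G.chords 0 1 = [] from ?_]
      · simp
      · rw [List.eq_nil_iff_forall_not_mem]
        intro e he
        obtain ⟨h1, h2, h3⟩ := mem_chords.1 he
        exact h e h1 h3
    · intro n
      rw [coef_eq, show G.chords 1 0 = [] from ?_]
      · simp
      · rw [List.eq_nil_iff_forall_not_mem]
        intro e he
        obtain ⟨h1, h2, h3⟩ := mem_chords.1 he
        exact h _ h3 (by simpa using h1)

/-- Equality in `Γ(0)` is equality of the coefficients up to opposite shifts for the two types. -/
lemma linkingClass_eq_iff {G' : GaussDiagram 2} (hb' : G'.Balanced) {F F' : Gamma0}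
    (hF : G.IsLinkingClass F) (hF' : G'.IsLinkingClass F') :
    F = F' ↔ ∃ k : ℤ, ∀ n, G'.coef 0 1 n = G.coef 0 1 (n - k) ∧
      G'.coef 1 0 n = G.coef 1 0 (n + k) := by
  obtain ⟨f, g, rfl, hf, hg⟩ := hF.exists_rep hb
  obtain ⟨f', g', rfl, hf', hg'⟩ := hF'.exists_rep hb'
  constructor
  · intro h
    obtain ⟨k, h1, h2⟩ := Quotient.exact h
    refine ⟨k, fun n => ⟨?_, ?_⟩⟩
    · rw [← hf', ← hf, ← coeff_T_mul, ← h1]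
    · rw [← hg', ← hg, ← sub_neg_eq_add, ← coeff_T_mul, ← h2]
  · rintro ⟨k, h⟩
    refine Quotient.sound ⟨k, ?_, ?_⟩
    · ext n
      rw [coeff_T_mul, hf', hf, (h n).1]
    · ext n
      rw [coeff_T_mul, hg', hg, (h n).2, sub_neg_eq_add]

omit hb

lemma signSum_circle (i : Fin 2) :
    signSum (G.circle i) = (G.lk 0 i - G.lk i 0) + (G.lk 1 i - G.lk i 1) := by
  -- the terminal endpoints on circle `i` belong to the chords that end there
  have hter : ∀ j, ((((G.circle i).filter fun e =>
      decide (e.terminal = true ∧ e.other ∈ G.circle j))).map fun e => (e.sign : ℤ)).sum =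
      G.lk j i := by
    intro j
    have hp : (((G.circle i).filter fun e =>
        decide (e.terminal = true ∧ e.other ∈ G.circle j)).map other).Perm (G.chords j i) := by
      refine (List.perm_ext_iff_of_nodup (((G.nodup_circle i).filter _).map other_injective)
        ((G.nodup_circle j).filter _)).2 ?_
      intro e
      rw [← chords, mem_chords]
      simp only [List.mem_map, List.mem_filter, decide_eq_true_eq]
      constructor
      · rintro ⟨f, ⟨h1, h2, h3⟩, rfl⟩
        simp [h1, h2, h3]
      · rintro ⟨h1, h2, h3⟩
        exact ⟨e.other, by simp [h1, h2, h3]⟩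
    rw [lk, ← (hp.map _).sum_eq, List.map_map]
    rfl
  rw [← hter 0, ← hter 1, lk, lk, chords, chords]
  simp only [sum_map_filter]
  have hmem : ∀ e ∈ G.circle i, (e.other ∈ G.circle 0 ∧ e.other ∉ G.circle 1) ∨
      (e.other ∈ G.circle 1 ∧ e.other ∉ G.circle 0) := fun e he => by
    rcases other_mem_circle he with h | h
    · exact Or.inl ⟨h, not_mem_other_circle h⟩
    · exact Or.inr ⟨h, fun h' => not_mem_other_circle h' h⟩
  generalize G.circle i = l at hmem
  induction l with
  | nil => simp
  | cons e l ih =>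
    simp only [signSum_cons, List.map_cons, List.sum_cons]
    rw [ih fun x hx => hmem x (by simp [hx])]
    rcases hmem e (by simp) with ⟨h1, h2⟩ | ⟨h1, h2⟩ <;> cases ht : e.terminal <;>
      simp [h1, h2, ht, endSign] <;> ring

lemma balanced_of_virtualLk (h : G.virtualLk = 0) : G.Balanced := by
  rw [virtualLk] at h
  intro i
  rw [signSum_circle]
  fin_cases i
  · simp; linarith
  · simp; linarith

end GaussDiagram

/-! ### Words with a bar -/

/-- The two words separated by the first bar `none` of a word; further bars are ignored. -/
def splitBar {α : Type*} : List (Option α) → List α × List α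
  | [] => ([], [])
  | none :: w => ([], w.reduceOption)
  | some a :: w => (a :: (splitBar w).1, (splitBar w).2)

lemma splitBar_append {α : Type*} (w : List (Option α)) :
    (splitBar w).1 ++ (splitBar w).2 = w.reduceOption := by
  induction w with
  | nil => rfl
  | cons a w ih =>
    cases a with
    | none => simp [splitBar, List.reduceOption_cons_of_none]
    | some a => simp [splitBar, List.reduceOption_cons_of_some, ih]

@[simp] lemma reduceOption_map_some {α : Type*} (l : List α) : (l.map some).reduceOption = l := by
  induction l with
  | nil => rfl
  | cons a l ih => rw [List.map_cons, List.reduceOption_cons_of_some, ih]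

lemma splitBar_bar {α : Type*} (u v : List α) :
    splitBar (u.map some ++ none :: v.map some) = (u, v) := by
  induction u with
  | nil => simp [splitBar]
  | cons a u ih => simp [splitBar, ih]

/-- A Gauss diagram with two circles, written as one word: the endpoints on the first circle, a bar
`none`, and the endpoints on the second circle.  In this way a local move is a replacement of
subwords, whatever the circles on which it takes place. -/
abbrev BarWord := List (Option Endpoint)

/-- The Gauss diagram described by a word with a bar. -/
def BarWord.diagram (w : BarWord) (h : WellFormed w.reduceOption) : GaussDiagram 2 where
  circle := ![(splitBar w).1, (splitBar w).2]
  nodup := by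
    simpa [List.finRange_succ, splitBar_append] using h.1
  sign_eq := by
    simpa only [List.finRange_succ, List.finRange_zero, List.map_nil, List.map_cons,
      List.flatMap_cons, List.flatMap_nil, Matrix.cons_val_zero, Matrix.cons_val_succ,
      List.append_nil, splitBar_append] using h.2.1
  other_mem := by
    simpa only [List.finRange_succ, List.finRange_zero, List.map_nil, List.map_cons,
      List.flatMap_cons, List.flatMap_nil, Matrix.cons_val_zero, Matrix.cons_val_succ,
      List.append_nil, splitBar_append] using h.2.2

/-- Both words describe Gauss diagrams, and these are S-equivalent. -/
def Sim (w w' : BarWord) : Prop :=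
  ∃ (h : WellFormed w.reduceOption) (h' : WellFormed w'.reduceOption),
    (w.diagram h).SEquiv (w'.diagram h')

namespace Sim

lemma refl {w : BarWord} (h : WellFormed w.reduceOption) : Sim w w :=
  ⟨h, h, Relation.EqvGen.refl _⟩

lemma symm {w w' : BarWord} : Sim w w' → Sim w' w := fun ⟨h, h', hs⟩ => ⟨h', h, hs.symm⟩

lemma trans {w w' w'' : BarWord} : Sim w w' → Sim w' w'' → Sim w w'' :=
  fun ⟨h, _, hs⟩ ⟨_, h'', hs'⟩ => ⟨h, h'', Relation.EqvGen.trans _ _ _ hs hs'⟩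

lemma right {w w' : BarWord} (h : Sim w w') : WellFormed w'.reduceOption := h.2.1

end Sim

/-- Insert words in the slots of a template with a bar. -/
def barFill {k : ℕ} (T : List (Option (Endpoint ⊕ Fin k))) (p : Fin k → List Endpoint) : BarWord :=
  T.flatMap fun o => o.elim [none] fun x => (Sum.elim (fun e => [e]) p x).map some

lemma splitBar_barFill {k : ℕ} (T : List (Option (Endpoint ⊕ Fin k))) (p : Fin k → List Endpoint) :
    splitBar (barFill T p) = ((splitBar T).1.flatMap (Sum.elim (fun e => [e]) p),
      (splitBar T).2.flatMap (Sum.elim (fun e => [e]) p)) := by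
  have hr : ∀ T : List (Option (Endpoint ⊕ Fin k)), (barFill T p).reduceOption =
      T.reduceOption.flatMap (Sum.elim (fun e => [e]) p) := by
    intro T
    induction T with
    | nil => rfl
    | cons o T ih =>
      cases o with
      | none =>
        rw [List.reduceOption_cons_of_none, ← ih]
        rfl
      | some x =>
        rw [List.reduceOption_cons_of_some, List.flatMap_cons, ← ih]
        simp [barFill, List.reduceOption_append]
  have hs : ∀ (l : List Endpoint) (w : BarWord), splitBar (l.map some ++ w) =
      (l ++ (splitBar w).1, (splitBar w).2) := by
    intro l w
    induction l with
    | nil => rfl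
    | cons a l ih => simp [splitBar, ih]
  induction T with
  | nil => rfl
  | cons o T ih =>
    cases o with
    | none =>
      have : barFill (none :: T) p = none :: barFill T p := rfl
      simp [this, splitBar, hr]
    | some x =>
      have : barFill (some x :: T) p =
        (Sum.elim (fun e => [e]) p x).map some ++ barFill T p := rfl
      rw [this, hs, ih]
      simp [splitBar]

lemma localMove_barFill {k : ℕ} (T : List (Option (Endpoint ⊕ Fin k)))
    (hT : ∀ h : Fin k, T.reduceOption.count (Sum.inr h) = 1) (p q : Fin k → List Endpoint)
    (hp : WellFormed (barFill T p).reduceOption) (hq : WellFormed (barFill T q).reduceOption) :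
    LocalMove p q ((barFill T p).diagram hp) ((barFill T q).diagram hq) := by
  refine ⟨![(splitBar T).1, (splitBar T).2], fun h => ?_, ?_, ?_⟩
  · rw [Fin.sum_univ_two, Matrix.cons_val_zero, Matrix.cons_val_one, Matrix.cons_val_fin_one,
      ← List.count_append, splitBar_append, hT]
  · funext i
    simp only [BarWord.diagram, splitBar_barFill, Template.fill]
    fin_cases i <;> rfl
  · funext i
    simp only [BarWord.diagram, splitBar_barFill, Template.fill]
    fin_cases i <;> rfl

/-- A word as part of a template. -/
def asTemplate (k : ℕ) (w : BarWord) : List (Option (Endpoint ⊕ Fin k)) :=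
  w.map (Option.map Sum.inl)

@[simp] lemma barFill_asTemplate {k : ℕ} (w : BarWord) (p : Fin k → List Endpoint) :
    barFill (asTemplate k w) p = w := by
  induction w with
  | nil => rfl
  | cons a w ih =>
    cases a with
    | none => exact congrArg (none :: ·) ih
    | some a => exact congrArg (some a :: ·) ih

@[simp] lemma count_asTemplate {k : ℕ} (w : BarWord) (h : Fin k) :
    (asTemplate k w).reduceOption.count (Sum.inr h) = 0 := by
  rw [List.count_eq_zero, List.reduceOption_mem_iff]
  simp [asTemplate]

lemma barFill_append {k : ℕ} (T T' : List (Option (Endpoint ⊕ Fin k)))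
    (p : Fin k → List Endpoint) : barFill (T ++ T') p = barFill T p ++ barFill T' p := by
  simp [barFill]

lemma localMove_one {p q : List Endpoint} {A B : BarWord}
    (hp : WellFormed (A ++ p.map some ++ B).reduceOption)
    (hq : WellFormed (A ++ q.map some ++ B).reduceOption) :
    LocalMove ![p] ![q] (BarWord.diagram _ hp) (BarWord.diagram _ hq) := by
  have e : ∀ r : List Endpoint, A ++ r.map some ++ B =
      barFill (asTemplate 1 A ++ [some (Sum.inr 0)] ++ asTemplate 1 B) ![r] := fun r => by
    simp only [barFill_append, barFill_asTemplate]
    simp [barFill]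
  have := localMove_barFill (asTemplate 1 A ++ [some (Sum.inr 0)] ++ asTemplate 1 B) (fun h => by
    fin_cases h
    simp [List.reduceOption_append, List.count_append]) ![p] ![q] (e p ▸ hp) (e q ▸ hq)
  convert this using 2
  · exact e p
  · exact e q

lemma localMove_two {p q p' q' : List Endpoint} {A B C : BarWord}
    (hp : WellFormed (A ++ p.map some ++ B ++ p'.map some ++ C).reduceOption)
    (hq : WellFormed (A ++ q.map some ++ B ++ q'.map some ++ C).reduceOption) :
    LocalMove ![p, p'] ![q, q'] (BarWord.diagram _ hp) (BarWord.diagram _ hq) := by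
  have e : ∀ r r' : List Endpoint, A ++ r.map some ++ B ++ r'.map some ++ C =
      barFill (asTemplate 2 A ++ [some (Sum.inr 0)] ++ asTemplate 2 B ++ [some (Sum.inr 1)] ++
        asTemplate 2 C) ![r, r'] := fun r r' => by
    simp only [barFill_append, barFill_asTemplate]
    simp [barFill]
  have := localMove_barFill (asTemplate 2 A ++ [some (Sum.inr 0)] ++ asTemplate 2 B ++
    [some (Sum.inr 1)] ++ asTemplate 2 C) (fun h => by
    fin_cases h <;> simp [List.reduceOption_append, List.count_append])
    ![p, p'] ![q, q'] (e p p' ▸ hp) (e q q' ▸ hq)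
  convert this using 2
  · exact e p p'
  · exact e q q'

lemma localMove_two_swap {p q p' q' : List Endpoint} {A B C : BarWord}
    (hp : WellFormed (A ++ p'.map some ++ B ++ p.map some ++ C).reduceOption)
    (hq : WellFormed (A ++ q'.map some ++ B ++ q.map some ++ C).reduceOption) :
    LocalMove ![p, p'] ![q, q'] (BarWord.diagram _ hp) (BarWord.diagram _ hq) := by
  have e : ∀ r r' : List Endpoint, A ++ r'.map some ++ B ++ r.map some ++ C =
      barFill (asTemplate 2 A ++ [some (Sum.inr 1)] ++ asTemplate 2 B ++ [some (Sum.inr 0)] ++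
        asTemplate 2 C) ![r, r'] := fun r r' => by
    simp only [barFill_append, barFill_asTemplate]
    simp [barFill]
  have := localMove_barFill (asTemplate 2 A ++ [some (Sum.inr 1)] ++ asTemplate 2 B ++
    [some (Sum.inr 0)] ++ asTemplate 2 C) (fun h => by
    fin_cases h <;> simp [List.reduceOption_append, List.count_append])
    ![p, p'] ![q, q'] (e p p' ▸ hp) (e q q' ▸ hq)
  convert this using 2
  · exact e p p'
  · exact e q q'

namespace Sim

lemma of_step {w w' : BarWord} (h : WellFormed w.reduceOption) (h' : WellFormed w'.reduceOption)
    (hs : ReidemeisterStep (w.diagram h) (w'.diagram h') ∨ S1 (w.diagram h) (w'.diagram h') ∨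
      S2 (w.diagram h) (w'.diagram h')) : Sim w w' :=
  ⟨h, h', Relation.EqvGen.rel _ _ hs⟩

lemma of_R1 {A B : BarWord} {e : Endpoint}
    (h : WellFormed (A ++ [e, e.other].map some ++ B).reduceOption) :
    Sim (A ++ B) (A ++ [e, e.other].map some ++ B) := by
  have h' : WellFormed (A ++ ([] : List Endpoint).map some ++ B).reduceOption := by
    refine (h.perm (l' := e :: e.other :: (A ++ B).reduceOption) ?_).of_cons_pair.perm (by simp)
    simp only [List.reduceOption_append, reduceOption_map_some, List.append_assoc]
    exact List.perm_append_comm_assoc _ _ _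
  have := of_step h' h (Or.inl (Or.inr (Or.inl ⟨e, localMove_one h' h⟩)))
  simpa using this

end Sim

/-- The two circles of a word are rotated and the chords are renamed. -/
lemma Sim.of_iso {w w' : BarWord} (h : WellFormed w.reduceOption) (h' : WellFormed w'.reduceOption)
    (σ : Equiv.Perm ℕ) (h0 : (splitBar w).1.map (rename σ) ~r (splitBar w').1)
    (h1 : (splitBar w).2.map (rename σ) ~r (splitBar w').2) : Sim w w' := by
  refine .of_step h h' (Or.inl (Or.inl ⟨σ, fun i => ?_⟩))
  fin_cases i
  · exact h0
  · exact h1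

lemma perm_of_multiset {l l' : List Endpoint} (h : (l : Multiset Endpoint) = l') : l.Perm l' :=
  Multiset.coe_eq_coe.1 h

/-! ### Reidemeister and shell moves on words -/

/-- The first endpoint of a shell `c` of sign `s` around `x`. -/
def shellFst (x : Endpoint) (c : ℕ) (s : ℤˣ) : Endpoint :=
  if x.endSign = 1 then ini c s else ter c s

/-- The second endpoint of a shell `c` of sign `s` around `x`. -/
def shellSnd (x : Endpoint) (c : ℕ) (s : ℤˣ) : Endpoint :=
  if x.endSign = 1 then ter c s else ini c s

lemma shelled_eq (x : Endpoint) (c : ℕ) (s : ℤˣ) :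
    shelled c s x = [shellFst x c s, x, shellSnd x c s] := by
  unfold shelled shellFst shellSnd
  split_ifs <;> rfl

lemma WellFormed.of_append_pair {l : List Endpoint} {c : ℕ} {s : ℤˣ} {m : List Endpoint}
    (h : WellFormed m) (hp : (m : Multiset Endpoint) = {ini c s} + {ter c s} + l) :
    WellFormed l := by
  have : m.Perm (ini c s :: (ini c s).other :: l) := perm_of_multiset (by
    rw [hp, ← Multiset.cons_coe, ← Multiset.cons_coe, ← Multiset.singleton_add,
      ← Multiset.singleton_add, add_assoc]; rfl)
  exact (h.perm this).of_cons_pair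

lemma coe_reduceOption_append (A B : BarWord) :
    ((A ++ B).reduceOption : Multiset Endpoint) = A.reduceOption + B.reduceOption := by
  rw [List.reduceOption_append, Multiset.coe_add]

lemma coe_pair (x : Endpoint) (c : ℕ) (s : ℤˣ) :
    ({shellFst x c s} + {shellSnd x c s} : Multiset Endpoint) = {ini c s} + {ter c s} := by
  unfold shellFst shellSnd
  split_ifs
  · rfl
  · exact add_comm _ _

namespace Sim

/-- A parallel pair of chords of opposite signs is born by R2. -/
lemma of_R2 {A B C : BarWord} {a b : ℕ} {s : ℤˣ}
    (h : WellFormed (A ++ [ini a s, ini b (-s)].map some ++ B ++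
      [ter a s, ter b (-s)].map some ++ C).reduceOption) :
    Sim (A ++ B ++ C) (A ++ [ini a s, ini b (-s)].map some ++ B ++
      [ter a s, ter b (-s)].map some ++ C) := by
  have h' : WellFormed (A ++ ([] : List Endpoint).map some ++ B ++
      ([] : List Endpoint).map some ++ C).reduceOption := by
    refine WellFormed.of_append_pair (c := a) (s := s) (WellFormed.of_append_pair (c := b)
      (s := -s) (l := ini a s :: ter a s :: (A ++ ([] : List Endpoint).map some ++ B ++
      ([] : List Endpoint).map some ++ C).reduceOption) h ?_) ?_
    all_goals
      simp only [coe_reduceOption_append, reduceOption_map_some, ← Multiset.cons_coe,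
        ← Multiset.singleton_add, Multiset.coe_nil]
      abel
  simpa using of_step h' h (Or.inl (Or.inr (Or.inr (Or.inl ⟨a, b, s, Or.inl (localMove_two h' h)⟩))))

/-- The same move, with the terminal endpoints first. -/
lemma of_R2_swap {A B C : BarWord} {a b : ℕ} {s : ℤˣ}
    (h : WellFormed (A ++ [ter a s, ter b (-s)].map some ++ B ++
      [ini a s, ini b (-s)].map some ++ C).reduceOption) :
    Sim (A ++ B ++ C) (A ++ [ter a s, ter b (-s)].map some ++ B ++
      [ini a s, ini b (-s)].map some ++ C) := by
  have h' : WellFormed (A ++ ([] : List Endpoint).map some ++ B ++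
      ([] : List Endpoint).map some ++ C).reduceOption := by
    refine WellFormed.of_append_pair (c := a) (s := s) (WellFormed.of_append_pair (c := b)
      (s := -s) (l := ini a s :: ter a s :: (A ++ ([] : List Endpoint).map some ++ B ++
      ([] : List Endpoint).map some ++ C).reduceOption) h ?_) ?_
    all_goals
      simp only [coe_reduceOption_append, reduceOption_map_some, ← Multiset.cons_coe,
        ← Multiset.singleton_add, Multiset.coe_nil]
      abel
  simpa using of_step h' h
    (Or.inl (Or.inr (Or.inr (Or.inl ⟨a, b, s, Or.inl (localMove_two_swap h' h)⟩))))

/-- Two parallel shells of opposite signs are born by R2. -/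
lemma of_nested {A B C : BarWord} (x : Endpoint) {a b : ℕ} {s : ℤˣ}
    (h : WellFormed (A ++ [shellFst x a s, shellFst x b (-s)].map some ++ B ++
      [shellSnd x b (-s), shellSnd x a s].map some ++ C).reduceOption) :
    Sim (A ++ B ++ C) (A ++ [shellFst x a s, shellFst x b (-s)].map some ++ B ++
      [shellSnd x b (-s), shellSnd x a s].map some ++ C) := by
  have h' : WellFormed (A ++ ([] : List Endpoint).map some ++ B ++
      ([] : List Endpoint).map some ++ C).reduceOption := by
    refine WellFormed.of_append_pair (c := a) (s := s) (WellFormed.of_append_pair (c := b)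
      (s := -s) (l := ini a s :: ter a s :: (A ++ ([] : List Endpoint).map some ++ B ++
      ([] : List Endpoint).map some ++ C).reduceOption) h ?_) ?_
    · rw [← coe_pair x b (-s)]
      have := coe_pair x a s
      simp only [coe_reduceOption_append, reduceOption_map_some, ← Multiset.cons_coe,
        ← Multiset.singleton_add, Multiset.coe_nil]
      rw [← add_assoc {ini a s}, ← this]
      abel
    · simp only [coe_reduceOption_append, reduceOption_map_some, ← Multiset.cons_coe,
        ← Multiset.singleton_add, Multiset.coe_nil]
      abel
  have key : R2 (BarWord.diagram _ h') (BarWord.diagram _ h) := by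
    by_cases hx : x.endSign = 1
    · refine ⟨a, b, s, Or.inr ?_⟩
      have := localMove_two h' h
      simpa only [shellFst, shellSnd, if_pos hx] using this
    · refine ⟨b, a, -s, Or.inr ?_⟩
      have := localMove_two_swap h' h
      simpa only [shellFst, shellSnd, if_neg hx, neg_neg] using this
  simpa using of_step h' h (Or.inl (Or.inr (Or.inr (Or.inl key))))

/-- A shell slides to the other endpoint of the chord. -/
lemma of_S1 {A B C : BarWord} {x : Endpoint} {c : ℕ} {s : ℤˣ}
    (h : WellFormed (A ++ (shelled c s x).map some ++ B ++ [x.other].map some ++ C).reduceOption) :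
    Sim (A ++ (shelled c s x).map some ++ B ++ [x.other].map some ++ C)
      (A ++ [x].map some ++ B ++ (shelled c s x.other).map some ++ C) := by
  have h' : WellFormed
      (A ++ [x].map some ++ B ++ (shelled c s x.other).map some ++ C).reduceOption := by
    refine h.perm (perm_of_multiset ?_)
    have h1 := coe_pair x c s
    have h2 := coe_pair x.other c s
    simp only [coe_reduceOption_append, reduceOption_map_some, ← Multiset.cons_coe,
      ← Multiset.singleton_add, Multiset.coe_nil, shelled_eq]
    rw [← h2] at h1
    calc _ = (({shellFst x c s} + {shellSnd x c s}) : Multiset Endpoint) +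
        (A.reduceOption + {x} + B.reduceOption + {x.other} + C.reduceOption) := by abel
      _ = _ := by rw [h1]; abel
  exact of_step h h' (Or.inr (Or.inl ⟨x, c, s, localMove_two h h'⟩))

lemma of_S1_swap {A B C : BarWord} {x : Endpoint} {c : ℕ} {s : ℤˣ}
    (h : WellFormed (A ++ [x.other].map some ++ B ++ (shelled c s x).map some ++ C).reduceOption) :
    Sim (A ++ [x.other].map some ++ B ++ (shelled c s x).map some ++ C)
      (A ++ (shelled c s x.other).map some ++ B ++ [x].map some ++ C) := by
  have h' : WellFormed
      (A ++ (shelled c s x.other).map some ++ B ++ [x].map some ++ C).reduceOption := by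
    refine h.perm (perm_of_multiset ?_)
    have h1 := coe_pair x c s
    have h2 := coe_pair x.other c s
    simp only [coe_reduceOption_append, reduceOption_map_some, ← Multiset.cons_coe,
      ← Multiset.singleton_add, Multiset.coe_nil, shelled_eq]
    rw [← h2] at h1
    calc _ = (({shellFst x c s} + {shellSnd x c s}) : Multiset Endpoint) +
        (A.reduceOption + {x} + B.reduceOption + {x.other} + C.reduceOption) := by abel
      _ = _ := by rw [h1]; abel
  exact of_step h h' (Or.inr (Or.inl ⟨x, c, s, localMove_two_swap h h'⟩))

end Sim

/-! ### Chords with stacks of shells -/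

/-- The name of the chord `c` of a diagram in the diagrams where chords have shells. -/
def coreName (c : ℕ) : ℕ := 2 * Nat.pair c 0

/-- The name of the `j`-th shell (counted from outside) around the endpoint `e`. -/
def shellName (e : Endpoint) (j : ℕ) : ℕ :=
  2 * Nat.pair e.chord (2 * j + 1 + if e.terminal then 1 else 0)

/-- An odd number: a name that is used neither for chords nor for shells. -/
def spareName (e : Endpoint) : ℕ := 1 + 2 * if e.terminal then 1 else 0

/-- The endpoint `e`, with the chord renamed to make room for the names of shells. -/
def core (e : Endpoint) : Endpoint := ⟨coreName e.chord, e.terminal, e.sign⟩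

@[simp] lemma endSign_core (e : Endpoint) : (core e).endSign = e.endSign := rfl

@[simp] lemma core_other (e : Endpoint) : core e.other = (core e).other := rfl

@[simp] lemma coreName_inj {c d : ℕ} : coreName c = coreName d ↔ c = d := by
  simp [coreName, Nat.pair_eq_pair]

lemma coreName_ne_shellName (c : ℕ) (e : Endpoint) (j : ℕ) : coreName c ≠ shellName e j := by
  simp only [coreName, shellName, ne_eq, mul_eq_mul_left_iff, Nat.pair_eq_pair]
  omega

lemma shellName_inj {e f : Endpoint} {i j : ℕ} (h : shellName e i = shellName f j) :
    e.chord = f.chord ∧ e.terminal = f.terminal ∧ i = j := by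
  simp only [shellName, mul_eq_mul_left_iff, Nat.pair_eq_pair] at h
  rcases h with ⟨h1, h2⟩ | h
  · refine ⟨h1, ?_, ?_⟩
    · cases he : e.terminal <;> cases hf : f.terminal <;> simp_all <;> omega
    · split_ifs at h2 <;> omega
  · omega

lemma spareName_ne_coreName (e : Endpoint) (c : ℕ) : spareName e ≠ coreName c := by
  unfold spareName coreName; omega

lemma spareName_ne_shellName (e f : Endpoint) (j : ℕ) : spareName e ≠ shellName f j := by
  unfold spareName shellName; omega

/-- The sign of an integer, as a unit. -/
def unitSign (k : ℤ) : ℤˣ := if 0 ≤ k then 1 else -1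

/-- The first endpoints of `n` parallel shells of sign `s` around `e`, from outside to inside. -/
def shellsBefore (e : Endpoint) (s : ℤˣ) : ℕ → List Endpoint
  | 0 => []
  | n + 1 => shellsBefore e s n ++ [shellFst e (shellName e n) s]

/-- The second endpoints of `n` parallel shells of sign `s` around `e`, from inside to outside. -/
def shellsAfter (e : Endpoint) (s : ℤˣ) : ℕ → List Endpoint
  | 0 => []
  | n + 1 => shellSnd e (shellName e n) s :: shellsAfter e s n

/-- The endpoint `e` surrounded by `|k|` parallel shells of the sign of `k`, and innermost by the
word `m` instead of `e` alone. -/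
def stack (e : Endpoint) (k : ℤ) (m : List Endpoint) : List Endpoint :=
  shellsBefore e (unitSign k) k.natAbs ++ m ++ shellsAfter e (unitSign k) k.natAbs

/-- Replace each endpoint of a word with a bar by a word. -/
def expandWord (E : Endpoint → List Endpoint) (w : BarWord) : BarWord :=
  w.flatMap fun o => o.elim [none] fun e => (E e).map some

/-- The diagram `w`, in which each endpoint `e` is surrounded by `|κ e|` parallel shells of the sign
of `κ e`. -/
def withShells (κ : Endpoint → ℤ) (w : BarWord) : BarWord :=
  expandWord (fun e => stack e (κ e) [core e]) w

lemma expandWord_append (E : Endpoint → List Endpoint) (v w : BarWord) :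
    expandWord E (v ++ w) = expandWord E v ++ expandWord E w := by simp [expandWord]

lemma expandWord_congr {E E' : Endpoint → List Endpoint} {w : BarWord}
    (h : ∀ e ∈ w.reduceOption, E e = E' e) : expandWord E w = expandWord E' w := by
  unfold expandWord
  refine List.flatMap_congr fun o ho => ?_
  cases o with
  | none => rfl
  | some e => simp [h e (by simpa [List.reduceOption_mem_iff] using ho)]

lemma reduceOption_expandWord (E : Endpoint → List Endpoint) (w : BarWord) :
    (expandWord E w).reduceOption = w.reduceOption.flatMap E := by
  induction w with
  | nil => rfl
  | cons o w ih =>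
    rw [← List.singleton_append, expandWord_append, List.reduceOption_append, ih,
      List.reduceOption_append, List.flatMap_append]
    cases o <;> simp [expandWord, List.reduceOption]

lemma exists_eq_append {w : BarWord} {x : Endpoint} (hx : x ∈ w.reduceOption)
    (hw : w.reduceOption.Nodup) : ∃ A B : BarWord, w = A ++ some x :: B ∧
      x ∉ A.reduceOption ∧ x ∉ B.reduceOption := by
  rw [List.reduceOption_mem_iff] at hx
  obtain ⟨A, B, rfl⟩ := List.append_of_mem hx
  refine ⟨A, B, rfl, ?_⟩
  rw [List.reduceOption_append, List.reduceOption_cons_of_some, List.nodup_append] at hw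
  refine ⟨fun h => hw.2.2 x h x (by simp) rfl, ?_⟩
  exact (List.nodup_cons.1 hw.2.1).1

lemma expandWord_update_of_notMem {E : Endpoint → List Endpoint} {w : BarWord} {x : Endpoint}
    (hx : x ∉ w.reduceOption) (L : List Endpoint) :
    expandWord (Function.update E x L) w = expandWord E w :=
  expandWord_congr fun e he => Function.update_of_ne (fun h : e = x => hx (h ▸ he)) _ _

lemma exists_expandWord_update {w : BarWord} {x : Endpoint} (hx : x ∈ w.reduceOption)
    (hw : w.reduceOption.Nodup) (E : Endpoint → List Endpoint) :
    ∃ A B : BarWord, ∀ L, expandWord (Function.update E x L) w = A ++ L.map some ++ B := by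
  obtain ⟨A, B, rfl, hA, hB⟩ := exists_eq_append hx hw
  refine ⟨expandWord E A, expandWord E B, fun L => ?_⟩
  rw [← List.singleton_append, expandWord_append, expandWord_append,
    expandWord_update_of_notMem hA, expandWord_update_of_notMem hB]
  simp [expandWord]

lemma exists_expandWord_update_update {w : BarWord} {x y : Endpoint} (hxy : x ≠ y)
    (hx : x ∈ w.reduceOption) (hy : y ∈ w.reduceOption) (hw : w.reduceOption.Nodup)
    (E : Endpoint → List Endpoint) :
    ∃ A B C : BarWord, (∀ L M, expandWord (Function.update (Function.update E x L) y M) w =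
        A ++ L.map some ++ B ++ M.map some ++ C) ∨
      (∀ L M, expandWord (Function.update (Function.update E x L) y M) w =
        A ++ M.map some ++ B ++ L.map some ++ C) := by
  obtain ⟨A, B, rfl, hA, hB⟩ := exists_eq_append hx hw
  have hnd := hw
  rw [List.reduceOption_append, List.reduceOption_cons_of_some, List.nodup_append,
    List.nodup_cons] at hnd
  have hy' : y ∈ A.reduceOption ∨ y ∈ B.reduceOption := by
    simpa [List.reduceOption_append, List.reduceOption_cons_of_some, hxy.symm] using hy
  have hcomm : ∀ L M, Function.update (Function.update E x L) y M =
      Function.update (Function.update E y M) x L := fun L M => Function.update_comm hxy _ _ _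
  rcases hy' with hy' | hy'
  · have hyB : y ∉ B.reduceOption := fun h => hnd.2.2 y hy' y (by simp [h]) rfl
    obtain ⟨A1, A2, hA12⟩ := exists_expandWord_update hy' hnd.1 E
    refine ⟨A1, A2, expandWord E B, Or.inr fun L M => ?_⟩
    rw [hcomm, ← List.singleton_append, expandWord_append, expandWord_append,
      expandWord_update_of_notMem hA, hA12, expandWord_update_of_notMem hB,
      expandWord_update_of_notMem hyB]
    simp [expandWord]
  · have hyA : y ∉ A.reduceOption := fun h => hnd.2.2 y h y (by simp [hy']) rfl
    obtain ⟨B1, B2, hB12⟩ := exists_expandWord_update hy' hnd.2.1.2 E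
    refine ⟨expandWord E A, B1, B2, Or.inl fun L M => ?_⟩
    rw [hcomm, ← List.singleton_append, expandWord_append, expandWord_append,
      expandWord_update_of_notMem hA, expandWord_update_of_notMem hB, hB12,
      expandWord_update_of_notMem hyA]
    simp [expandWord]

lemma WellFormed.map_core {l : List Endpoint} (h : WellFormed l) : WellFormed (l.map core) := by
  have hinj : Function.Injective core := by
    rintro ⟨a, b, c⟩ ⟨a', b', c'⟩ h
    simp only [core, Endpoint.mk.injEq, coreName_inj] at h
    simp [h]
  refine ⟨h.1.map hinj, ?_, ?_⟩
  · intro e he f hf hef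
    obtain ⟨e, he', rfl⟩ := List.mem_map.1 he
    obtain ⟨f, hf', rfl⟩ := List.mem_map.1 hf
    exact h.2.1 e he' f hf' (coreName_inj.1 hef)
  · intro e he
    obtain ⟨e, he', rfl⟩ := List.mem_map.1 he
    exact List.mem_map.2 ⟨e.other, h.2.2 e he', rfl⟩

/-- The two endpoints of each of a list of chords, given by their names and signs. -/
def chordEnds (c : List (ℕ × ℤˣ)) : List Endpoint := c.flatMap fun n => [ini n.1 n.2, ter n.1 n.2]

lemma mem_chordEnds {c : List (ℕ × ℤˣ)} {f : Endpoint} (h : f ∈ chordEnds c) :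
    f.chord ∈ c.map Prod.fst := by
  obtain ⟨n, hn, hf⟩ := List.mem_flatMap.1 h
  simp only [List.mem_cons, List.not_mem_nil, or_false] at hf
  rcases hf with rfl | rfl <;> exact List.mem_map_of_mem hn

lemma WellFormed.chordEnds_append {l : List Endpoint} (h : WellFormed l) {c : List (ℕ × ℤˣ)}
    (hc : (c.map Prod.fst).Nodup) (hl : ∀ f ∈ l, f.chord ∉ c.map Prod.fst) :
    WellFormed (chordEnds c ++ l) := by
  induction c with
  | nil => exact h
  | cons n c ih =>
    rw [List.map_cons, List.nodup_cons] at hc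
    refine WellFormed.cons_pair (e := ini n.1 n.2) (ih hc.2 fun f hf hf' => hl f hf (by simp [hf']))
      fun f hf hfn => ?_
    rcases List.mem_append.1 hf with hf | hf
    · exact hc.1 (by simpa [hfn] using mem_chordEnds hf)
    · exact hl f hf (by simp [hfn])

/-- The shells in a stack. -/
def shellList (e : Endpoint) (k : ℤ) : List (ℕ × ℤˣ) :=
  (List.range k.natAbs).map fun j => (shellName e j, unitSign k)

lemma coe_shellsBefore_add (e : Endpoint) (s : ℤˣ) (n : ℕ) :
    (shellsBefore e s n : Multiset Endpoint) + shellsAfter e s n =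
      chordEnds ((List.range n).map fun j => (shellName e j, s)) := by
  induction n with
  | zero => rfl
  | succ n ih =>
    rw [List.range_succ, List.map_append, chordEnds, List.flatMap_append, ← Multiset.coe_add]
    unfold chordEnds at ih
    rw [← ih, shellsBefore, shellsAfter, ← Multiset.coe_add, ← Multiset.cons_coe,
      ← Multiset.singleton_add]
    have := coe_pair e (shellName e n) s
    simp only [List.map_cons, List.map_nil, List.flatMap_cons, List.flatMap_nil, List.append_nil,
      ← Multiset.cons_coe, Multiset.coe_nil, ← Multiset.singleton_add, add_zero]
    rw [← this]
    abel

lemma coe_stack (e : Endpoint) (k : ℤ) (m : List Endpoint) :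
    (stack e k m : Multiset Endpoint) = chordEnds (shellList e k) + m := by
  rw [shellList, ← coe_shellsBefore_add, stack, ← Multiset.coe_add, ← Multiset.coe_add]
  abel

lemma coe_withShells (κ : Endpoint → ℤ) (w : BarWord) :
    ((withShells κ w).reduceOption : Multiset Endpoint) =
      (chordEnds (w.reduceOption.flatMap fun e => shellList e (κ e)) ++
        w.reduceOption.map core : List Endpoint) := by
  rw [withShells, reduceOption_expandWord]
  induction w.reduceOption with
  | nil => rfl
  | cons e l ih =>
    rw [List.flatMap_cons, ← Multiset.coe_add, ih, coe_stack]
    simp only [chordEnds, List.flatMap_cons, List.flatMap_append, List.map_cons,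
      ← Multiset.coe_add, ← Multiset.cons_coe, ← Multiset.singleton_add, Multiset.coe_nil]
    abel

lemma mem_shellList {e : Endpoint} {k : ℤ} {c : ℕ} (h : c ∈ (shellList e k).map Prod.fst) :
    ∃ j < k.natAbs, c = shellName e j := by
  simp only [shellList, List.map_map, List.mem_map, List.mem_range, Function.comp] at h
  obtain ⟨j, hj, rfl⟩ := h
  exact ⟨j, hj, rfl⟩

lemma withShells_chord {κ : Endpoint → ℤ} {w : BarWord} {f : Endpoint}
    (hf : f ∈ (withShells κ w).reduceOption) :
    (∃ c, f.chord = coreName c) ∨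
      ∃ e ∈ w.reduceOption, ∃ j < (κ e).natAbs, f.chord = shellName e j := by
  rw [← Multiset.mem_coe, coe_withShells, Multiset.mem_coe, List.mem_append] at hf
  rcases hf with hf | hf
  · right
    have := mem_chordEnds hf
    rw [List.map_flatMap, List.mem_flatMap] at this
    obtain ⟨e, he, h⟩ := this
    exact ⟨e, he, mem_shellList h⟩
  · left
    obtain ⟨e, -, rfl⟩ := List.mem_map.1 hf
    exact ⟨e.chord, rfl⟩

lemma WellFormed.eq_of_chord_terminal {l : List Endpoint} (h : WellFormed l) {e f : Endpoint}
    (he : e ∈ l) (hf : f ∈ l) (hc : e.chord = f.chord) (ht : e.terminal = f.terminal) : e = f := by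
  have := h.2.1 e he f hf hc
  cases e; cases f; simp_all

lemma WellFormed.withShells {w : BarWord} (h : WellFormed w.reduceOption) (κ : Endpoint → ℤ) :
    WellFormed (withShells κ w).reduceOption := by
  refine WellFormed.perm ?_ (perm_of_multiset (coe_withShells κ w).symm)
  refine h.map_core.chordEnds_append ?_ ?_
  · rw [List.map_flatMap, List.nodup_flatMap]
    constructor
    · intro e _
      rw [shellList, List.map_map]
      exact List.nodup_range.map fun i j hij => (shellName_inj hij).2.2
    · refine h.1.imp_of_mem fun {e f} he hf hef c hc hc' => ?_
      obtain ⟨i, -, rfl⟩ := mem_shellList hc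
      obtain ⟨j, -, hj⟩ := mem_shellList hc'
      have := shellName_inj hj
      exact hef (h.eq_of_chord_terminal he hf this.1 this.2.1)
  · intro f hf hf'
    obtain ⟨e, -, rfl⟩ := List.mem_map.1 hf
    rw [List.map_flatMap, List.mem_flatMap] at hf'
    obtain ⟨a, -, ha⟩ := hf'
    obtain ⟨j, -, hj⟩ := mem_shellList ha
    exact coreName_ne_shellName _ _ _ hj

/-! ### Shells can be moved to the other endpoint -/

@[simp] lemma stack_zero (e : Endpoint) (m : List Endpoint) : stack e 0 m = m := by
  simp [stack, shellsBefore, shellsAfter]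

/-- Adding a shell of sign `s` to a stack of `k` shells makes it longer if `0 ≤ k * s`. -/
lemma stack_add_of_nonneg (e : Endpoint) {k : ℤ} {s : ℤˣ} (h : 0 ≤ k * s) (m : List Endpoint) :
    stack e (k + s) m = stack e k
      ([shellFst e (shellName e k.natAbs) s] ++ m ++ [shellSnd e (shellName e k.natAbs) s]) := by
  have h1 : (k + s).natAbs = k.natAbs + 1 := by
    rcases units_cases s with rfl | rfl <;> simp at h ⊢ <;> omega
  have h2 : unitSign (k + s) = s := by
    unfold unitSign
    rcases units_cases s with rfl | rfl
    · simp at h ⊢; omega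
    · simp at h ⊢; omega
  have h3 : ∀ n, k.natAbs = n → shellsBefore e (unitSign k) n = shellsBefore e s n ∧
      shellsAfter e (unitSign k) n = shellsAfter e s n := by
    intro n hn
    by_cases hk : k = 0
    · subst hk
      rw [← hn]
      exact ⟨rfl, rfl⟩
    · have : unitSign k = s := by
        unfold unitSign
        rcases units_cases s with rfl | rfl
        · simp at h ⊢; omega
        · simp at h ⊢; omega
      rw [this]
      exact ⟨rfl, rfl⟩
  simp [stack, h1, h2, shellsBefore, shellsAfter, h3]

lemma stack_add_of_neg (e : Endpoint) {k : ℤ} {s : ℤˣ} (h : k * s < 0) (m : List Endpoint) :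
    stack e k m = stack e (k + s) ([shellFst e (shellName e (k + s).natAbs) (-s)] ++ m ++
      [shellSnd e (shellName e (k + s).natAbs) (-s)]) := by
  have := stack_add_of_nonneg e (k := k + s) (s := -s) (by
    rcases units_cases s with rfl | rfl <;> simp at h ⊢ <;> omega) m
  rw [← this]
  congr 1
  simp

/-- A name for a shell of sign `s` that is added to a stack of `k` shells: the next name if the
stack becomes longer, and a spare name if the new shell will cancel. -/
def nextName (e : Endpoint) (k : ℤ) (s : ℤˣ) : ℕ :=
  if 0 ≤ k * s then shellName e k.natAbs else spareName e

lemma Sim.absorb {A B : BarWord} {e : Endpoint} {k : ℤ} {s : ℤˣ}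
    (h : WellFormed (A ++ (stack e k (shelled (nextName e k s) s (core e))).map some ++
      B).reduceOption) :
    Sim (A ++ (stack e k (shelled (nextName e k s) s (core e))).map some ++ B)
      (A ++ (stack e (k + s) [core e]).map some ++ B) := by
  by_cases hk : 0 ≤ k * s
  · have : stack e k (shelled (nextName e k s) s (core e)) = stack e (k + s) [core e] := by
      rw [stack_add_of_nonneg e hk, nextName, if_pos hk, shelled_eq]
      rfl
    rw [this] at h ⊢
    exact Sim.refl h
  · rw [stack_add_of_neg e (not_le.1 hk), shelled_eq] at h ⊢
    set n := shellName e (k + s).natAbs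
    set d := nextName e k s
    have hs : shellFst (core e) d s = shellFst e d (- -s) ∧
        shellSnd (core e) d s = shellSnd e d (- -s) := by
      rw [neg_neg]; exact ⟨rfl, rfl⟩
    rw [hs.1, hs.2] at h ⊢
    set P := shellsBefore e (unitSign (k + s)) (k + s).natAbs with hP
    set Q := shellsAfter e (unitSign (k + s)) (k + s).natAbs with hQ
    have := Sim.of_nested (A := A ++ P.map some) (B := [core e].map some) (C := Q.map some ++ B) e
      (a := n) (b := d) (s := -s) (by
        convert h using 2
        simp [stack, ← hP, ← hQ])
    convert this.symm using 1
    · simp [stack, ← hP, ← hQ]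
    · simp [stack, ← hP, ← hQ]

lemma nextName_ne {κ : Endpoint → ℤ} {w : BarWord} (hw : WellFormed w.reduceOption) {x : Endpoint}
    (hx : x ∈ w.reduceOption) (s : ℤˣ) {f : Endpoint} (hf : f ∈ (withShells κ w).reduceOption) :
    f.chord ≠ nextName x (κ x) s := by
  intro h
  unfold nextName at h
  rcases withShells_chord hf with ⟨c, hc⟩ | ⟨e, he, j, hj, hc⟩
  · rw [hc] at h
    split_ifs at h
    · exact coreName_ne_shellName _ _ _ h
    · exact spareName_ne_coreName _ _ h.symm
  · rw [hc] at h
    split_ifs at h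
    · obtain ⟨h1, h2, h3⟩ := shellName_inj h
      have := hw.eq_of_chord_terminal he hx h1 h2
      subst this
      omega
    · exact spareName_ne_shellName _ _ _ h.symm

lemma nextName_ne_nextName_other (x : Endpoint) (k k' : ℤ) (s s' : ℤˣ) :
    nextName x k s ≠ nextName x.other k' s' := by
  intro h
  unfold nextName at h
  split_ifs at h
  · have := (shellName_inj h).2.1
    simp at this
  · exact spareName_ne_shellName _ _ _ h.symm
  · exact spareName_ne_shellName _ _ _ h
  · unfold spareName at h
    cases hx : x.terminal <;> simp [hx] at h

/-- A shell slides from `x.other` to `x`. -/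
lemma Sim.slide_unit {w : BarWord} (hw : WellFormed w.reduceOption) (κ : Endpoint → ℤ)
    {x : Endpoint} (hx : x ∈ w.reduceOption) (s : ℤˣ) :
    Sim (withShells κ w) (withShells (Function.update (Function.update κ x (κ x + s)) x.other
      (κ x.other - s)) w) := by
  set E : Endpoint → List Endpoint := fun e => stack e (κ e) [core e] with hE
  set d := nextName x (κ x) s with hd
  set d' := nextName x.other (κ x.other) (-s) with hd'
  have hdd : d ≠ d' := nextName_ne_nextName_other _ _ _ _ _
  have hne := x.other_ne.symm
  obtain ⟨A, B, C, H⟩ := exists_expandWord_update_update hne hx (hw.2.2 x hx) hw.1 E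
  have e0 : withShells κ w = expandWord (Function.update (Function.update E x
      (stack x (κ x) [core x])) x.other (stack x.other (κ x.other) [core x.other])) w := by
    refine expandWord_congr fun e _ => ?_
    by_cases h1 : e = x.other
    · subst h1; simp
    · simp [h1, hE]
  have e4 : withShells (Function.update (Function.update κ x (κ x + s)) x.other
      (κ x.other - s)) w = expandWord (Function.update (Function.update E x
      (stack x (κ x + s) [core x])) x.other
      (stack x.other (κ x.other + ((-s : ℤˣ) : ℤ)) [core x.other])) w := by
    refine expandWord_congr fun e _ => ?_
    by_cases h1 : e = x.other
    · subst h1; simp [sub_eq_add_neg]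
    · by_cases h2 : e = x
      · subst h2; simp [h1]
      · simp [h1, h2, hE]
  -- two shells of opposite signs are born around `x`
  have s1 : Sim (withShells κ w) (expandWord (Function.update (Function.update E x
      (stack x (κ x) ([shellFst x d s, shellFst x d' (-s)] ++ [core x] ++
        [shellSnd x d' (-s), shellSnd x d s]))) x.other
      (stack x.other (κ x.other) [core x.other])) w) := by
    have hwf := hw.withShells κ
    have hf1 : ∀ f ∈ (withShells κ w).reduceOption, f.chord ≠ d := fun f => nextName_ne hw hx s
    have hf2 : ∀ f ∈ (withShells κ w).reduceOption, f.chord ≠ d' := fun f =>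
      nextName_ne hw (hw.2.2 x hx) (-s)
    have hwf' := hwf.chordEnds_append (c := [(d, s), (d', -s)]) (by simpa using hdd)
      (fun f hf => by simpa using ⟨hf1 f hf, hf2 f hf⟩)
    rw [e0] at hwf' ⊢
    have hc1 := coe_pair x d s
    have hc2 := coe_pair x d' (-s)
    set P := shellsBefore x (unitSign (κ x)) (κ x).natAbs with hP
    set Q := shellsAfter x (unitSign (κ x)) (κ x).natAbs with hQ
    rcases H with H | H
    · rw [H] at hwf' ⊢
      rw [H]
      have := Sim.of_nested (A := A ++ P.map some) (B := [core x].map some)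
        (C := Q.map some ++ B ++ (stack x.other (κ x.other) [core x.other]).map some ++ C) x
        (a := d) (b := d') (s := s) (by
          refine hwf'.perm (perm_of_multiset ?_)
          simp only [← Multiset.coe_add, coe_reduceOption_append, reduceOption_map_some, stack,
            ← hP, ← hQ, chordEnds, List.flatMap_cons, List.flatMap_nil, ← Multiset.cons_coe,
            Multiset.coe_nil, ← Multiset.singleton_add, add_zero]
          rw [← hc1, ← hc2]
          abel)
      convert this using 1
      · simp [stack, ← hP, ← hQ]
      · simp [stack, ← hP, ← hQ]
    · rw [H] at hwf' ⊢
      rw [H]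
      have := Sim.of_nested (A := A ++ (stack x.other (κ x.other) [core x.other]).map some ++ B ++
        P.map some) (B := [core x].map some) (C := Q.map some ++ C) x
        (a := d) (b := d') (s := s) (by
          refine hwf'.perm (perm_of_multiset ?_)
          simp only [← Multiset.coe_add, coe_reduceOption_append, reduceOption_map_some, stack,
            ← hP, ← hQ, chordEnds, List.flatMap_cons, List.flatMap_nil, ← Multiset.cons_coe,
            Multiset.coe_nil, ← Multiset.singleton_add, add_zero]
          rw [← hc1, ← hc2]
          abel)
      convert this using 1
      · simp [stack, ← hP, ← hQ]
      · simp [stack, ← hP, ← hQ]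
  -- the inner one slides to the other endpoint
  have s2 : Sim (expandWord (Function.update (Function.update E x
      (stack x (κ x) ([shellFst x d s, shellFst x d' (-s)] ++ [core x] ++
        [shellSnd x d' (-s), shellSnd x d s]))) x.other
      (stack x.other (κ x.other) [core x.other])) w)
      (expandWord (Function.update (Function.update E x
      (stack x (κ x) (shelled d s (core x)))) x.other
      (stack x.other (κ x.other) (shelled d' (-s) (core x.other)))) w) := by
    have h1 := s1.right
    set P := shellsBefore x (unitSign (κ x)) (κ x).natAbs with hP
    set Q := shellsAfter x (unitSign (κ x)) (κ x).natAbs with hQ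
    set P' := shellsBefore x.other (unitSign (κ x.other)) (κ x.other).natAbs with hP'
    set Q' := shellsAfter x.other (unitSign (κ x.other)) (κ x.other).natAbs with hQ'
    have hsh : shelled d' (-s) (core x) = [shellFst x d' (-s), core x, shellSnd x d' (-s)] :=
      shelled_eq _ _ _
    have hsh' : shelled d s (core x) = [shellFst x d s, core x, shellSnd x d s] :=
      shelled_eq _ _ _
    rcases H with H | H
    · rw [H] at h1 ⊢
      rw [H]
      have := Sim.of_S1 (A := A ++ (P ++ [shellFst x d s]).map some)
        (B := (shellSnd x d s :: Q).map some ++ B ++ P'.map some) (C := Q'.map some ++ C)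
        (x := core x) (c := d') (s := -s) (by
          convert h1 using 2
          simp [stack, ← hP, ← hQ, ← hP', ← hQ', hsh])
      convert this using 1
      · simp [stack, ← hP, ← hQ, ← hP', ← hQ', hsh]
      · simp [stack, ← hP, ← hQ, ← hP', ← hQ', hsh']
    · rw [H] at h1 ⊢
      rw [H]
      have := Sim.of_S1_swap (A := A ++ P'.map some)
        (B := Q'.map some ++ B ++ (P ++ [shellFst x d s]).map some)
        (C := (shellSnd x d s :: Q).map some ++ C)
        (x := core x) (c := d') (s := -s) (by
          convert h1 using 2
          simp [stack, ← hP, ← hQ, ← hP', ← hQ', hsh])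
      convert this using 1
      · simp [stack, ← hP, ← hQ, ← hP', ← hQ', hsh]
      · simp [stack, ← hP, ← hQ, ← hP', ← hQ', hsh']
  -- both shells become part of the stacks
  have s3 : Sim (expandWord (Function.update (Function.update E x
      (stack x (κ x) (shelled d s (core x)))) x.other
      (stack x.other (κ x.other) (shelled d' (-s) (core x.other)))) w)
      (expandWord (Function.update (Function.update E x
      (stack x (κ x + s) [core x])) x.other
      (stack x.other (κ x.other) (shelled d' (-s) (core x.other)))) w) := by
    have h1 := s2.right
    rcases H with H | H
    · rw [H] at h1 ⊢
      rw [H]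
      simp only [List.append_assoc] at h1 ⊢
      simp only [← List.append_assoc A] at h1 ⊢
      exact Sim.absorb h1
    · rw [H] at h1 ⊢
      rw [H]
      exact Sim.absorb h1
  have s4 : Sim (expandWord (Function.update (Function.update E x
      (stack x (κ x + s) [core x])) x.other
      (stack x.other (κ x.other) (shelled d' (-s) (core x.other)))) w)
      (withShells (Function.update (Function.update κ x (κ x + s)) x.other
      (κ x.other - s)) w) := by
    rw [e4]
    have h1 := s3.right
    rcases H with H | H
    · rw [H] at h1 ⊢
      rw [H]
      exact Sim.absorb h1
    · rw [H] at h1 ⊢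
      rw [H]
      simp only [List.append_assoc] at h1 ⊢
      simp only [← List.append_assoc A] at h1 ⊢
      exact Sim.absorb h1
  exact ((s1.trans s2).trans s3).trans s4

lemma withShells_congr {κ κ' : Endpoint → ℤ} {w : BarWord}
    (h : ∀ e ∈ w.reduceOption, κ e = κ' e) : withShells κ w = withShells κ' w :=
  expandWord_congr fun e he => by rw [h e he]

namespace Sim

lemma slide {w : BarWord} (hw : WellFormed w.reduceOption) (κ : Endpoint → ℤ)
    {x : Endpoint} (hx : x ∈ w.reduceOption) (k : ℤ) :
    Sim (withShells κ w) (withShells (Function.update (Function.update κ x (κ x + k)) x.other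
      (κ x.other - k)) w) := by
  have hne := x.other_ne.symm
  induction k using Int.induction_on with
  | zero => simpa using Sim.refl (hw.withShells κ)
  | succ k ih =>
    refine ih.trans ?_
    convert slide_unit hw _ hx 1 using 2
    funext e
    by_cases h1 : e = x.other
    · subst h1; simp; ring
    · by_cases h2 : e = x
      · subst h2; simp [h1]; ring
      · simp [h1, h2]
  | pred k ih =>
    refine ih.trans ?_
    convert slide_unit hw _ hx (-1) using 2
    funext e
    by_cases h1 : e = x.other
    · subst h1; simp; ring
    · by_cases h2 : e = x
      · subst h2; simp [h1]; ring
      · simp [h1, h2]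

/-- Only the total number of shells on the two endpoints of a chord matters. -/
lemma withShells_congr {w : BarWord} (hw : WellFormed w.reduceOption) {κ κ' : Endpoint → ℤ}
    (h : ∀ e ∈ w.reduceOption, κ e + κ e.other = κ' e + κ' e.other) :
    Sim (withShells κ w) (withShells κ' w) := by
  have key : ∀ l : List Endpoint, (∀ e ∈ l, e ∈ w.reduceOption) →
      Sim (withShells κ w) (withShells (fun e => if e ∈ l ∨ e.other ∈ l then κ' e else κ e) w) := by
    intro l hl
    induction l with
    | nil => simpa using Sim.refl (hw.withShells κ)
    | cons x l ih =>
      refine (ih fun e he => hl e (by simp [he])).trans ?_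
      set κl : Endpoint → ℤ := fun e => if e ∈ l ∨ e.other ∈ l then κ' e else κ e with hκl
      have hx := hl x (by simp)
      have hsum : κl x + κl x.other = κ' x + κ' x.other := by
        simp only [hκl, other_other, or_comm (a := x.other ∈ l)]
        split_ifs
        · rfl
        · exact h x hx
      convert slide hw κl hx (κ' x - κl x) using 2
      funext e
      by_cases h1 : e = x.other
      · subst h1
        simp
        linarith
      · by_cases h2 : e = x
        · subst h2; simp [h1]
        · have h3 : e.other ≠ x := fun h => h1 (by rw [← h, other_other])
          simp [h1, h2, h3, hκl]
  refine (key w.reduceOption fun e he => he).trans ?_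
  rw [VirtualLinks.withShells_congr (κ' := κ')]
  · exact Sim.refl (hw.withShells κ')
  · intro e he
    simp [he]

end Sim

/-! ### Diagrams with prescribed indices -/

lemma before_cons (x : Endpoint) (l : List Endpoint) (e : Endpoint) :
    before (x :: l) e = if x = e then 0 else x.endSign + before l e := by
  unfold before
  rw [List.takeWhile_cons]
  by_cases h : x = e <;> simp [h]

lemma before_append (l m : List Endpoint) (e : Endpoint) :
    before (l ++ m) e = if e ∈ l then before l e else signSum l + before m e := by
  induction l with
  | nil => simp
  | cons x l ih =>
    rw [List.cons_append, before_cons, before_cons, ih]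
    by_cases h : x = e
    · simp [h]
    · by_cases h' : e ∈ l <;> simp [h, h', Ne.symm h, add_assoc]

/-- The number of shells at the terminal endpoint that gives each chord `c` the index `I c`. -/
def stackFor (w : BarWord) (I : ℕ → ℤ) (e : Endpoint) : ℤ :=
  if e.terminal then
    e.sign * (heightIn w.reduceOption e - heightIn w.reduceOption e.other - I e.chord)
  else 0

/-- The diagram `w` in which the chords have received shells such that each chord `c` has the
index `I c`. -/
def withIndex (w : BarWord) (I : ℕ → ℤ) : BarWord := withShells (stackFor w I) w

/-- With `κ e` shells around each endpoint `e`, each chord `c` of `w` has the index `I c`: a shell of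
sign `s` lowers the index of a chord of sign `ε` by `ε * s`. -/
def HasIndex (w : BarWord) (κ : Endpoint → ℤ) (I : ℕ → ℤ) : Prop :=
  ∀ e ∈ w.reduceOption, e.terminal = true →
    heightIn w.reduceOption e - heightIn w.reduceOption e.other - e.sign * (κ e + κ e.other) =
      I e.chord

lemma unit_mul_self (s : ℤˣ) : (s : ℤ) * s = 1 := by
  rcases units_cases s with rfl | rfl <;> simp

lemma hasIndex_stackFor (w : BarWord) (I : ℕ → ℤ) : HasIndex w (stackFor w I) I := by
  intro e _ ht
  simp only [stackFor, ht, other_terminal, if_true, Bool.not_true, Bool.false_eq_true, if_false,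
    add_zero]
  rw [← mul_assoc, unit_mul_self]
  ring

lemma Sim.of_hasIndex {w : BarWord} (hw : WellFormed w.reduceOption) {κ : Endpoint → ℤ}
    {I : ℕ → ℤ} (h : HasIndex w κ I) : Sim (withShells κ w) (withIndex w I) := by
  refine Sim.withShells_congr hw fun e he => ?_
  have key : ∀ e ∈ w.reduceOption, e.terminal = true →
      κ e + κ e.other = stackFor w I e + stackFor w I e.other := by
    intro e he ht
    have h1 := h e he ht
    have h2 := hasIndex_stackFor w I e he ht
    have h3 : (e.sign : ℤ) * (κ e + κ e.other) =
        e.sign * (stackFor w I e + stackFor w I e.other) := by linarith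
    have := congrArg (fun z => (e.sign : ℤ) * z) h3
    simpa only [← mul_assoc, unit_mul_self, one_mul] using this
  cases ht : e.terminal
  · have := key e.other (hw.2.2 e he) (by simp [ht])
    rw [other_other] at this
    linarith
  · exact key e he ht

lemma Sim.withIndex_refl {w : BarWord} (hw : WellFormed w.reduceOption) (I : ℕ → ℤ) :
    Sim (withIndex w I) (withIndex w I) := Sim.refl (hw.withShells _)

lemma withIndex_congr {w : BarWord} {I J : ℕ → ℤ}
    (h : ∀ e ∈ w.reduceOption, I e.chord = J e.chord) : withIndex w I = withIndex w J :=
  withShells_congr fun e he => by rw [stackFor, stackFor, h e he]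

lemma reduceOption_swap (A B : BarWord) (x y : Endpoint) :
    (A ++ some x :: some y :: B).reduceOption = A.reduceOption ++ x :: y :: B.reduceOption := by
  simp [List.reduceOption_append, List.reduceOption_cons_of_some]

lemma before_swap {l m : List Endpoint} {x y e : Endpoint} (hx : x ∉ l) (hy : y ∉ l) (hxy : x ≠ y) :
    before (l ++ y :: x :: m) e = before (l ++ x :: y :: m) e +
      (if e = x then (y.endSign : ℤ) else 0) - if e = y then (x.endSign : ℤ) else 0 := by
  simp only [before_append, before_cons]
  by_cases h : e ∈ l
  · have h1 : e ≠ x := fun h' => hx (h' ▸ h)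
    have h2 : e ≠ y := fun h' => hy (h' ▸ h)
    simp [h, h1, h2]
  · by_cases h1 : e = x
    · subst h1
      simp [h, hxy, hxy.symm]
    · by_cases h2 : e = y
      · subst h2
        simp [h, hxy.symm, Ne.symm h1]
      · simp [h, h1, h2, Ne.symm h1, Ne.symm h2]
        ring

lemma heightIn_swap {l m : List Endpoint} {x y e : Endpoint} (hx : x ∉ l) (hy : y ∉ l)
    (hxy : x ≠ y) : heightIn (l ++ y :: x :: m) e = heightIn (l ++ x :: y :: m) e +
      (if e = x then (y.endSign : ℤ) else 0) - if e = y then (x.endSign : ℤ) else 0 := by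
  unfold heightIn
  rw [before_swap hx hy hxy, add_sub_assoc, height_add]
  ring

/-- The shells born in an exchange by S2 keep the indices. -/
lemma Sim.swap {A B : BarWord} {x y : Endpoint} (hxy : x.chord ≠ y.chord)
    (hw : WellFormed (A ++ some x :: some y :: B).reduceOption) (I : ℕ → ℤ) :
    Sim (withIndex (A ++ some x :: some y :: B) I) (withIndex (A ++ some y :: some x :: B) I) := by
  set w := A ++ some x :: some y :: B with hwd
  set w' := A ++ some y :: some x :: B with hwd'
  have hperm : w.reduceOption.Perm w'.reduceOption := by
    rw [hwd, hwd', reduceOption_swap, reduceOption_swap]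
    exact List.Perm.append_left _ (List.Perm.swap _ _ _)
  have hw' := hw.perm hperm
  set κ := stackFor w I with hκ
  have hne : x ≠ y := fun h => hxy (by rw [h])
  have hxy' : x ≠ y.other := fun h => hxy (by rw [h]; rfl)
  have hyx' : y ≠ x.other := fun h => hxy (by rw [h]; rfl)
  have hnd := hw.1
  rw [hwd, reduceOption_swap, List.nodup_append] at hnd
  have hxA : x ∉ A.reduceOption := fun h => hnd.2.2 x h x (by simp) rfl
  have hyA : y ∉ A.reduceOption := fun h => hnd.2.2 y h y (by simp) rfl
  have hxB : x ∉ B.reduceOption := fun h => by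
    have := (List.nodup_cons.1 hnd.2.1).1; simp [h] at this
  have hyB : y ∉ B.reduceOption := fun h => by
    have := (List.nodup_cons.1 (List.nodup_cons.1 hnd.2.1).2).1; simp [h] at this
  -- all shells of the two chords are moved to the endpoints that are not exchanged
  set κ' : Endpoint → ℤ := fun e => if e = x ∨ e = y then 0 else
    if e.other = x ∨ e.other = y then κ e + κ e.other else κ e with hκ'
  have hsum : ∀ e, κ e + κ e.other = κ' e + κ' e.other := by
    intro e
    simp only [hκ', other_other]
    by_cases h1 : e = x ∨ e = y
    · have h2 : ¬(e.other = x ∨ e.other = y) := by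
        rintro (h2 | h2) <;> rcases h1 with h1 | h1
        · exact x.other_ne (h1 ▸ h2)
        · exact hxy' (by rw [← h1, ← h2])
        · exact hyx' (by rw [← h1, ← h2])
        · exact y.other_ne (h1 ▸ h2)
      simp [h1, h2, add_comm]
    · simp only [h1, if_false]
      split_ifs <;> simp
  have s1 : Sim (withIndex w I) (withShells κ' w) :=
    Sim.withShells_congr hw fun e _ => hsum e
  set a := x.endSign * y.endSign with ha
  set κ'' := Function.update (Function.update κ' x a) y (-a) with hκ''
  have s2 : Sim (withShells κ' w) (withShells κ'' w') := by
    have h1 := hw.withShells κ'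
    have h2 := hw'.withShells κ''
    have hA : withShells κ'' A = withShells κ' A := VirtualLinks.withShells_congr fun e he => by
      have h1 : e ≠ x := fun h => hxA (h ▸ he)
      have h2 : e ≠ y := fun h => hyA (h ▸ he)
      simp [hκ'', h1, h2]
    have hB : withShells κ'' B = withShells κ' B := VirtualLinks.withShells_congr fun e he => by
      have h1 : e ≠ x := fun h => hxB (h ▸ he)
      have h2 : e ≠ y := fun h => hyB (h ▸ he)
      simp [hκ'', h1, h2]
    have hst : ∀ (e : Endpoint) (s : ℤˣ), stack e s [core e] =
        shelled (shellName e 0) s (core e) := by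
      intro e s
      have := stack_add_of_nonneg e (k := 0) (s := s) (by simp) [core e]
      rw [zero_add, stack_zero] at this
      rw [this, shelled_eq]
      rfl
    have e1 : withShells κ' w = withShells κ' A ++ [core x, core y].map some ++
        withShells κ' B := by
      rw [hwd, show A ++ some x :: some y :: B = A ++ [some x, some y] ++ B by simp]
      unfold withShells
      rw [expandWord_append, expandWord_append]
      simp [expandWord, hκ']
    have e2 : withShells κ'' w' = withShells κ' A ++
        (shelled (shellName y 0) (-a) (core y) ++ shelled (shellName x 0) a (core x)).map some ++
        withShells κ' B := by
      rw [← hst, ← hst, ← hA, ← hB, hwd',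
        show A ++ some y :: some x :: B = A ++ [some y, some x] ++ B by simp]
      unfold withShells
      rw [expandWord_append, expandWord_append]
      simp [expandWord, hκ'', hne]
    rw [e1] at h1 ⊢
    rw [e2] at h2 ⊢
    refine .of_step h1 h2 (Or.inr (Or.inr ⟨core x, core y, shellName x 0, shellName y 0, ?_, ?_⟩))
    · simpa [core] using hxy
    · exact localMove_one h1 h2
  have s3 : HasIndex w' κ'' I := by
    intro e he ht
    have h0 := hasIndex_stackFor w I e (hperm.mem_iff.2 he) ht
    rw [← hκ, hsum] at h0
    have hh : ∀ e, heightIn w'.reduceOption e = heightIn w.reduceOption e +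
        (if e = x then (y.endSign : ℤ) else 0) - if e = y then (x.endSign : ℤ) else 0 := by
      intro e
      rw [hwd, hwd', reduceOption_swap, reduceOption_swap]
      exact heightIn_swap hxA hyA hne
    have hk : ∀ e, κ'' e = κ' e + (if e = x then (a : ℤ) else 0) - if e = y then (a : ℤ) else 0 := by
      intro e
      by_cases h1 : e = y
      · subst h1; simp [hκ'', hne.symm, hκ']
      · by_cases h2 : e = x
        · subst h2; simp [hκ'', hκ', h1]
        · simp [hκ'', h1, h2]
    rw [← h0, hh, hh, hk, hk, ha]
    have hab : ∀ z : Endpoint, z.other = e → z.endSign = -e.sign := fun z hz => by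
      have : z.terminal = false := by rw [← hz] at ht; simpa using ht
      rw [← hz]
      simp [endSign, this]
    have haa : e.endSign = e.sign := by simp [endSign, ht]
    have hoe : ∀ z : Endpoint, e.other = z → e ≠ z := fun z h h' => e.other_ne (h.trans h'.symm)
    have u := unit_mul_self e.sign
    by_cases h1 : e = x
    · subst h1
      have h2 : e.other ≠ y := hyx'.symm
      simp only [hne, e.other_ne, h2, if_false, haa]
      push_cast
      linear_combination (-(y.endSign : ℤ)) * u
    by_cases h2 : e = y
    · subst h2
      have h3 : e.other ≠ x := hxy'.symm
      simp only [h1, e.other_ne, h3, if_false, haa]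
      push_cast
      linear_combination (x.endSign : ℤ) * u
    by_cases h3 : e.other = x
    · have h4 : e.other ≠ y := fun h => hne (h3.symm.trans h)
      have := hab x (by rw [← h3, other_other])
      simp only [h1, h2, h3, hne, if_true, if_false, this]
      push_cast
      linear_combination (y.endSign : ℤ) * u
    by_cases h4 : e.other = y
    · have := hab y (by rw [← h4, other_other])
      simp only [h1, h2, h4, hne.symm, if_true, if_false, this]
      push_cast
      linear_combination (-(x.endSign : ℤ)) * u
    simp only [h1, h2, h3, h4, if_false]
    ring
  exact (s1.trans s2).trans (Sim.of_hasIndex hw' s3)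

lemma before_insert {l m r : List Endpoint} (hm : signSum m = 0) {e : Endpoint} (he : e ∉ m) :
    before (l ++ (m ++ r)) e = before (l ++ r) e := by
  simp only [before_append, he, if_false, hm, zero_add]

lemma heightIn_insert {l m r : List Endpoint} (hm : signSum m = 0) {e : Endpoint} (he : e ∉ m) :
    heightIn (l ++ (m ++ r)) e = heightIn (l ++ r) e := by
  rw [heightIn, before_insert hm he, heightIn]

lemma withShells_append (κ : Endpoint → ℤ) (v w : BarWord) :
    withShells κ (v ++ w) = withShells κ v ++ withShells κ w := expandWord_append _ _ _

lemma withShells_map_some {κ : Endpoint → ℤ} {m : List Endpoint} (h : ∀ e ∈ m, κ e = 0) :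
    withShells κ (m.map some) = (m.map core).map some := by
  induction m with
  | nil => rfl
  | cons e m ih =>
    rw [List.map_cons, ← List.singleton_append, withShells_append,
      ih fun f hf => h f (by simp [hf])]
    simp [withShells, expandWord, h e (by simp)]

lemma stackFor_eq_zero {w : BarWord} {I : ℕ → ℤ} {e : Endpoint}
    (h : e.terminal = true →
      heightIn w.reduceOption e - heightIn w.reduceOption e.other = I e.chord) :
    stackFor w I e = 0 := by
  unfold stackFor
  split_ifs with ht
  · rw [h ht]; simp
  · rfl

namespace Sim

/-- An endpoint moves past endpoints of other chords. -/
lemma move_right {A B : BarWord} {x : Endpoint} {m : List Endpoint}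
    (hm : ∀ e ∈ m, e.chord ≠ x.chord) (I : ℕ → ℤ)
    (hw : WellFormed (A ++ (x :: m).map some ++ B).reduceOption) :
    Sim (withIndex (A ++ (x :: m).map some ++ B) I)
      (withIndex (A ++ (m ++ [x]).map some ++ B) I) := by
  induction m generalizing A with
  | nil => exact Sim.withIndex_refl hw I
  | cons y m ih =>
    have hp : (A ++ (x :: y :: m).map some ++ B).reduceOption.Perm
        ((A ++ [some y]) ++ (x :: m).map some ++ B).reduceOption := by
      refine perm_of_multiset ?_
      rw [show A ++ [some y] = A ++ [y].map some from rfl]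
      simp only [coe_reduceOption_append, reduceOption_map_some, ← Multiset.cons_coe,
        ← Multiset.singleton_add, Multiset.coe_nil, add_zero]
      abel
    have h1 := Sim.swap (A := A) (x := x) (y := y) (B := m.map some ++ B)
      (fun h => hm y (by simp) h.symm) (by simpa using hw) I
    have h2 := ih (A := A ++ [some y]) (fun e he => hm e (by simp [he])) (hw.perm hp)
    have h3 : Sim (withIndex (A ++ (x :: y :: m).map some ++ B) I)
        (withIndex ((A ++ [some y]) ++ (x :: m).map some ++ B) I) := by simpa using h1
    simpa using h3.trans h2

/-- The two endpoints of an isolated chord have the same height, and the chord does not affect the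
shells of the other chords. -/
lemma withIndex_isolated {A B : BarWord} {e : Endpoint} {I : ℕ → ℤ} {κ : Endpoint → ℤ}
    (hw : WellFormed (A ++ [e, e.other].map some ++ B).reduceOption)
    (hκ : stackFor (A ++ [e, e.other].map some ++ B) I = κ) :
    withIndex (A ++ B) I = withShells κ A ++ withShells κ B ∧
      withIndex (A ++ [e, e.other].map some ++ B) I =
        withShells κ A ++ withShells κ ([e, e.other].map some) ++ withShells κ B ∧
      heightIn (A ++ [e, e.other].map some ++ B).reduceOption e =
        heightIn (A ++ [e, e.other].map some ++ B).reduceOption e.other := by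
  set w := A ++ [e, e.other].map some ++ B with hwd
  have hl : w.reduceOption = A.reduceOption ++ ([e, e.other] ++ B.reduceOption) := by
    simp only [hwd, List.reduceOption_append, reduceOption_map_some, List.append_assoc]
  have hp : w.reduceOption.Perm (e :: e.other :: (A ++ B).reduceOption) := by
    rw [hl, List.reduceOption_append]
    exact List.perm_append_comm_assoc _ _ _
  have hw1 := hw.perm hp
  have hfresh : ∀ f ∈ (A ++ B).reduceOption, f.chord ≠ e.chord := fun f hf => hw1.chord_ne hf
  have hh : ∀ f, f.chord ≠ e.chord →
      heightIn w.reduceOption f = heightIn (A ++ B).reduceOption f := by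
    intro f hf
    rw [hl, List.reduceOption_append]
    refine heightIn_insert (by simp) ?_
    simp only [List.mem_cons, List.not_mem_nil, or_false, not_or]
    exact ⟨fun h => hf (by rw [h]), fun h => hf (by rw [h]; rfl)⟩
  have hA : e ∉ A.reduceOption := fun h => hfresh e (by simp [List.reduceOption_append, h]) rfl
  have hA' : e.other ∉ A.reduceOption := fun h =>
    hfresh e.other (by simp [List.reduceOption_append, h]) rfl
  have hAB : ∀ f ∈ (A ++ B).reduceOption, stackFor (A ++ B) I f = stackFor w I f := by
    intro f hf
    rw [stackFor, stackFor, hh f (hfresh f hf), hh f.other (hfresh f hf)]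
  refine ⟨?_, ?_, ?_⟩
  · rw [withIndex, VirtualLinks.withShells_congr hAB, withShells_append, hκ]
  · rw [withIndex, hκ, hwd, withShells_append, withShells_append]
  · rw [hl]
    unfold heightIn
    simp only [before_append, before_cons, hA, hA', if_false, List.mem_cons, List.not_mem_nil]
    cases ht : e.terminal <;> simp [height, ht, e.other_ne.symm]

/-- An isolated chord with index `0` can be removed by R1. -/
lemma isolated {A B : BarWord} {e : Endpoint} {I : ℕ → ℤ} (hI : I e.chord = 0)
    (hw : WellFormed (A ++ [e, e.other].map some ++ B).reduceOption) :
    Sim (withIndex (A ++ B) I) (withIndex (A ++ [e, e.other].map some ++ B) I) := by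
  obtain ⟨e1, e2, he⟩ := withIndex_isolated hw (I := I) rfl
  have hz : ∀ f ∈ [e, e.other], stackFor (A ++ [e, e.other].map some ++ B) I f = 0 := by
    intro f hf
    simp only [List.mem_cons, List.not_mem_nil, or_false] at hf
    rcases hf with rfl | rfl
    · exact stackFor_eq_zero fun _ => by rw [he, hI, sub_self]
    · exact stackFor_eq_zero fun _ => by rw [other_other, he, other_chord, hI, sub_self]
  have h2 : WellFormed (withIndex (A ++ [e, e.other].map some ++ B) I).reduceOption :=
    hw.withShells _
  rw [e2, withShells_map_some hz] at h2
  rw [e1, e2, withShells_map_some hz]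
  exact of_R1 h2

/-- An isolated chord with index `1` whose first endpoint is negative can be removed: it carries one
shell, and these two chords are born together by R2. -/
lemma isolated_one {A B : BarWord} {e : Endpoint} {I : ℕ → ℤ} (hI : I e.chord = 1)
    (hs : e.endSign = -1) (hw : WellFormed (A ++ [e, e.other].map some ++ B).reduceOption) :
    Sim (withIndex (A ++ B) I) (withIndex (A ++ [e, e.other].map some ++ B) I) := by
  obtain ⟨e1, e2, he⟩ := withIndex_isolated hw (I := I) rfl
  have h2 : WellFormed (withIndex (A ++ [e, e.other].map some ++ B) I).reduceOption :=
    hw.withShells _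
  set κ := stackFor (A ++ [e, e.other].map some ++ B) I with hκ
  rw [e2] at h2
  rw [e1, e2]
  cases ht : e.terminal
  · have hsgn : e.sign = 1 := by simpa [endSign, ht] using hs
    have k1 : κ e = 0 := by simp [hκ, stackFor, ht]
    have k2 : κ e.other = -1 := by
      rw [hκ, stackFor, other_other, he]
      simp [ht, hI, hsgn]
    have e3 : withShells κ ([e, e.other].map some) =
        [ini (coreName e.chord) 1, ini (shellName e.other 0) (-1)].map some ++ [] ++
          [ter (coreName e.chord) 1, ter (shellName e.other 0) (-1)].map some := by
      simp [withShells, expandWord, k1, k2, stack, shellsBefore, shellsAfter, unitSign, shellFst,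
        shellSnd, hs]
      simp [core, ini, ter, ht, hsgn, other]
    rw [e3] at h2 ⊢
    have := of_R2 (A := withShells κ A) (B := []) (C := withShells κ B)
      (a := coreName e.chord) (b := shellName e.other 0) (s := 1) (by simpa using h2)
    simpa using this
  · have hsgn : e.sign = -1 := by simpa [endSign, ht] using hs
    have k1 : κ e.other = 0 := by simp [hκ, stackFor, ht]
    have k2 : κ e = 1 := by
      rw [hκ, stackFor, he]
      simp [ht, hI, hsgn]
    have e3 : withShells κ ([e, e.other].map some) =
        [ter (shellName e 0) 1, ter (coreName e.chord) (-1)].map some ++ [] ++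
          [ini (shellName e 0) 1, ini (coreName e.chord) (-1)].map some := by
      simp [withShells, expandWord, k1, k2, stack, shellsBefore, shellsAfter, unitSign, shellFst,
        shellSnd, hs]
      simp [core, ini, ter, ht, hsgn, other]
    rw [e3] at h2 ⊢
    have := of_R2_swap (A := withShells κ A) (B := []) (C := withShells κ B)
      (b := coreName e.chord) (a := shellName e 0) (s := 1) (by simpa using h2)
    simpa using this

/-- The move R2 for two parallel chords whose initial or terminal endpoints come first. -/
lemma of_R2_pair {A B C : BarWord} {x y : Endpoint} (ht : y.terminal = x.terminal)
    (hs : y.sign = -x.sign)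
    (h : WellFormed (A ++ [x, y].map some ++ B ++ [x.other, y.other].map some ++ C).reduceOption) :
    Sim (A ++ B ++ C) (A ++ [x, y].map some ++ B ++ [x.other, y.other].map some ++ C) := by
  rcases x with ⟨a, _ | _, s⟩ <;> rcases y with ⟨b, t, s'⟩ <;> simp only at ht hs <;> subst ht hs
  · exact of_R2 h
  · exact of_R2_swap h

lemma coe_pair_word (A B C : BarWord) (x y : Endpoint) :
    ((A ++ [x, y].map some ++ B ++ [x.other, y.other].map some ++ C).reduceOption :
      Multiset Endpoint) = (x :: x.other :: y :: y.other :: (A ++ B ++ C).reduceOption :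
        List Endpoint) := by
  simp only [coe_reduceOption_append, reduceOption_map_some, ← Multiset.cons_coe,
    ← Multiset.singleton_add, Multiset.coe_nil, add_zero]
  abel

/-- Two parallel chords of opposite signs can be removed by R2 if they have the index that their
position suggests. -/
lemma parallel_of_eq {A B C : BarWord} {x y : Endpoint} (ht : y.terminal = x.terminal)
    (hs : y.sign = -x.sign) {I : ℕ → ℤ}
    (hw : WellFormed (A ++ [x, y].map some ++ B ++ [x.other, y.other].map some ++ C).reduceOption)
    (hx : I x.chord = x.sign + (if x.terminal then -1 else 1) * signSum B.reduceOption)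
    (hy : I y.chord = I x.chord) :
    Sim (withIndex (A ++ B ++ C) I)
      (withIndex (A ++ [x, y].map some ++ B ++ [x.other, y.other].map some ++ C) I) := by
  set w := A ++ [x, y].map some ++ B ++ [x.other, y.other].map some ++ C with hwd
  have hl : w.reduceOption = A.reduceOption ++ ([x, y] ++ (B.reduceOption ++
      ([x.other, y.other] ++ C.reduceOption))) := by
    simp only [hwd, List.reduceOption_append, reduceOption_map_some, List.append_assoc]
  have hw1 := hw.perm (perm_of_multiset (coe_pair_word A B C x y))
  have hyx : y.chord ≠ x.chord := hw1.chord_ne (by simp)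
  have hf1 : ∀ f ∈ (A ++ B ++ C).reduceOption, f.chord ≠ x.chord := fun f hf =>
    hw1.chord_ne (List.mem_cons_of_mem _ (List.mem_cons_of_mem _ hf))
  have hf2 : ∀ f ∈ (A ++ B ++ C).reduceOption, f.chord ≠ y.chord := fun f hf =>
    hw1.of_cons_pair.chord_ne hf
  have hend : (x.endSign : ℤ) + y.endSign = 0 := by
    unfold endSign
    rw [ht, hs]
    split_ifs <;> simp
  have hh : ∀ f, f.chord ≠ x.chord → f.chord ≠ y.chord →
      heightIn w.reduceOption f = heightIn (A ++ B ++ C).reduceOption f := by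
    intro f hf hf'
    rw [hl, List.reduceOption_append, List.reduceOption_append, heightIn_insert (by simpa using hend),
      ← List.append_assoc, heightIn_insert]
    · simp; linarith
    · simp only [List.mem_cons, List.not_mem_nil, or_false, not_or]
      exact ⟨fun h => hf (by rw [h]; rfl), fun h => hf' (by rw [h]; rfl)⟩
    · simp only [List.mem_cons, List.not_mem_nil, or_false, not_or]
      exact ⟨fun h => hf (by rw [h]), fun h => hf' (by rw [h])⟩
  have hmem : ∀ f : Endpoint, f.chord = x.chord ∨ f.chord = y.chord →
      f ∉ A.reduceOption ∧ f ∉ B.reduceOption := by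
    intro f hf
    constructor <;> intro h
    · rcases hf with hf | hf
      · exact hf1 f (by simp [List.reduceOption_append, h]) hf
      · exact hf2 f (by simp [List.reduceOption_append, h]) hf
    · rcases hf with hf | hf
      · exact hf1 f (by simp [List.reduceOption_append, h]) hf
      · exact hf2 f (by simp [List.reduceOption_append, h]) hf
  have hxA := hmem x (Or.inl rfl)
  have hxA' := hmem x.other (Or.inl rfl)
  have hyA := hmem y (Or.inr rfl)
  have hyA' := hmem y.other (Or.inr rfl)
  have n1 : x ≠ y := fun h => hyx (by rw [h])
  have n2 : x ≠ y.other := fun h => hyx (by rw [h]; rfl)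
  have n3 : y ≠ x.other := fun h => hyx (by rw [h]; rfl)
  have n4 : x.other ≠ y.other := fun h => n1 (other_injective h)
  have b1 : before w.reduceOption x = signSum A.reduceOption := by
    rw [hl]; simp [before_append, before_cons, hxA]
  have b2 : before w.reduceOption y = signSum A.reduceOption + x.endSign := by
    rw [hl]; simp [before_append, before_cons, hyA, n1]
  have b3 : before w.reduceOption x.other = signSum A.reduceOption + signSum B.reduceOption := by
    rw [hl]; simp [before_append, before_cons, hxA', x.other_ne.symm, n3]; linarith
  have b4 : before w.reduceOption y.other =
      signSum A.reduceOption + signSum B.reduceOption - x.endSign := by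
    rw [hl]; simp [before_append, before_cons, hyA', y.other_ne.symm, n2, n4]; linarith
  have hz : ∀ f, f.chord = x.chord ∨ f.chord = y.chord → f ∈ w.reduceOption →
      stackFor w I f = 0 := by
    intro f hf hfw
    refine stackFor_eq_zero fun hft => ?_
    have hfs : f = x ∨ f = x.other ∨ f = y ∨ f = y.other := by
      rcases hf with hf | hf
      · rcases hw.eq_or_eq_other (by simp [hl]) hfw hf with h | h <;> simp [h]
      · rcases hw.eq_or_eq_other (by simp [hl]) hfw hf with h | h <;> simp [h]
    unfold heightIn
    rcases hfs with rfl | rfl | rfl | rfl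
    · rw [b1, b3, hx]; simp [height, hft, endSign]; ring
    · have hft' : x.terminal = false := by simpa using hft
      rw [other_other, b1, b3, other_chord, hx]; simp [height, hft', endSign]; ring
    · have hft' : x.terminal = true := by rw [← ht, hft]
      rw [b2, b4, hy, hx]; simp [height, hft, endSign, hs, hft']; ring
    · have hft' : y.terminal = false := by simpa using hft
      have hft'' : x.terminal = false := by rw [← ht, hft']
      rw [other_other, b2, b4, other_chord, hy, hx]
      simp [height, hft', endSign, hs, hft'']; ring
  have hAB : ∀ f ∈ (A ++ B ++ C).reduceOption, stackFor (A ++ B ++ C) I f = stackFor w I f := by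
    intro f hf
    rw [stackFor, stackFor, hh f (hf1 f hf) (hf2 f hf), hh f.other (hf1 f hf) (hf2 f hf)]
  have e1 : withIndex (A ++ B ++ C) I = withShells (stackFor w I) A ++
      withShells (stackFor w I) B ++ withShells (stackFor w I) C := by
    rw [withIndex, VirtualLinks.withShells_congr hAB, withShells_append, withShells_append]
  have e2 : withIndex w I = withShells (stackFor w I) A ++ [core x, core y].map some ++
      withShells (stackFor w I) B ++ [(core x).other, (core y).other].map some ++
      withShells (stackFor w I) C := by
    rw [withIndex, hwd, withShells_append, withShells_append, withShells_append, withShells_append,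
      ← hwd, withShells_map_some, withShells_map_some]
    · rfl
    · intro f hf
      have : f = x.other ∨ f = y.other := by simpa using hf
      rcases this with rfl | rfl
      · exact hz _ (Or.inl rfl) (by simp [hl])
      · exact hz _ (Or.inr rfl) (by simp [hl])
    · intro f hf
      have : f = x ∨ f = y := by simpa using hf
      rcases this with rfl | rfl
      · exact hz _ (Or.inl rfl) (by simp [hl])
      · exact hz _ (Or.inr rfl) (by simp [hl])
  have h2 : WellFormed (withIndex w I).reduceOption := hw.withShells _
  rw [e2] at h2
  rw [e1, e2]
  exact of_R2_pair ht hs h2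

lemma exists_fresh (l : List Endpoint) : ∃ z : ℕ, ∀ f ∈ l, f.chord ≠ z := by
  obtain ⟨z, hz⟩ := Infinite.exists_notMem_finset (l.map chord).toFinset
  refine ⟨z, fun f hf h => hz ?_⟩
  rw [List.mem_toFinset]
  exact List.mem_map.2 ⟨f, hf, h⟩

/-- Two parallel chords of opposite signs and of equal index can be removed.  If their index is not
the one suggested by their position, isolated chords of index `0` are used to correct the heights
at this position. -/
lemma parallel {A B C : BarWord} {x y : Endpoint} (ht : y.terminal = x.terminal)
    (hs : y.sign = -x.sign) {I : ℕ → ℤ}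
    (hw : WellFormed (A ++ [x, y].map some ++ B ++ [x.other, y.other].map some ++ C).reduceOption)
    (hy : I y.chord = I x.chord) :
    Sim (withIndex (A ++ B ++ C) I)
      (withIndex (A ++ [x, y].map some ++ B ++ [x.other, y.other].map some ++ C) I) := by
  obtain ⟨N, hN⟩ : ∃ N : ℕ, (I x.chord - (x.sign + (if x.terminal then -1 else 1) *
    signSum B.reduceOption)).natAbs = N := ⟨_, rfl⟩
  induction N generalizing B C I with
  | zero => exact parallel_of_eq ht hs hw (by omega) hy
  | succ N ih =>
    set w := A ++ [x, y].map some ++ B ++ [x.other, y.other].map some ++ C with hwd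
    obtain ⟨z, hz⟩ := exists_fresh w.reduceOption
    have hw1 := perm_of_multiset (coe_pair_word A B C x y)
    have hzx : x.chord ≠ z := hz x (hw1.mem_iff.2 (by simp))
    have hzy : y.chord ≠ z := hz y (hw1.mem_iff.2 (by simp))
    have hz' : ∀ f ∈ (A ++ B ++ C).reduceOption, f.chord ≠ z := fun f hf =>
      hz f (hw1.mem_iff.2 (List.mem_cons_of_mem _ (List.mem_cons_of_mem _
        (List.mem_cons_of_mem _ (List.mem_cons_of_mem _ hf)))))
    obtain ⟨c, hc⟩ : ∃ c : ℤˣ, (I x.chord - (x.sign + (if x.terminal then -1 else 1) *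
        (signSum B.reduceOption + c))).natAbs = N := by
      split_ifs at hN ⊢
      · rcases le_total 0 (I x.chord - (x.sign + (-1) * signSum B.reduceOption)) with h | h
        · exact ⟨-1, by simp; omega⟩
        · exact ⟨1, by simp; omega⟩
      · rcases le_total 0 (I x.chord - (x.sign + 1 * signSum B.reduceOption)) with h | h
        · exact ⟨1, by simp; omega⟩
        · exact ⟨-1, by simp; omega⟩
    set e : Endpoint := ini z (-c) with he
    set J := Function.update I z 0 with hJ
    have hJe : J e.chord = 0 := by simp [hJ, he]
    have c1 : withIndex (A ++ B ++ C) I = withIndex (A ++ B ++ C) J :=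
      withIndex_congr fun f hf => by simp [hJ, hz' f hf]
    have c2 : withIndex w J = withIndex w I :=
      withIndex_congr fun f hf => by simp [hJ, hz f hf]
    have w1 : WellFormed (e :: e.other :: w.reduceOption) := hw.cons_pair hz
    have w2 : WellFormed ((A ++ [x, y].map some ++ B ++ [x.other, y.other].map some) ++
        [e, e.other].map some ++ C).reduceOption := by
      refine w1.perm (perm_of_multiset ?_)
      simp only [hwd, coe_reduceOption_append, reduceOption_map_some, ← Multiset.cons_coe,
        ← Multiset.singleton_add, Multiset.coe_nil, add_zero]
      abel
    have w3 : WellFormed (A ++ [x, y].map some ++ (B ++ [some e]) ++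
        [x.other, y.other].map some ++ (some e.other :: C)).reduceOption := by
      refine w2.perm (perm_of_multiset ?_)
      rw [show A ++ [x, y].map some ++ (B ++ [some e]) ++ [x.other, y.other].map some ++
        (some e.other :: C) = A ++ [x, y].map some ++ (B ++ [e].map some) ++
        [x.other, y.other].map some ++ ([e.other].map some ++ C) by simp]
      simp only [coe_reduceOption_append, reduceOption_map_some, ← Multiset.cons_coe,
        ← Multiset.singleton_add, Multiset.coe_nil, add_zero]
      abel
    have w4 : WellFormed ((A ++ B) ++ [e, e.other].map some ++ C).reduceOption := by
      refine ((w1.perm (perm_of_multiset (l' := x :: x.other :: y :: y.other ::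
        ((A ++ B) ++ [e, e.other].map some ++ C).reduceOption) ?_)).of_cons_pair).of_cons_pair
      simp only [hwd, coe_reduceOption_append, reduceOption_map_some, ← Multiset.cons_coe,
        ← Multiset.singleton_add, Multiset.coe_nil, add_zero]
      abel
    have s1 := isolated (I := J) hJe w4
    have s2 := ih (B := B ++ [some e]) (C := some e.other :: C) (I := J) w3
      (by simp [hJ, hzx, hzy, hy]) (by
        simp only [hJ, Function.update_of_ne hzx]
        rw [show B ++ [some e] = B ++ [e].map some by simp, List.reduceOption_append,
          reduceOption_map_some, signSum_append]
        simpa [he] using hc)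
    have s3 := move_right (A := A ++ [x, y].map some ++ B) (B := some e.other :: C) (x := e)
      (m := [x.other, y.other]) (by simp [he, hzx, hzy]) J (by
        convert w3 using 2
        simp)
    have s4 := isolated (I := J) hJe w2
    rw [c1, ← c2]
    refine s1.trans ?_
    refine Sim.trans (w' := withIndex (A ++ [x, y].map some ++ (B ++ [some e]) ++
      [x.other, y.other].map some ++ (some e.other :: C)) J) ?_ ?_
    · simpa using s2
    refine Sim.trans (w' := withIndex ((A ++ [x, y].map some ++ B ++
      [x.other, y.other].map some) ++ [e, e.other].map some ++ C) J) ?_ s4.symm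
    simpa using s3

end Sim

/-! ### Rotation of the circles -/

/-- The words `P` and `Q` are such that in `P ++ m.map some ++ Q` the word `m` is a whole circle. -/
def IsCircle (P Q : BarWord) : Prop :=
  (P = [] ∧ ∃ v : List Endpoint, Q = none :: v.map some) ∨
    ((∃ u : List Endpoint, P = u.map some ++ [none]) ∧ Q = [])

lemma withShells_map_some_eq (κ : Endpoint → ℤ) (m : List Endpoint) :
    withShells κ (m.map some) = (m.flatMap fun e => stack e (κ e) [core e]).map some := by
  induction m with
  | nil => rfl
  | cons e m ih =>
    rw [List.map_cons, ← List.singleton_append, withShells_append, ih]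
    simp [withShells, expandWord]

lemma Sim.withShells_rotate {P Q : BarWord} (hc : IsCircle P Q) {u m : List Endpoint}
    (hw : WellFormed (P ++ (u ++ m).map some ++ Q).reduceOption)
    (hw' : WellFormed (P ++ (m ++ u).map some ++ Q).reduceOption) (κ : Endpoint → ℤ) :
    Sim (withShells κ (P ++ (u ++ m).map some ++ Q))
      (withShells κ (P ++ (m ++ u).map some ++ Q)) := by
  have h1 := hw.withShells κ
  have h2 := hw'.withShells κ
  have hrot : ∀ a b : List Endpoint, (a ++ b) ~r (b ++ a) := fun a b =>
    ⟨a.length, by simp⟩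
  have hbar : ∀ a b : BarWord, withShells κ (a ++ none :: b) =
      withShells κ a ++ none :: withShells κ b := fun a b => by simp [withShells, expandWord]
  have hid : ∀ l : List Endpoint, l.map (rename 1) = l := fun l => List.map_id _
  rcases hc with ⟨rfl, v, rfl⟩ | ⟨⟨v, rfl⟩, rfl⟩
  · have e : ∀ l : List Endpoint, withShells κ ([] ++ l.map some ++ none :: v.map some) =
        (l.flatMap fun e => stack e (κ e) [core e]).map some ++ none ::
          (v.flatMap fun e => stack e (κ e) [core e]).map some := fun l => by
      rw [List.nil_append, hbar, withShells_map_some_eq, withShells_map_some_eq]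
    rw [e] at h1 h2 ⊢
    rw [e]
    refine .of_iso h1 h2 1 ?_ ?_
    · rw [splitBar_bar, splitBar_bar, hid, List.flatMap_append, List.flatMap_append]
      exact hrot _ _
    · rw [splitBar_bar, splitBar_bar, hid]
  · have e : ∀ l : List Endpoint, withShells κ (v.map some ++ [none] ++ l.map some ++ []) =
        (v.flatMap fun e => stack e (κ e) [core e]).map some ++ none ::
          (l.flatMap fun e => stack e (κ e) [core e]).map some := fun l => by
      rw [List.append_nil, List.append_assoc, List.singleton_append, hbar, withShells_map_some_eq,
        withShells_map_some_eq]
    rw [e] at h1 h2 ⊢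
    rw [e]
    refine .of_iso h1 h2 1 ?_ ?_
    · rw [splitBar_bar, splitBar_bar, hid]
    · rw [splitBar_bar, splitBar_bar, hid, List.flatMap_append, List.flatMap_append]
      exact hrot _ _

lemma before_rotate {p u m q : List Endpoint} (h : (p ++ (u ++ m) ++ q).Nodup)
    (h0 : signSum (u ++ m) = 0) (e : Endpoint) :
    before (p ++ (m ++ u) ++ q) e = before (p ++ (u ++ m) ++ q) e +
      if e ∈ u ++ m then signSum m else 0 := by
  rw [signSum_append] at h0
  simp only [before_append, List.mem_append, signSum_append]
  rw [List.nodup_append, List.nodup_append] at h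
  by_cases hp : e ∈ p
  · have h1 : ¬(e ∈ u ∨ e ∈ m) := fun h' => h.1.2.2 e hp e (by simpa using h') rfl
    simp [hp, h1]
  · by_cases hu : e ∈ u
    · have hm : e ∉ m := fun h' => (List.nodup_append.1 h.1.2.1).2.2 e hu e h' rfl
      simp [hp, hu, hm]
      ring
    · by_cases hm : e ∈ m
      · simp [hp, hu, hm]
        linarith
      · simp [hp, hu, hm]
        ring

lemma reduceOption_frame (P Q : BarWord) (l : List Endpoint) :
    (P ++ l.map some ++ Q).reduceOption = P.reduceOption ++ l ++ Q.reduceOption := by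
  simp only [List.reduceOption_append, reduceOption_map_some]

lemma WellFormed.frame_perm {P Q : BarWord} {l l' : List Endpoint} (hp : l.Perm l')
    (h : WellFormed (P ++ l.map some ++ Q).reduceOption) :
    WellFormed (P ++ l'.map some ++ Q).reduceOption := by
  refine h.perm ?_
  rw [reduceOption_frame, reduceOption_frame]
  exact (hp.append_left _).append_right _

/-- If the base point of a circle is moved past the word `m`, all heights on this circle change by
the sign sum of `m`. -/
lemma Sim.rotate {P Q : BarWord} (hc : IsCircle P Q) {u m : List Endpoint}
    (hw : WellFormed (P ++ (u ++ m).map some ++ Q).reduceOption) (h0 : signSum (u ++ m) = 0)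
    {I J : ℕ → ℤ}
    (hJ : ∀ e ∈ (P ++ (u ++ m).map some ++ Q).reduceOption, e.terminal = true →
      J e.chord = I e.chord + (if e ∈ u ++ m then signSum m else 0) -
        if e.other ∈ u ++ m then signSum m else 0) :
    Sim (withIndex (P ++ (u ++ m).map some ++ Q) I)
      (withIndex (P ++ (m ++ u).map some ++ Q) J) := by
  have hw' := hw.frame_perm (l' := m ++ u) List.perm_append_comm
  refine (Sim.withShells_rotate hc hw hw' _).trans (Sim.of_hasIndex hw' fun e he ht => ?_)
  have hp : (P ++ (m ++ u).map some ++ Q).reduceOption.Perm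
      (P ++ (u ++ m).map some ++ Q).reduceOption := by
    rw [reduceOption_frame, reduceOption_frame]
    exact (List.perm_append_comm.append_left _).append_right _
  have hh : ∀ e, heightIn (P ++ (m ++ u).map some ++ Q).reduceOption e =
      heightIn (P ++ (u ++ m).map some ++ Q).reduceOption e +
        if e ∈ u ++ m then signSum m else 0 := by
    intro e
    have hnd := hw.1
    rw [reduceOption_frame] at hnd ⊢
    rw [reduceOption_frame, heightIn, before_rotate hnd h0, height_add, heightIn]
  have h1 := hasIndex_stackFor (P ++ (u ++ m).map some ++ Q) I e (hp.mem_iff.1 he) ht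
  rw [hh, hh, hJ e (hp.mem_iff.1 he) ht, ← h1]
  ring

/-! ### Reordering the endpoints -/

/-- The two adjacent endpoints of a chord can be exchanged.  One of them is moved around the circle,
together with an endpoint of opposite sign of an isolated chord, so that the indices of all other
chords are the same as before. -/
lemma Sim.flip {P Q : BarWord} (hc : IsCircle P Q) {A B : List Endpoint} {x : Endpoint}
    (hw : WellFormed (P ++ (A ++ x :: x.other :: B).map some ++ Q).reduceOption)
    (h0 : signSum (A ++ x :: x.other :: B) = 0) (I : ℕ → ℤ) :
    Sim (withIndex (P ++ (A ++ x :: x.other :: B).map some ++ Q) I)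
      (withIndex (P ++ (A ++ x.other :: x :: B).map some ++ Q) I) := by
  set w := P ++ (A ++ x :: x.other :: B).map some ++ Q with hwd
  obtain ⟨z, hz⟩ := Sim.exists_fresh w.reduceOption
  have hmem : ∀ f, f ∈ A ++ x :: x.other :: B → f ∈ w.reduceOption := fun f hf => by
    rw [hwd, reduceOption_frame]
    exact List.mem_append_left _ (List.mem_append_right _ hf)
  have hx : x.chord ≠ z := hz x (hmem _ (by simp))
  have hA : ∀ f ∈ A, f.chord ≠ x.chord ∧ f.chord ≠ z := fun f hf => by
    refine ⟨?_, hz f (hmem f (by simp [hf]))⟩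
    refine WellFormed.chord_ne (l := P.reduceOption ++ (A ++ B) ++ Q.reduceOption) ?_ (by simp [hf])
    refine hw.perm (perm_of_multiset ?_)
    rw [hwd, reduceOption_frame]
    simp only [← Multiset.coe_add, ← Multiset.cons_coe, ← Multiset.singleton_add]
    abel
  have hB : ∀ f ∈ B, f.chord ≠ x.chord ∧ f.chord ≠ z := fun f hf => by
    refine ⟨?_, hz f (hmem f (by simp [hf]))⟩
    refine WellFormed.chord_ne (l := P.reduceOption ++ (A ++ B) ++ Q.reduceOption) ?_ (by simp [hf])
    refine hw.perm (perm_of_multiset ?_)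
    rw [hwd, reduceOption_frame]
    simp only [← Multiset.coe_add, ← Multiset.cons_coe, ← Multiset.singleton_add]
    abel
  set y : Endpoint := ini z x.endSign with hy
  have hyz : y.chord = z := rfl
  have hyx : y.endSign = x.other.endSign := by simp [hy]
  set J := Function.update I z 0 with hJ
  have hJe : J y.chord = 0 := by simp [hJ, hy]
  have hcongr : ∀ l : List Endpoint, l.Perm (A ++ x :: x.other :: B) →
      withIndex (P ++ l.map some ++ Q) I = withIndex (P ++ l.map some ++ Q) J := by
    intro l hl
    refine withIndex_congr fun f hf => ?_
    have : f ∈ w.reduceOption := by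
      rw [reduceOption_frame] at hf
      rw [hwd, reduceOption_frame]
      exact ((hl.append_left _).append_right _).mem_iff.1 hf
    simp [hJ, hz f this]
  have hwy : WellFormed (y :: y.other :: w.reduceOption) := hw.cons_pair hz
  -- every word on the circle that arises below is well-formed
  have hwf : ∀ l : List Endpoint,
      (l : Multiset Endpoint) = ({y} + {y.other} + {x} + {x.other} + A + B : Multiset Endpoint) →
      WellFormed (P ++ l.map some ++ Q).reduceOption := by
    intro l hl
    refine hwy.perm (perm_of_multiset ?_)
    rw [hwd, reduceOption_frame, reduceOption_frame]
    simp only [← Multiset.coe_add, hl, ← Multiset.cons_coe, ← Multiset.singleton_add]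
    abel
  have hsum : signSum A + signSum B = 0 := by
    simp only [signSum_append, signSum_cons, endSign_other, Units.val_neg] at h0
    linarith
  rw [hcongr _ (List.Perm.refl _), hcongr _ ((List.Perm.swap _ _ _).append_left _)]
  -- `x.other` moves to the end of the circle
  have s1 : Sim (withIndex w J) (withIndex (P ++ (A ++ x :: (B ++ [x.other])).map some ++ Q) J) := by
    have := Sim.move_right (A := P ++ (A ++ [x]).map some) (x := x.other) (m := B) (B := Q)
      (fun f hf => (hB f hf).1) J (by convert hw using 2; simp [hwd])
    convert this using 2 <;> simp [hwd]
  -- an isolated chord is born there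
  have s2 : Sim (withIndex (P ++ (A ++ x :: (B ++ [x.other])).map some ++ Q) J)
      (withIndex (P ++ (A ++ x :: (B ++ [x.other, y, y.other])).map some ++ Q) J) := by
    have := Sim.isolated (A := P ++ (A ++ x :: (B ++ [x.other])).map some) (B := Q) hJe (by
      have := hwf (A ++ x :: (B ++ [x.other, y, y.other])) (by
        simp only [← Multiset.coe_add, ← Multiset.cons_coe, ← Multiset.singleton_add,
          Multiset.coe_nil, add_zero]
        abel)
      convert this using 2
      simp)
    convert this using 2
    simp
  have s3 : Sim (withIndex (P ++ (A ++ x :: (B ++ [x.other, y, y.other])).map some ++ Q) J)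
      (withIndex (P ++ ((A ++ x :: (B ++ [y])) ++ [y.other, x.other]).map some ++ Q) J) := by
    have := Sim.move_right (A := P ++ (A ++ x :: B).map some) (x := x.other) (m := [y, y.other])
      (B := Q) (by simp [hyz, hx.symm]) J (by
      have := hwf (A ++ x :: (B ++ [x.other, y, y.other])) (by
        simp only [← Multiset.coe_add, ← Multiset.cons_coe, ← Multiset.singleton_add,
          Multiset.coe_nil, add_zero]
        abel)
      convert this using 2
      simp)
    convert this using 2 <;> simp
  -- the word `y.other, x.other` of sign sum zero moves past the base point
  have s4 : Sim (withIndex (P ++ ((A ++ x :: (B ++ [y])) ++ [y.other, x.other]).map some ++ Q) J)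
      (withIndex (P ++ ([y.other, x.other] ++ (A ++ x :: (B ++ [y]))).map some ++ Q) J) := by
    have hm : signSum [y.other, x.other] = 0 := by
      simp [hyx]
    refine Sim.rotate hc (hwf _ ?_) ?_ ?_
    · simp only [← Multiset.coe_add, ← Multiset.cons_coe, ← Multiset.singleton_add,
        Multiset.coe_nil, add_zero]
      abel
    · rw [signSum_append, hm]
      simp [hyx]
      linarith
    · intro e _ _
      simp [hm]
  have s5 : Sim (withIndex (P ++ ([y.other, x.other] ++ (A ++ x :: (B ++ [y]))).map some ++ Q) J)
      (withIndex (P ++ (y.other :: (A ++ x.other :: x :: (B ++ [y]))).map some ++ Q) J) := by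
    have := Sim.move_right (A := P ++ [y.other].map some) (x := x.other) (m := A)
      (B := (x :: (B ++ [y])).map some ++ Q) (fun f hf => (hA f hf).1) J (by
      have := hwf ([y.other, x.other] ++ (A ++ x :: (B ++ [y]))) (by
        simp only [← Multiset.coe_add, ← Multiset.cons_coe, ← Multiset.singleton_add,
          Multiset.coe_nil, add_zero]
        abel)
      convert this using 2
      simp)
    convert this using 2 <;> simp
  have s6 : Sim (withIndex (P ++ (y.other :: (A ++ x.other :: x :: (B ++ [y]))).map some ++ Q) J)
      (withIndex (P ++ (A ++ x.other :: x :: (B ++ [y.other, y])).map some ++ Q) J) := by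
    have := Sim.move_right (A := P) (x := y.other) (m := A ++ x.other :: x :: B)
      (B := [y].map some ++ Q) (fun f hf => by
        simp only [List.mem_append, List.mem_cons] at hf
        rcases hf with hf | rfl | rfl | hf
        · exact (hA f hf).2
        · exact hx
        · exact hx
        · exact (hB f hf).2) J (by
      have := hwf (y.other :: (A ++ x.other :: x :: (B ++ [y]))) (by
        simp only [← Multiset.coe_add, ← Multiset.cons_coe, ← Multiset.singleton_add,
          Multiset.coe_nil, add_zero]
        abel)
      convert this using 2
      simp)
    convert this using 2 <;> simp
  have s7 : Sim (withIndex (P ++ (A ++ x.other :: x :: B).map some ++ Q) J)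
      (withIndex (P ++ (A ++ x.other :: x :: (B ++ [y.other, y])).map some ++ Q) J) := by
    have := Sim.isolated (A := P ++ (A ++ x.other :: x :: B).map some) (B := Q) (e := y.other)
      (I := J) hJe (by
      have := hwf (A ++ x.other :: x :: (B ++ [y.other, y])) (by
        simp only [← Multiset.coe_add, ← Multiset.cons_coe, ← Multiset.singleton_add,
          Multiset.coe_nil, add_zero]
        abel)
      convert this using 2
      simp)
    convert this using 2
    simp
  exact (((((s1.trans s2).trans s3).trans s4).trans s5).trans s6).trans s7.symm

/-- With the indices of the chords prescribed, the order of the endpoints on a circle is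
irrelevant. -/
lemma Sim.perm_circle {P Q : BarWord} (hc : IsCircle P Q) {l l' : List Endpoint} (hp : l.Perm l')
    (hw : WellFormed (P ++ l.map some ++ Q).reduceOption) (h0 : signSum l = 0) (I : ℕ → ℤ) :
    Sim (withIndex (P ++ l.map some ++ Q) I) (withIndex (P ++ l'.map some ++ Q) I) := by
  have key : ∀ pre : List Endpoint, WellFormed (P ++ (pre ++ l).map some ++ Q).reduceOption →
      signSum (pre ++ l) = 0 → Sim (withIndex (P ++ (pre ++ l).map some ++ Q) I)
        (withIndex (P ++ (pre ++ l').map some ++ Q) I) := by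
    clear hw h0
    induction hp with
    | nil => exact fun pre hw _ => Sim.withIndex_refl hw I
    | cons x _ ih =>
      intro pre hw h0
      simpa using ih (pre ++ [x]) (by simpa using hw) (by simpa using h0)
    | swap x y l =>
      intro pre hw h0
      by_cases hxy : x.chord = y.chord
      · have hnd : (y :: x :: l).Nodup := by
          have hnd := hw.1
          rw [reduceOption_frame] at hnd
          exact ((hnd.of_append_left).of_append_right).of_append_right
        have hne : x ≠ y := fun h => by
          rw [h] at hnd
          exact (List.nodup_cons.1 hnd).1 List.mem_cons_self
        have hy : y ∈ (P ++ (pre ++ y :: x :: l).map some ++ Q).reduceOption := by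
          rw [reduceOption_frame]; simp
        have hx : x ∈ (P ++ (pre ++ y :: x :: l).map some ++ Q).reduceOption := by
          rw [reduceOption_frame]; simp
        have h := (hw.eq_or_eq_other hy hx hxy).resolve_left hne
        rw [h] at hw h0 ⊢
        exact Sim.flip hc hw h0 I
      · have e : ∀ a b : Endpoint, P ++ (pre ++ a :: b :: l).map some ++ Q =
            (P ++ pre.map some) ++ some a :: some b :: (l.map some ++ Q) := fun a b => by
          simp only [List.map_append, List.map_cons, List.append_assoc, List.cons_append]
        rw [e] at hw ⊢
        rw [e]
        exact Sim.swap (Ne.symm hxy) hw I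
    | trans h1 h2 ih1 ih2 =>
      intro pre hw h0
      refine (ih1 pre hw h0).trans (ih2 pre (hw.frame_perm (h1.append_left _)) ?_)
      rw [← h0]
      exact signSum_perm (h1.append_left _).symm
  exact key [] hw h0

/-- The word with a bar that describes two circles. -/
def barWord (u v : List Endpoint) : BarWord := u.map some ++ none :: v.map some

lemma reduceOption_barWord (u v : List Endpoint) : (barWord u v).reduceOption = u ++ v := by
  simp [barWord, List.reduceOption_append, List.reduceOption_cons_of_none]

/-- With the indices of the chords prescribed, only the set of the endpoints on each circle matters. -/
lemma Sim.perm {u v u' v' : List Endpoint} (hu : u.Perm u') (hv : v.Perm v')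
    (hw : WellFormed (u ++ v)) (h0 : signSum u = 0) (h1 : signSum v = 0) (I : ℕ → ℤ) :
    Sim (withIndex (barWord u v) I) (withIndex (barWord u' v') I) := by
  have hw' : WellFormed (u' ++ v) := hw.perm (hu.append_right _)
  have s1 := Sim.perm_circle (P := []) (Q := none :: v.map some) (Or.inl ⟨rfl, v, rfl⟩) hu
    (by rw [← reduceOption_barWord] at hw; exact hw) h0 I
  have s2 := Sim.perm_circle (P := u'.map some ++ [none]) (Q := []) (Or.inr ⟨⟨u', rfl⟩, rfl⟩) hv
    (by rw [← reduceOption_barWord] at hw'; simpa [barWord] using hw') h1 I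
  refine s1.trans ?_
  simpa [barWord] using s2

/-! ### Diagrams without shells -/

lemma splitBar_map {α β : Type*} (f : α → β) (w : List (Option α)) :
    splitBar (w.map (Option.map f)) = ((splitBar w).1.map f, (splitBar w).2.map f) := by
  induction w with
  | nil => rfl
  | cons a w ih =>
    cases a with
    | none =>
      simp only [List.map_cons, Option.map_none, splitBar, List.map_nil]
      rw [List.reduceOption_map]
    | some a => simp [splitBar, ih]

lemma withShells_eq_map {κ : Endpoint → ℤ} {w : BarWord} (h : ∀ e ∈ w.reduceOption, κ e = 0) :
    withShells κ w = w.map (Option.map core) := by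
  rw [withShells_congr (κ' := fun _ => 0) h]
  induction w with
  | nil => rfl
  | cons a w ih =>
    rw [← List.singleton_append, withShells_append, ih, List.singleton_append, List.map_cons]
    · cases a <;> simp [withShells, expandWord]
    · intro e he
      exact h e (by
        rw [List.reduceOption_mem_iff] at he ⊢
        exact List.mem_cons_of_mem _ he)

/-- No shells are needed if each chord has the index given by its position. -/
lemma Sim.withIndex_of_height {w : BarWord} (hw : WellFormed w.reduceOption) {I : ℕ → ℤ}
    (hI : ∀ e ∈ w.reduceOption, e.terminal = true →
      heightIn w.reduceOption e - heightIn w.reduceOption e.other = I e.chord) :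
    Sim w (withIndex w I) := by
  have e1 : withIndex w I = w.map (Option.map core) :=
    withShells_eq_map fun e he => stackFor_eq_zero (hI e he)
  have h2 : WellFormed (withIndex w I).reduceOption := hw.withShells _
  rw [e1] at h2 ⊢
  set s := (w.reduceOption.map chord).toFinset with hs
  obtain ⟨σ, hσ⟩ := Equiv.Perm.exists_extending_pair (fun c : s => (c : ℕ))
    (fun c : s => coreName c) Subtype.val_injective fun a b h => Subtype.ext (by simpa using h)
  have hσ' : ∀ e ∈ w.reduceOption, rename σ e = core e := fun e he => by
    have hc : e.chord ∈ s := by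
      rw [hs, List.mem_toFinset]
      exact List.mem_map_of_mem he
    have := hσ ⟨e.chord, hc⟩
    simp only at this
    simp [rename, core, this]
  rw [← splitBar_append] at hσ'
  refine .of_iso hw h2 σ ?_ ?_
  · rw [splitBar_map]
    refine ⟨0, ?_⟩
    rw [List.rotate_zero]
    exact List.map_congr_left fun e he => hσ' e (List.mem_append_left _ he)
  · rw [splitBar_map]
    refine ⟨0, ?_⟩
    rw [List.rotate_zero]
    exact List.map_congr_left fun e he => hσ' e (List.mem_append_right _ he)

lemma WellFormed.exists_chord_fun {l : List Endpoint} (h : WellFormed l) (g : Endpoint → ℤ) :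
    ∃ I : ℕ → ℤ, ∀ e ∈ l, e.terminal = true → I e.chord = g e := by
  classical
  refine ⟨fun c => if hc : ∃ e ∈ l, e.terminal = true ∧ e.chord = c then g hc.choose else 0,
    fun e he ht => ?_⟩
  have hc : ∃ f ∈ l, f.terminal = true ∧ f.chord = e.chord := ⟨e, he, ht, rfl⟩
  simp only [dif_pos hc]
  congr 1
  exact h.eq_of_chord_terminal hc.choose_spec.1 he hc.choose_spec.2.2
    (hc.choose_spec.2.1.trans ht.symm)

/-! ### Change of the indices of the nonself-chords -/

/-- One endpoint of a new isolated chord is moved once around the first circle.  The base point passes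
this endpoint, which changes the heights on this circle by its sign. -/
lemma Sim.shift_unit {u v : List Endpoint} (hw : WellFormed (u ++ v)) (h0 : signSum u = 0)
    (s : ℤˣ) {I J : ℕ → ℤ}
    (hJ : ∀ e ∈ u ++ v, e.terminal = true → J e.chord = I e.chord +
      (if e ∈ u then (s : ℤ) else 0) - if e.other ∈ u then (s : ℤ) else 0) :
    Sim (withIndex (barWord u v) I) (withIndex (barWord u v) J) := by
  obtain ⟨z, hz⟩ := Sim.exists_fresh (u ++ v)
  set y : Endpoint := ini z s with hy
  have hys : y.other.endSign = s := by simp [hy, endSign, ini, other]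
  have hyu : y ∉ u := fun h => hz y (List.mem_append_left _ h) rfl
  have hyu' : y.other ∉ u := fun h => hz y.other (List.mem_append_left _ h) rfl
  have hcongr : ∀ I : ℕ → ℤ, withIndex (barWord u v) I =
      withIndex (barWord u v) (Function.update I z 0) := fun I => by
    refine withIndex_congr fun f hf => ?_
    rw [reduceOption_barWord] at hf
    simp [hz f hf]
  have hwf : ∀ l : List Endpoint, l.Perm (y :: y.other :: u) →
      WellFormed (l.map some ++ none :: v.map some).reduceOption := fun l hl => by
    refine (hw.cons_pair (e := y) hz).perm ?_
    rw [List.reduceOption_append, List.reduceOption_cons_of_none, reduceOption_map_some,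
      reduceOption_map_some]
    exact (hl.symm.append_right v)
  rw [hcongr I, hcongr J]
  set I' := Function.update I z 0 with hI'
  set J' := Function.update J z 0 with hJ'
  have s1 : Sim (withIndex (barWord u v) I') (withIndex (barWord (u ++ [y, y.other]) v) I') := by
    have := Sim.isolated (A := u.map some) (B := none :: v.map some) (e := y) (I := I')
      (by simp [hI', hy]) (by
        rw [← List.map_append]
        exact hwf _ List.perm_append_comm)
    simpa [barWord] using this
  have s2 : Sim (withIndex (barWord ((u ++ [y]) ++ [y.other]) v) I')
      (withIndex (barWord ([y.other] ++ (u ++ [y])) v) J') := by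
    have hp : ((u ++ [y]) ++ [y.other]).Perm (y :: y.other :: u) := by
      rw [List.append_assoc]
      exact List.perm_append_comm
    refine Sim.rotate (P := []) (Q := none :: v.map some) (Or.inl ⟨rfl, v, rfl⟩) (hwf _ hp) ?_ ?_
    · rw [signSum_perm hp]
      simpa using h0
    · intro e he ht
      have hm : ∀ e, (e ∈ (u ++ [y]) ++ [y.other]) = (e = y ∨ e = y.other ∨ e ∈ u) := fun e => by
        rw [hp.mem_iff]; simp
      simp only [hm]
      have hsm : signSum [y.other] = s := by simp [← hys]
      rw [hsm]
      have he' : e ∈ y :: y.other :: (u ++ v) := by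
        rw [reduceOption_frame] at he
        have he'' : e ∈ ((u ++ [y]) ++ [y.other]) ++ v := by
          simpa [List.reduceOption_cons_of_none] using he
        exact (hp.append_right v).mem_iff.1 he''
      rcases List.mem_cons.1 he' with rfl | he'
      · simp [hy, ini] at ht
      rcases List.mem_cons.1 he' with rfl | he'
      · simp [hI', hJ', hy]
      · have hez := hz e he'
        have n1 : e ≠ y := fun h => hez (by rw [h]; rfl)
        have n2 : e ≠ y.other := fun h => hez (by rw [h]; rfl)
        have n3 : e.other ≠ y := fun h => hez (by rw [← other_chord, h]; rfl)
        have n4 : e.other ≠ y.other := fun h => n1 (other_injective h)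
        simp only [hI', hJ', Function.update_of_ne hez, n1, n2, n3, n4, false_or]
        exact hJ e he' ht
  have s3 : Sim (withIndex (barWord ([y.other] ++ (u ++ [y])) v) J')
      (withIndex (barWord (u ++ [y.other, y]) v) J') := by
    have := Sim.move_right (A := []) (x := y.other) (m := u) (B := [y].map some ++ none :: v.map some)
      (fun f hf => hz f (List.mem_append_left _ hf)) J' (by
        have := hwf ([y.other] ++ (u ++ [y])) (by
          rw [← List.append_assoc]
          exact List.perm_append_comm)
        simpa using this)
    simpa [barWord] using this
  have s4 : Sim (withIndex (barWord u v) J') (withIndex (barWord (u ++ [y.other, y]) v) J') := by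
    have := Sim.isolated (A := u.map some) (B := none :: v.map some) (e := y.other) (I := J')
      (by simp [hJ', hy]) (by
        rw [← List.map_append, other_other]
        exact hwf _ (List.perm_append_comm.trans (List.Perm.swap _ _ _)))
    simpa [barWord] using this
  refine s1.trans (Sim.trans ?_ (s3.trans s4.symm))
  simpa using s2

/-- The indices of the chords from the second to the first circle can be raised if those of the
chords from the first to the second circle are lowered: an endpoint of an isolated chord is moved
once around the first circle. -/
lemma Sim.shift {u v : List Endpoint} (hw : WellFormed (u ++ v)) (h0 : signSum u = 0)
    {f : ℕ → ℤ} (hf : ∀ e ∈ u ++ v, e.terminal = true → f e.chord =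
      (if e ∈ u then 1 else 0) - if e.other ∈ u then 1 else 0) (k : ℤ) (I : ℕ → ℤ) :
    Sim (withIndex (barWord u v) I) (withIndex (barWord u v) fun c => I c + k * f c) := by
  induction k using Int.induction_on with
  | zero =>
    rw [← reduceOption_barWord] at hw
    simpa using Sim.withIndex_refl hw I
  | succ k ih =>
    refine ih.trans (Sim.shift_unit hw h0 1 fun e he ht => ?_)
    simp only [hf e he ht]
    split_ifs <;> simp <;> ring
  | pred k ih =>
    refine ih.trans (Sim.shift_unit hw h0 (-1) fun e he ht => ?_)
    simp only [hf e he ht]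
    split_ifs <;> simp <;> ring

/-! ### Lists of chords -/

/-- A chord from circle `src` to circle `tgt` with a prescribed index. -/
structure IndexedChord where
  name : ℕ
  src : Fin 2
  tgt : Fin 2
  sign : ℤˣ
  index : ℤ

namespace IndexedChord

/-- The endpoints on circle `k` of the chords in a list. -/
def endsOn (S : List IndexedChord) (k : Fin 2) : List Endpoint :=
  S.flatMap fun c => (if c.src = k then [ini c.name c.sign] else []) ++
    if c.tgt = k then [ter c.name c.sign] else []

/-- The word with a bar in which the chords of a list appear one after the other. -/
def wordOf (S : List IndexedChord) : BarWord := barWord (endsOn S 0) (endsOn S 1)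

/-- The index of the chord with a given name. -/
def indexOf (S : List IndexedChord) (n : ℕ) : ℤ :=
  ((S.find? fun c => decide (c.name = n)).map index).getD 0

/-- The diagram with shells in which each chord of a list has its prescribed index. -/
def formOf (S : List IndexedChord) : BarWord := withIndex (wordOf S) (indexOf S)

/-- Distinct chords in the list have distinct names. -/
def NodupNames (S : List IndexedChord) : Prop := (S.map name).Nodup

lemma NodupNames.perm {S T : List IndexedChord} (h : NodupNames S) (hp : S.Perm T) : NodupNames T :=
  (hp.map _).nodup_iff.1 h

lemma NodupNames.of_append_right {S T : List IndexedChord} (h : NodupNames (S ++ T)) :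
    NodupNames T := by
  unfold NodupNames at h
  rw [List.map_append] at h
  exact List.Nodup.of_append_right h

lemma indexOf_of_mem {S : List IndexedChord} (hS : NodupNames S) {c : IndexedChord} (hc : c ∈ S) :
    indexOf S c.name = c.index := by
  induction S with
  | nil => simp at hc
  | cons d S ih =>
    simp only [NodupNames, List.map_cons, List.nodup_cons, List.mem_map, not_exists, not_and] at hS
    rcases List.mem_cons.1 hc with rfl | hc
    · simp [indexOf]
    · have hne : d.name ≠ c.name := fun h => hS.1 c hc h.symm
      have := ih hS.2 hc
      rw [← this]
      simp [indexOf, hne]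

lemma endsOn_cons (c : IndexedChord) (S : List IndexedChord) (k : Fin 2) :
    endsOn (c :: S) k = ((if c.src = k then [ini c.name c.sign] else []) ++
      if c.tgt = k then [ter c.name c.sign] else []) ++ endsOn S k := rfl

lemma mem_endsOn {S : List IndexedChord} {k : Fin 2} {f : Endpoint} :
    f ∈ endsOn S k ↔ ∃ c ∈ S, (c.src = k ∧ f = ini c.name c.sign) ∨
      (c.tgt = k ∧ f = ter c.name c.sign) := by
  simp only [endsOn, List.mem_flatMap, List.mem_append]
  refine exists_congr fun c => and_congr_right fun _ => ?_
  split_ifs <;> simp_all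

lemma endsOn_perm (S : List IndexedChord) :
    (endsOn S 0 ++ endsOn S 1).Perm (chordEnds (S.map fun c => (c.name, c.sign))) := by
  refine perm_of_multiset ?_
  induction S with
  | nil => rfl
  | cons c S ih =>
    have h1 : (chordEnds ((c :: S).map fun c => (c.name, c.sign)) : Multiset Endpoint) =
        {ini c.name c.sign} + {ter c.name c.sign} + chordEnds (S.map fun c => (c.name, c.sign)) :=
      rfl
    rw [h1, ← ih]
    rcases c with ⟨n, i, j, s, x⟩
    simp only [endsOn_cons]
    fin_cases i <;> fin_cases j <;>
      simp [← Multiset.coe_add, ← Multiset.cons_coe, ← Multiset.singleton_add] <;> abel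

lemma NodupNames.wellFormed {S : List IndexedChord} (h : NodupNames S) :
    WellFormed (endsOn S 0 ++ endsOn S 1) := by
  refine WellFormed.perm ?_ (endsOn_perm S).symm
  have h0 : WellFormed ([] : List Endpoint) := ⟨by simp, by simp, by simp⟩
  have := h0.chordEnds_append (c := S.map fun c => (c.name, c.sign))
    (by rw [List.map_map]; exact h) (by simp)
  simpa using this

lemma NodupNames.wellFormed_wordOf {S : List IndexedChord} (h : NodupNames S) :
    WellFormed (wordOf S).reduceOption := by
  rw [wordOf, reduceOption_barWord]
  exact h.wellFormed

lemma formOf_eq {S : List IndexedChord} (h : NodupNames S) {I : ℕ → ℤ}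
    (hI : ∀ c ∈ S, I c.name = c.index) : formOf S = withIndex (wordOf S) I := by
  refine withIndex_congr fun e he => ?_
  rw [wordOf, reduceOption_barWord, List.mem_append, mem_endsOn, mem_endsOn] at he
  rcases he with ⟨c, hc, h'⟩ | ⟨c, hc, h'⟩ <;> rcases h' with ⟨-, rfl⟩ | ⟨-, rfl⟩ <;>
    exact (indexOf_of_mem h hc).trans (hI c hc).symm

/-- The number `1` for a chord from the second to the first circle, `-1` for a chord from the first
to the second circle, and `0` for self-chords. -/
def crossing (c : IndexedChord) : ℤ := (if c.tgt = 0 then 1 else 0) - if c.src = 0 then 1 else 0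

/-- The contribution of a chord to the sum of the signs on the first circle. -/
def flux (c : IndexedChord) : ℤ := c.sign * c.crossing

/-- The signs of the endpoints on each circle add up to zero. -/
def IsBalanced (S : List IndexedChord) : Prop := (S.map flux).sum = 0

lemma IsBalanced.perm {S T : List IndexedChord} (h : IsBalanced S) (hp : S.Perm T) :
    IsBalanced T := by
  rw [IsBalanced, ← h]
  exact (hp.map _).symm.sum_eq

lemma signSum_endsOn (S : List IndexedChord) :
    signSum (endsOn S 0) = (S.map flux).sum ∧ signSum (endsOn S 1) = -(S.map flux).sum := by
  induction S with
  | nil => simp [endsOn]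
  | cons c S ih =>
    simp only [endsOn_cons, signSum_append, ih.1, ih.2, List.map_cons, List.sum_cons]
    rcases c with ⟨n, i, j, s, x⟩
    fin_cases i <;> fin_cases j <;> simp [flux, crossing, endSign, ini, ter] <;> ring

lemma IsBalanced.signSum_zero {S : List IndexedChord} (h : IsBalanced S) :
    signSum (endsOn S 0) = 0 := by rw [(signSum_endsOn S).1, h]

lemma IsBalanced.signSum_one {S : List IndexedChord} (h : IsBalanced S) :
    signSum (endsOn S 1) = 0 := by rw [(signSum_endsOn S).2, h, neg_zero]

/-- The order of the endpoints on the circles is irrelevant. -/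
lemma sim_barWord {S : List IndexedChord} (hn : NodupNames S) (hb : IsBalanced S)
    {u v : List Endpoint} (hu : (endsOn S 0).Perm u) (hv : (endsOn S 1).Perm v) :
    Sim (formOf S) (withIndex (barWord u v) (indexOf S)) :=
  Sim.perm hu hv hn.wellFormed hb.signSum_zero hb.signSum_one _

lemma sim_of_perm {S T : List IndexedChord} (hp : S.Perm T) (hn : NodupNames S)
    (hb : IsBalanced S) : Sim (formOf S) (formOf T) := by
  rw [formOf_eq (hn.perm hp) (I := indexOf S) fun c hc => indexOf_of_mem hn (hp.mem_iff.2 hc)]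
  exact sim_barWord hn hb (hp.flatMap_right _) (hp.flatMap_right _)

/-! ### Cancellation of chords -/

/-- Two chords between the same circles, of equal index and of opposite signs, can be removed. -/
lemma sim_cancel {c d : IndexedChord} {S : List IndexedChord} (hn : NodupNames (c :: d :: S))
    (hb : IsBalanced (c :: d :: S)) (hsrc : d.src = c.src) (htgt : d.tgt = c.tgt)
    (hs : d.sign = -c.sign) (hi : d.index = c.index) :
    Sim (formOf S) (formOf (c :: d :: S)) := by
  have hnS : NodupNames S := NodupNames.of_append_right (S := [c, d]) hn
  have hI : indexOf (c :: d :: S) d.name = indexOf (c :: d :: S) c.name := by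
    rw [indexOf_of_mem hn (by simp), indexOf_of_mem hn (by simp), hi]
  have e1 : formOf S = withIndex (wordOf S) (indexOf (c :: d :: S)) :=
    formOf_eq hnS fun f hf => indexOf_of_mem hn (by simp [hf])
  set I := indexOf (c :: d :: S) with hId
  rw [e1]
  rcases c with ⟨n, i, j, s, z⟩
  rcases d with ⟨n', i', j', s', z'⟩
  simp only at hsrc htgt hs hi hI
  subst hsrc htgt hs hi
  set x := ini n s with hx
  set y := ini n' (-s) with hy
  have hxt : ter n s = x.other := rfl
  have hyt : ter n' (-s) = y.other := rfl
  have hwf := hn.wellFormed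
  -- after a reordering of the endpoints on the circles the chords are parallel
  have key : ∀ {u v : List Endpoint}, (endsOn (⟨n, i', j', s, z'⟩ :: ⟨n', i', j', -s, z'⟩ :: S) 0).Perm
      u → (endsOn (⟨n, i', j', s, z'⟩ :: ⟨n', i', j', -s, z'⟩ :: S) 1).Perm v →
      (WellFormed (barWord u v).reduceOption →
        Sim (withIndex (wordOf S) I) (withIndex (barWord u v) I)) →
      Sim (withIndex (wordOf S) I) (formOf (⟨n, i', j', s, z'⟩ :: ⟨n', i', j', -s, z'⟩ :: S)) := by
    intro u v hu hv h
    refine (h ?_).trans (sim_barWord hn hb hu hv).symm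
    rw [reduceOption_barWord]
    exact hwf.perm (hu.append hv)
  fin_cases i' <;> fin_cases j'
  · refine key (u := [x, y] ++ [x.other, y.other] ++ endsOn S 0) (v := endsOn S 1) ?_ ?_ ?_
    · simpa [endsOn_cons, hxt, hyt, ← hx, ← hy] using
        List.Perm.swap y x.other (y.other :: endsOn S 0)
    · simp [endsOn_cons]
    · intro hw
      have := Sim.parallel (A := []) (B := []) (C := wordOf S) (x := x) (y := y) rfl rfl
        (by simpa [barWord, wordOf] using hw) hI
      simpa [barWord, wordOf] using this
  · refine key (u := [x, y] ++ endsOn S 0) (v := [x.other, y.other] ++ endsOn S 1) ?_ ?_ ?_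
    · simp [endsOn_cons, ← hx, ← hy]
    · simp [endsOn_cons, hxt, hyt]
    · intro hw
      have := Sim.parallel (A := []) (B := (endsOn S 0).map some ++ [none])
        (C := (endsOn S 1).map some) (x := x) (y := y) rfl rfl
        (by simpa [barWord, wordOf] using hw) hI
      simpa [barWord, wordOf] using this
  · refine key (u := [x.other, y.other] ++ endsOn S 0) (v := [x, y] ++ endsOn S 1) ?_ ?_ ?_
    · simp [endsOn_cons, hxt, hyt]
    · simp [endsOn_cons, ← hx, ← hy]
    · intro hw
      have := Sim.parallel (A := []) (B := (endsOn S 0).map some ++ [none])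
        (C := (endsOn S 1).map some) (x := x.other) (y := y.other) rfl rfl
        (by simpa [barWord, wordOf] using hw) hI
      simpa [barWord, wordOf] using this
  · refine key (u := endsOn S 0) (v := [x, y] ++ [x.other, y.other] ++ endsOn S 1) ?_ ?_ ?_
    · simp [endsOn_cons]
    · simpa [endsOn_cons, hxt, hyt, ← hx, ← hy] using
        List.Perm.swap y x.other (y.other :: endsOn S 1)
    · intro hw
      have := Sim.parallel (A := (endsOn S 0).map some ++ [none]) (B := [])
        (C := (endsOn S 1).map some) (x := x) (y := y) rfl rfl
        (by simpa [barWord, wordOf] using hw) hI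
      simpa [barWord, wordOf] using this

/-- Self-chords of index `0` or `1` can be removed. -/
lemma sim_delete {c : IndexedChord} {S : List IndexedChord} (hn : NodupNames (c :: S))
    (hb : IsBalanced (c :: S)) (hc : ¬Essential c.src c.tgt c.index) :
    Sim (formOf S) (formOf (c :: S)) := by
  have hnS : NodupNames S := NodupNames.of_append_right (S := [c]) hn
  have hI : indexOf (c :: S) c.name = c.index := indexOf_of_mem hn (by simp)
  have e1 : formOf S = withIndex (wordOf S) (indexOf (c :: S)) :=
    formOf_eq hnS fun f hf => indexOf_of_mem hn (by simp [hf])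
  set I := indexOf (c :: S) with hId
  rw [e1]
  have hwf := hn.wellFormed
  obtain ⟨hst, h01⟩ : c.tgt = c.src ∧ (c.index = 0 ∨ c.index = 1) := by
    unfold Essential at hc
    push Not at hc
    exact ⟨hc.1.symm, or_iff_not_imp_left.2 hc.2⟩
  obtain ⟨x, hxc, hxs, hx⟩ : ∃ x : Endpoint, x.chord = c.name ∧ x.endSign = -1 ∧
      [ini c.name c.sign, ter c.name c.sign].Perm [x, x.other] := by
    rcases units_cases c.sign with h | h
    · exact ⟨ini c.name c.sign, rfl, by simp [endSign, ini, h], List.Perm.refl _⟩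
    · exact ⟨ter c.name c.sign, rfl, by simp [endSign, ter, h], List.Perm.swap _ _ _⟩
  have hiso : ∀ A B : BarWord, WellFormed (A ++ [x, x.other].map some ++ B).reduceOption →
      Sim (withIndex (A ++ B) I) (withIndex (A ++ [x, x.other].map some ++ B) I) := by
    intro A B hw
    rcases h01 with h | h
    · exact Sim.isolated (by rw [hxc, hI, h]) hw
    · exact Sim.isolated_one (by rw [hxc, hI, h]) hxs hw
  have key : ∀ {u v : List Endpoint}, (endsOn (c :: S) 0).Perm u → (endsOn (c :: S) 1).Perm v →
      (WellFormed (barWord u v).reduceOption →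
        Sim (withIndex (wordOf S) I) (withIndex (barWord u v) I)) →
      Sim (withIndex (wordOf S) I) (formOf (c :: S)) := by
    intro u v hu hv h
    refine (h ?_).trans (sim_barWord hn hb hu hv).symm
    rw [reduceOption_barWord]
    exact hwf.perm (hu.append hv)
  rcases (by omega : c.src = 0 ∨ c.src = 1) with h | h
  · refine key (u := [x, x.other] ++ endsOn S 0) (v := endsOn S 1) ?_ ?_ fun hw => ?_
    · simpa [endsOn_cons, hst, h] using hx.append_right _
    · simp [endsOn_cons, hst, h]
    · have := hiso [] (wordOf S) (by simpa [barWord, wordOf] using hw)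
      simpa [barWord, wordOf] using this
  · refine key (u := endsOn S 0) (v := [x, x.other] ++ endsOn S 1) ?_ ?_ fun hw => ?_
    · simp [endsOn_cons, hst, h]
    · simpa [endsOn_cons, hst, h] using hx.append_right _
    · have := hiso ((endsOn S 0).map some ++ [none]) ((endsOn S 1).map some)
        (by simpa [barWord, wordOf] using hw)
      simpa [barWord, wordOf] using this

/-- The sum of the signs of the chords from circle `i` to circle `j` of index `n`. -/
def coef (S : List IndexedChord) (i j : Fin 2) (n : ℤ) : ℤ :=
  (S.map fun c => if c.src = i ∧ c.tgt = j ∧ c.index = n then (c.sign : ℤ) else 0).sum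

lemma coef_cons (c : IndexedChord) (S : List IndexedChord) (i j : Fin 2) (n : ℤ) :
    coef (c :: S) i j n =
      (if c.src = i ∧ c.tgt = j ∧ c.index = n then (c.sign : ℤ) else 0) + coef S i j n := by
  simp [coef]

lemma coef_append (S T : List IndexedChord) (i j : Fin 2) (n : ℤ) :
    coef (S ++ T) i j n = coef S i j n + coef T i j n := by simp [coef]

lemma coef_perm {S T : List IndexedChord} (h : S.Perm T) (i j : Fin 2) (n : ℤ) :
    coef S i j n = coef T i j n := (h.map _).sum_eq

/-- If the coefficient of a chord vanishes, another chord of opposite sign contributes to it. -/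
lemma exists_opposite {c : IndexedChord} {S : List IndexedChord}
    (h : coef (c :: S) c.src c.tgt c.index = 0) :
    ∃ d ∈ S, d.src = c.src ∧ d.tgt = c.tgt ∧ d.sign = -c.sign ∧ d.index = c.index := by
  by_contra hno
  have key : ∀ T : List IndexedChord, (∀ d ∈ T, d ∈ S) →
      0 ≤ (c.sign : ℤ) * coef T c.src c.tgt c.index := by
    intro T hT
    induction T with
    | nil => simp [coef]
    | cons d T ih =>
      rw [coef_cons, mul_add]
      refine add_nonneg ?_ (ih fun e he => hT e (List.mem_cons_of_mem _ he))
      split_ifs with hd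
      · have hs : d.sign ≠ -c.sign := fun h' => hno ⟨d, hT d (by simp), hd.1, hd.2.1, h', hd.2.2⟩
        rcases units_cases c.sign with h1 | h1 <;> rcases units_cases d.sign with h2 | h2 <;>
          simp [h1, h2] at hs ⊢
      · simp
  have h1 := key S fun d hd => hd
  rw [coef_cons, if_pos ⟨rfl, rfl, rfl⟩] at h
  have h2 : (c.sign : ℤ) * c.sign + c.sign * coef S c.src c.tgt c.index = 0 := by
    rw [← mul_add, h, mul_zero]
  rw [unit_mul_self] at h2
  linarith

/-- Chords whose signs cancel for each essential index can be removed. -/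
lemma sim_remove {D S : List IndexedChord} (hn : NodupNames (D ++ S)) (hb : IsBalanced (D ++ S))
    (h : ∀ i j n, Essential i j n → coef D i j n = 0) : Sim (formOf S) (formOf (D ++ S)) := by
  obtain ⟨N, hN⟩ : ∃ N, D.length = N := ⟨_, rfl⟩
  induction N using Nat.strong_induction_on generalizing D with
  | _ N ih =>
    rcases D with _ | ⟨c, D⟩
    · exact Sim.withIndex_refl hn.wellFormed_wordOf _
    by_cases hc : Essential c.src c.tgt c.index
    · obtain ⟨d, hd, hsrc, htgt, hs, hi⟩ := exists_opposite (h _ _ _ hc)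
      obtain ⟨D', hp⟩ : ∃ D', D.Perm (d :: D') := by
        obtain ⟨A, B, rfl⟩ := List.append_of_mem hd
        exact ⟨A ++ B, List.perm_middle⟩
      have hp' : (c :: D ++ S).Perm (c :: d :: (D' ++ S)) := (hp.cons c).append_right S
      have hn' := hn.perm hp'
      have hb' := hb.perm hp'
      have hzero : flux c + flux d = 0 := by
        simp only [flux, crossing, hsrc, htgt, hs, Units.val_neg]
        ring
      refine (ih D'.length ?_ (D := D') ?_ ?_ ?_ rfl).trans
        ((sim_cancel hn' hb' hsrc htgt hs hi).trans (sim_of_perm hp' hn hb).symm)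
      · rw [← hN, List.length_cons, hp.length_eq, List.length_cons]
        omega
      · exact NodupNames.of_append_right (S := [c, d]) hn'
      · simp only [IsBalanced, List.map_cons, List.sum_cons] at hb' ⊢
        linarith
      · intro i j n hijn
        have h1 := h i j n hijn
        rw [coef_perm (hp.cons c), coef_cons, coef_cons, hsrc, htgt, hs, hi] at h1
        split_ifs at h1 with h2
        · simpa using h1
        · simpa using h1
    · have hzero : flux c = 0 := by
        unfold Essential at hc
        push Not at hc
        simp [flux, crossing, hc.1]
      refine (ih D.length ?_ (D := D) ?_ ?_ ?_ rfl).trans (sim_delete hn hb hc)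
      · rw [← hN, List.length_cons]
        omega
      · exact NodupNames.of_append_right (S := [c]) hn
      · simp only [IsBalanced, List.cons_append, List.map_cons, List.sum_cons] at hb ⊢
        linarith
      · intro i j n hijn
        have h1 := h i j n hijn
        rw [coef_cons, if_neg, zero_add] at h1
        · exact h1
        · rintro ⟨rfl, rfl, rfl⟩
          exact hc hijn

/-- A copy of the chords with other names, and with other signs if `s = -1`. -/
def copy (N : ℕ) (s : ℤˣ) (S : List IndexedChord) : List IndexedChord :=
  S.map fun c => ⟨c.name + N, c.src, c.tgt, s * c.sign, c.index⟩

lemma coef_copy (N : ℕ) (s : ℤˣ) (S : List IndexedChord) (i j : Fin 2) (n : ℤ) :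
    coef (copy N s S) i j n = s * coef S i j n := by
  induction S with
  | nil => simp [copy, coef]
  | cons c S ih =>
    have : copy N s (c :: S) = ⟨c.name + N, c.src, c.tgt, s * c.sign, c.index⟩ :: copy N s S := rfl
    rw [this, coef_cons, coef_cons, ih, mul_add]
    split_ifs <;> simp

lemma IsBalanced.copy {S : List IndexedChord} (h : IsBalanced S) (N : ℕ) (s : ℤˣ) :
    IsBalanced (copy N s S) := by
  have key : ((IndexedChord.copy N s S).map flux).sum = s * (S.map flux).sum := by
    clear h
    induction S with
    | nil => simp [IndexedChord.copy]
    | cons c S ih =>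
      have : IndexedChord.copy N s (c :: S) =
        ⟨c.name + N, c.src, c.tgt, s * c.sign, c.index⟩ :: IndexedChord.copy N s S := rfl
      rw [this, List.map_cons, List.sum_cons, ih, List.map_cons, List.sum_cons, mul_add]
      simp [flux, crossing, mul_assoc]
  rw [IsBalanced, key, h, mul_zero]

lemma IsBalanced.append {S T : List IndexedChord} (hS : IsBalanced S) (hT : IsBalanced T) :
    IsBalanced (S ++ T) := by
  unfold IsBalanced at *
  rw [List.map_append, List.sum_append, hS, hT, add_zero]

lemma exists_name_lt (S : List IndexedChord) : ∃ N, ∀ c ∈ S, c.name < N := by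
  induction S with
  | nil => exact ⟨0, by simp⟩
  | cons c S ih =>
    obtain ⟨N, hN⟩ := ih
    refine ⟨max N (c.name + 1), fun d hd => ?_⟩
    rcases List.mem_cons.1 hd with rfl | hd
    · omega
    · have := hN d hd
      omega

lemma NodupNames.copy_append {S T : List IndexedChord} (hS : NodupNames S) (hT : NodupNames T)
    {N : ℕ} (hN : ∀ c ∈ T, c.name < N) (s : ℤˣ) : NodupNames (copy N s S ++ T) := by
  unfold NodupNames at *
  have e : (copy N s S).map name = (S.map name).map (· + N) := by
    simp [copy, Function.comp_def]
  rw [List.map_append, e]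
  refine List.nodup_append.2 ⟨hS.map (add_left_injective N), hT, ?_⟩
  rintro a ha b hb rfl
  obtain ⟨m, -, rfl⟩ := List.mem_map.1 ha
  obtain ⟨c, hc, hcm⟩ := List.mem_map.1 hb
  have := hN c hc
  omega

/-- Two lists of chords without common names, for which the signs of the chords of each essential
index have the same sum. -/
lemma sim_of_disjoint {S T : List IndexedChord} (hn : NodupNames (S ++ T)) (hS : IsBalanced S)
    (hT : IsBalanced T) (h : ∀ i j n, Essential i j n → coef S i j n = coef T i j n) :
    Sim (formOf S) (formOf T) := by
  obtain ⟨N, hN⟩ := exists_name_lt (S ++ T)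
  -- `T` and its negative are inserted in `S`; then `S` cancels with the negative of `T`
  set U := copy N (-1) T with hU
  have hUb : IsBalanced U := hT.copy N (-1)
  have hUn : NodupNames (U ++ (S ++ T)) := hn.of_append_right.copy_append hn hN (-1)
  have hc : ∀ i j n, coef U i j n = -coef T i j n := fun i j n => by simp [hU, coef_copy]
  have p1 : (U ++ (S ++ T)).Perm ((U ++ T) ++ S) := by
    rw [List.append_assoc]
    exact List.perm_append_comm.append_left U
  have p2 : (U ++ (S ++ T)).Perm ((U ++ S) ++ T) := by rw [List.append_assoc]
  have hb := hUb.append (hS.append hT)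
  have s1 := sim_remove (hUn.perm p1) (hb.perm p1) fun i j n _ => by
    rw [coef_append, hc]; ring
  have s2 := sim_remove (hUn.perm p2) (hb.perm p2) fun i j n hijn => by
    rw [coef_append, hc, h i j n hijn]; ring
  exact s1.trans ((sim_of_perm (p1.symm.trans p2) (hUn.perm p1) (hb.perm p1)).trans s2.symm)

/-- The S-equivalence class depends only on the coefficients. -/
lemma sim_of_coef {S T : List IndexedChord} (hS : NodupNames S) (hT : NodupNames T)
    (hSb : IsBalanced S) (hTb : IsBalanced T)
    (h : ∀ i j n, Essential i j n → coef S i j n = coef T i j n) : Sim (formOf S) (formOf T) := by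
  obtain ⟨N, hN⟩ := exists_name_lt (S ++ T)
  have hc : ∀ i j n, coef (copy N 1 T) i j n = coef T i j n := fun i j n => by simp [coef_copy]
  have hb := hTb.copy N 1
  have s1 := sim_of_disjoint (hT.copy_append hS (fun c hc => hN c (by simp [hc])) 1) hb hSb
    fun i j n hijn => by rw [hc, h i j n hijn]
  have s2 := sim_of_disjoint (hT.copy_append hT (fun c hc => hN c (by simp [hc])) 1) hb hTb
    fun i j n _ => hc i j n
  exact s1.symm.trans s2

/-! ### Change of the indices of the nonself-chords, for lists of chords -/

/-- The chords with the indices of the nonself-chords changed by `k` or `-k`, according to the type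
of the chord. -/
def reindex (k : ℤ) (S : List IndexedChord) : List IndexedChord :=
  S.map fun c => ⟨c.name, c.src, c.tgt, c.sign, c.index + k * c.crossing⟩

lemma endsOn_reindex (k : ℤ) (S : List IndexedChord) (i : Fin 2) :
    endsOn (reindex k S) i = endsOn S i := by
  simp [endsOn, reindex, List.flatMap_map]

lemma NodupNames.reindex {S : List IndexedChord} (h : NodupNames S) (k : ℤ) :
    NodupNames (reindex k S) := by
  unfold NodupNames IndexedChord.reindex at *
  rwa [List.map_map]

lemma IsBalanced.reindex {S : List IndexedChord} (h : IsBalanced S) (k : ℤ) :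
    IsBalanced (reindex k S) := by
  unfold IsBalanced IndexedChord.reindex at *
  rwa [List.map_map]

lemma coef_reindex (k : ℤ) (S : List IndexedChord) (i j : Fin 2) (n : ℤ) :
    coef (reindex k S) i j n =
      coef S i j (n - k * ((if j = 0 then 1 else 0) - if i = 0 then 1 else 0)) := by
  unfold coef reindex
  rw [List.map_map]
  refine congrArg List.sum (List.map_congr_left fun c _ => ?_)
  refine if_congr ?_ rfl rfl
  refine and_congr_right fun hi => and_congr_right fun hj => ?_
  rw [← hi, ← hj, eq_sub_iff_add_eq]
  rfl

lemma NodupNames.eq_of_name {S : List IndexedChord} (h : NodupNames S) {c d : IndexedChord}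
    (hc : c ∈ S) (hd : d ∈ S) (hcd : c.name = d.name) : c = d :=
  List.inj_on_of_nodup_map h hc hd hcd

lemma NodupNames.ini_mem_iff {S : List IndexedChord} (h : NodupNames S) {c : IndexedChord}
    (hc : c ∈ S) (k : Fin 2) : ini c.name c.sign ∈ endsOn S k ↔ c.src = k := by
  rw [mem_endsOn]
  refine ⟨?_, fun hk => ⟨c, hc, Or.inl ⟨hk, rfl⟩⟩⟩
  rintro ⟨d, hd, ⟨hk, he⟩ | ⟨-, he⟩⟩
  · rw [h.eq_of_name hc hd (congrArg Endpoint.chord he), hk]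
  · simp [ini, ter] at he

lemma NodupNames.ter_mem_iff {S : List IndexedChord} (h : NodupNames S) {c : IndexedChord}
    (hc : c ∈ S) (k : Fin 2) : ter c.name c.sign ∈ endsOn S k ↔ c.tgt = k := by
  rw [mem_endsOn]
  refine ⟨?_, fun hk => ⟨c, hc, Or.inr ⟨hk, rfl⟩⟩⟩
  rintro ⟨d, hd, ⟨-, he⟩ | ⟨hk, he⟩⟩
  · simp [ini, ter] at he
  · rw [h.eq_of_name hc hd (congrArg Endpoint.chord he), hk]

/-- A simultaneous change of the indices of the nonself-chords. -/
lemma sim_reindex {S : List IndexedChord} (hn : NodupNames S) (hb : IsBalanced S) (k : ℤ) :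
    Sim (formOf S) (formOf (reindex k S)) := by
  obtain ⟨f, hf⟩ := hn.wellFormed.exists_chord_fun fun e =>
    (if e ∈ endsOn S 0 then 1 else 0) - if e.other ∈ endsOn S 0 then 1 else 0
  have e1 : formOf (reindex k S) = withIndex (wordOf S) fun c => indexOf S c + k * f c := by
    have hw : wordOf (reindex k S) = wordOf S := by
      rw [wordOf, wordOf, endsOn_reindex, endsOn_reindex]
    rw [← hw]
    refine formOf_eq (hn.reindex k) fun d hd => ?_
    obtain ⟨c, hc, rfl⟩ := List.mem_map.1 hd
    have hmem : ter c.name c.sign ∈ endsOn S 0 ++ endsOn S 1 := by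
      rw [List.mem_append, hn.ter_mem_iff hc, hn.ter_mem_iff hc]
      omega
    have h1 : f c.name = _ := hf _ hmem rfl
    have h2 : (ter c.name c.sign).other = ini c.name c.sign := rfl
    rw [h2] at h1
    simp only [hn.ter_mem_iff hc, hn.ini_mem_iff hc] at h1
    simp only [indexOf_of_mem hn hc, h1, crossing]
  rw [e1]
  exact Sim.shift hn.wellFormed hb.signSum_zero hf k _

end IndexedChord

/-! ### The list of chords of a diagram -/

namespace GaussDiagram

open IndexedChord

variable (G : GaussDiagram 2)

/-- The chords of a Gauss diagram with their indices, which are differences of heights. -/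
def indexedChords : List IndexedChord :=
  ((G.circle 0 ++ G.circle 1).filter fun e => !e.terminal).map fun e =>
    ⟨e.chord, if e ∈ G.circle 0 then 0 else 1, if e.other ∈ G.circle 0 then 0 else 1, e.sign,
      heightIn (G.circle 0 ++ G.circle 1) e.other - heightIn (G.circle 0 ++ G.circle 1) e⟩

variable {G}

lemma ite_circle_eq {e : Endpoint} (he : e ∈ G.circle 0 ++ G.circle 1) (k : Fin 2) :
    (if e ∈ G.circle 0 then (0 : Fin 2) else 1) = k ↔ e ∈ G.circle k := by
  rcases List.mem_append.1 he with h | h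
  · have := not_mem_other_circle h
    fin_cases k <;> simp [h, this]
  · have : e ∉ G.circle 0 := fun h' => not_mem_other_circle h' h
    fin_cases k <;> simp [h, this]

lemma nodupNames_indexedChords : NodupNames G.indexedChords := by
  unfold NodupNames indexedChords
  rw [List.map_map]
  refine List.Nodup.map_on ?_ (G.wellFormed.1.filter _)
  intro e he f hf hef
  rw [List.mem_filter] at he hf
  refine G.wellFormed.eq_of_chord_terminal he.1 hf.1 hef ?_
  have h1 := he.2
  have h2 := hf.2
  simp only [Bool.not_eq_true'] at h1 h2
  rw [h1, h2]

lemma endsOn_indexedChords (k : Fin 2) : (endsOn G.indexedChords k).Perm (G.circle k) := by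
  have hnd : (endsOn G.indexedChords k).Nodup := by
    have := List.nodup_append.1 (nodupNames_indexedChords (G := G)).wellFormed.1
    fin_cases k
    · exact this.1
    · exact this.2.1
  refine (List.perm_ext_iff_of_nodup hnd (G.nodup_circle k)).2 fun f => ?_
  have hmem : ∀ e ∈ G.circle k, e ∈ G.circle 0 ++ G.circle 1 := fun e he => by
    fin_cases k <;> simp_all
  rw [mem_endsOn]
  constructor
  · rintro ⟨c, hc, h⟩
    obtain ⟨e, he, rfl⟩ := List.mem_map.1 hc
    rw [List.mem_filter, Bool.not_eq_true'] at he
    simp only [ite_circle_eq he.1, ite_circle_eq (G.wellFormed.2.2 e he.1)] at h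
    rcases h with ⟨h, rfl⟩ | ⟨h, rfl⟩
    · have : ini e.chord e.sign = e := by
        rw [ini, ← he.2]
      rwa [this]
    · have : ter e.chord e.sign = e.other := by
        rw [other, he.2]; rfl
      rwa [this]
  · intro hf
    have hf' := hmem f hf
    cases ht : f.terminal
    · refine ⟨_, List.mem_map.2 ⟨f, List.mem_filter.2 ⟨hf', by simp [ht]⟩, rfl⟩, Or.inl ⟨?_, ?_⟩⟩
      · exact (ite_circle_eq hf' k).2 hf
      · simp only
        rw [ini, ← ht]
    · have hfo := G.wellFormed.2.2 f hf'
      refine ⟨_, List.mem_map.2 ⟨f.other, List.mem_filter.2 ⟨hfo, by simp [ht]⟩, rfl⟩,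
        Or.inr ⟨?_, ?_⟩⟩
      · simp only [other_other]
        exact (ite_circle_eq hf' k).2 hf
      · simp only [other_chord, other_sign]
        rw [ter, ← ht]

lemma heightIn_circle (hb : G.Balanced) {k : Fin 2} {e : Endpoint} (he : e ∈ G.circle k) :
    heightIn (G.circle 0 ++ G.circle 1) e = heightIn (G.circle k) e := by
  unfold heightIn
  rw [before_append]
  fin_cases k
  · simp only [Fin.zero_eta] at he ⊢
    rw [if_pos he]
  · simp only [Fin.mk_one] at he ⊢
    rw [if_neg fun h => not_mem_other_circle h he, hb 0, zero_add]

lemma coef_indexedChords (hb : G.Balanced) (i j : Fin 2) (n : ℤ) :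
    IndexedChord.coef G.indexedChords i j n = G.coef i j n := by
  set g : Endpoint → ℤ := fun e =>
    if e ∈ G.circle i ∧ e.terminal = false ∧ e.other ∈ G.circle j ∧ G.baseIndex i j e = n then
      (e.sign : ℤ) else 0 with hg
  have h1 : IndexedChord.coef G.indexedChords i j n =
      ((G.circle 0 ++ G.circle 1).map g).sum := by
    unfold IndexedChord.coef indexedChords
    rw [List.map_map, sum_map_filter]
    refine congrArg List.sum (List.map_congr_left fun e he => ?_)
    simp only [Function.comp, ite_circle_eq he, ite_circle_eq (G.wellFormed.2.2 e he), hg]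
    cases ht : e.terminal
    · simp only [Bool.not_false, if_true, true_and]
      refine if_congr ?_ rfl rfl
      refine and_congr_right fun h1 => and_congr_right fun h2 => ?_
      rw [heightIn_circle hb h1, heightIn_circle hb h2]
      rfl
    · simp
  have h2 : G.coef i j n = ((G.circle i).map g).sum := by
    rw [coef_eq, sum_map_filter, chords, sum_map_filter]
    refine congrArg List.sum (List.map_congr_left fun e he => ?_)
    by_cases h3 : e.terminal = false ∧ e.other ∈ G.circle j
    · simp [hg, he, h3]
    · have h4 : ¬(e.terminal = false ∧ e.other ∈ G.circle j ∧ G.baseIndex i j e = n) :=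
        fun h => h3 ⟨h.1, h.2.1⟩
      simp [hg, h3, h4]
  have h3 : ∀ k, k ≠ i → ((G.circle k).map g).sum = 0 := by
    intro k hk
    refine List.sum_eq_zero fun x hx => ?_
    obtain ⟨e, he, rfl⟩ := List.mem_map.1 hx
    refine if_neg fun h => ?_
    have hki : (k = 0 ∧ i = 1) ∨ (k = 1 ∧ i = 0) := by omega
    rcases hki with ⟨rfl, rfl⟩ | ⟨rfl, rfl⟩
    · exact not_mem_other_circle he h.1
    · exact not_mem_other_circle h.1 he
  rw [h1, h2, List.map_append, List.sum_append]
  rcases (by omega : i = 0 ∨ i = 1) with rfl | rfl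
  · rw [h3 1 (by decide), add_zero]
  · rw [h3 0 (by decide), zero_add]

lemma isBalanced_indexedChords (hb : G.Balanced) : IsBalanced G.indexedChords := by
  rw [IsBalanced, ← (signSum_endsOn _).1, signSum_perm (endsOn_indexedChords 0), hb]

/-- A balanced diagram is S-equivalent to the normal form of its list of chords. -/
lemma sim_indexedChords (hb : G.Balanced) :
    Sim (barWord (G.circle 0) (G.circle 1)) (formOf G.indexedChords) := by
  have hw : WellFormed (barWord (G.circle 0) (G.circle 1)).reduceOption := by
    rw [reduceOption_barWord]; exact G.wellFormed
  refine (Sim.withIndex_of_height (I := indexOf G.indexedChords) hw fun e he ht => ?_).trans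
    (sim_barWord nodupNames_indexedChords (isBalanced_indexedChords hb) (endsOn_indexedChords 0)
      (endsOn_indexedChords 1)).symm
  rw [reduceOption_barWord] at he ⊢
  have := indexOf_of_mem nodupNames_indexedChords (List.mem_map.2 ⟨e.other, List.mem_filter.2
    ⟨G.wellFormed.2.2 e he, by simp [ht]⟩, rfl⟩ : _ ∈ G.indexedChords)
  simp only [other_chord, other_other] at this
  exact this.symm

lemma diagram_barWord (h : WellFormed (barWord (G.circle 0) (G.circle 1)).reduceOption) :
    (barWord (G.circle 0) (G.circle 1)).diagram h = G := by
  have hc : ((barWord (G.circle 0) (G.circle 1)).diagram h).circle = G.circle := by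
    funext i
    simp only [BarWord.diagram, barWord, splitBar_bar]
    fin_cases i <;> rfl
  cases G
  simpa only [BarWord.diagram, mk.injEq] using hc

/-- Diagrams with the same invariants are S-equivalent. -/
lemma sEquiv_of_coef {G' : GaussDiagram 2} (hb : G.Balanced) (hb' : G'.Balanced)
    (hself : ∀ i n, Essential i i n → G.coef i i n = G'.coef i i n) {k : ℤ}
    (hk : ∀ n, G'.coef 0 1 n = G.coef 0 1 (n - k) ∧ G'.coef 1 0 n = G.coef 1 0 (n + k)) :
    G.SEquiv G' := by
  have hB := isBalanced_indexedChords hb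
  have hN := nodupNames_indexedChords (G := G)
  have s2 := sim_of_coef (hN.reindex (-k)) (nodupNames_indexedChords (G := G')) (hB.reindex (-k))
    (isBalanced_indexedChords hb') fun i j n hn => by
      rw [coef_reindex, coef_indexedChords hb, coef_indexedChords hb']
      rcases (by omega : i = 0 ∨ i = 1) with rfl | rfl <;>
        rcases (by omega : j = 0 ∨ j = 1) with rfl | rfl
      · simpa using hself 0 n hn
      · rw [(hk n).1]; simp [sub_eq_add_neg]
      · rw [(hk n).2]; simp
      · simpa using hself 1 n hn
  obtain ⟨h, h', hs⟩ := (sim_indexedChords hb).trans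
    ((sim_reindex hN hB (-k)).trans (s2.trans (sim_indexedChords hb').symm))
  rwa [diagram_barWord, diagram_barWord] at hs

end GaussDiagram

end VirtualLinks

theorem theorem1p2 (L L' : VirtualLinks.VirtualLink 2) (G G' : VirtualLinks.GaussDiagram 2)
    (hG : VirtualLinks.IsDiagramOf G L) (hG' : VirtualLinks.IsDiagramOf G' L')
    (hlk : G.virtualLk = 0) (hlk' : G'.virtualLk = 0)
    (F F' : VirtualLinks.Gamma0) (hF : G.IsLinkingClass F) (hF' : G'.IsLinkingClass F') :
    L.SEquiv L' ↔
      (∀ n : ℤ, n ≠ 0 → n ≠ 1 → G.writhe 0 n = G'.writhe 0 n) ∧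
      (∀ n : ℤ, n ≠ 0 → n ≠ 1 → G.writhe 1 n = G'.writhe 1 n) ∧
      F = F' := by
  have hb := VirtualLinks.GaussDiagram.balanced_of_virtualLk hlk
  have hb' := VirtualLinks.GaussDiagram.balanced_of_virtualLk hlk'
  simp only [VirtualLinks.GaussDiagram.writhe_eq hb, VirtualLinks.GaussDiagram.writhe_eq hb',
    VirtualLinks.GaussDiagram.linkingClass_eq_iff hb hb' hF hF']
  constructor
  · intro h
    obtain ⟨d, hd⟩ := (h.gaussDiagram hG hG').sameInvariants.2 hb
    have hself : ∀ i n, n ≠ 0 → n ≠ 1 → G.coef i i n = G'.coef i i n := fun i n h0 h1 => by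
      rw [hd i i n fun _ => ⟨h0, h1⟩, sub_self, sub_zero]
    refine ⟨hself 0, hself 1, d 1 - d 0, fun n => ⟨?_, ?_⟩⟩
    · exact hd 0 1 n fun h => absurd h (by decide)
    · rw [hd 1 0 n fun h => absurd h (by decide)]
      congr 1
      ring
  · rintro ⟨h0, h1, k, hk⟩
    refine ⟨G, G', hG, hG', VirtualLinks.GaussDiagram.sEquiv_of_coef hb hb' (fun i n hn => ?_) hk⟩
    obtain ⟨hn0, hn1⟩ := hn rfl
    rcases (by omega : i = 0 ∨ i = 1) with rfl | rfl
    · exact h0 n hn0 hn1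
    · exact h1 n hn0 hn1
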